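/- **Notation.** Let $f\colon\mathbb{C}\to\mathbb{P}^n(\mathbb{C})$ be an entire (holomorphic) curve with a reduced representation $f=[f_0:\dots:f_n]$, i.e. the $f_i$ are entire functions without common zeros, and put $\|f(z)\|=\max_i|f_i(z)|$. Let $D=\{Q=0\}\subset\mathbb{P}^n(\mathbb{C})$ be a smooth hypersurface, where $Q$ is homogeneous of degree $d\ge 1$ and the gradient of $Q$ vanishes at no point of $\{Q=0\}\setminus\{0\}$. The Cartan order function of $f$ is $$T_f(r)=\frac1{2\pi}\int_0^{2\pi}\log\|f(re^{i\theta})\|\,d\theta,$$ and, if $f(\mathbb{C})\not\subset D$, the counting function of $f$ for $D$ truncated at level $1$ is $$N_f^{[1]}(r,D)=\int_1^r\Big(\sum_{|a|<t}\min\{1,\operatorname{ord}_a(Q\circ f)\}\Big)\frac{dt}{t}\qquad(r>1).$$ We write $S_f(r)$ for any real function of $r>0$ for which there is a constant $C$ such that, for every $\delta>0$, the inequality $S_f(r)\le C\log T_f(r)+\delta\log r$ holds for all $r>0$ outside a set of finite Lebesgue measure (which may depend on $\delta$). For integers $k,m\ge 0$ let $E^{GG}_{k,m}T^*_{\mathbb{P}^n(\mathbb{C})}(\log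 D)$ be the logarithmic Green–Griffiths bundle of jet differentials of order $k$ and weighted degree $m$ along $D$. A global section $\mathscr{P}$ of $E^{GG}_{k,m}T^*_{\mathbb{P}^n(\mathbb{C})}(\log D)\otimes\mathcal{O}_{\mathbb{P}^n(\mathbb{C})}(1)^{-\widetilde m}$ is an object that, around every point of $\mathbb{P}^n(\mathbb{C})$, in local coordinates $x_1,\dots,x_n$ in which $D$ is either empty or $\{x_1=0\}$, is a polynomial, with local holomorphic sections of $\mathcal{O}_{\mathbb{P}^n(\mathbb{C})}(1)^{-\widetilde m}$ as coefficients, in the jet-coordinates $x_i^{(j)}$ ($1\le j\le k$), where $x_1^{(j)}$ is replaced by $(\log x_1)^{(j)}$ if $D=\{x_1=0\}$, and is weighted homogeneous of degree $m$ when the jet-coordinates of order $j$ have weight $j$. It takes a value $\mathscr{P}(j_k(f))(z)$ in the fibre of $\mathcal{O}_{\mathbb{P}^n(\mathbb{C})}(1)^{-\widetilde m}$ at $f(z)$ for every $z$ with $f(z)\notin D$; the condition $\mathscr{P}(j_k(f))\not\equiv0$ means that this value is nonzero for some such $z$ (in particular $f(\mathbb{C})\not\subset D$). **Theorem.** Let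 $f\colon\mathbb{C}\to\mathbb{P}^n(\mathbb{C})$ be an entire curve, let $D\subset\mathbb{P}^n(\mathbb{C})$ be a smooth hypersurface and let $\widetilde m$ be a positive integer. If there exists a global logarithmic jet differential $$\mathscr{P}\in H^0\big(\mathbb{P}^n(\mathbb{C}),\,E^{GG}_{k,m}T^*_{\mathbb{P}^n(\mathbb{C})}(\log D)\otimes\mathcal{O}_{\mathbb{P}^n(\mathbb{C})}(1)^{-\widetilde m}\big)$$ such that $\mathscr{P}(j_k(f))\not\equiv 0$, then $$T_f(r)\le\frac{m}{\widetilde m}\,N_f^{[1]}(r,D)+S_f(r)\qquad(r>1).$$ -/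

import Mathlib

open scoped LinearAlgebra.Projectivization

noncomputable section

/-- Complex projective space `ℙⁿ(ℂ)`. -/
abbrev Pn (n : ℕ) : Type := ℙ ℂ (Fin (n + 1) → ℂ)

/-- The punctured cone in `ℂⁿ⁺¹ ∖ {0}` over a subset of `ℙⁿ(ℂ)`. -/
def cone {n : ℕ} (U : Set (Pn n)) : Set (Fin (n + 1) → ℂ) :=
  {v | ∃ h : v ≠ 0, Projectivization.mk ℂ v h ∈ U}

open Classical in
/-- The function `v ↦ φ [v]` on `ℂⁿ⁺¹ ∖ {0}` attached to a function on `ℙⁿ(ℂ)`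
(with the irrelevant value `0` at the origin). -/
def onCone {n : ℕ} {E : Type*} [Zero E] (φ : Pn n → E) (v : Fin (n + 1) → ℂ) : E :=
  if h : v ≠ 0 then φ (Projectivization.mk ℂ v h) else 0

/-- A map `g` from `ℂ` to `ℙⁿ(ℂ)` is holomorphic near `z₀`. -/
def HolomorphicCurveAt {n : ℕ} (g : ℂ → Pn n) (z₀ : ℂ) : Prop :=
  ∃ G : ℂ → Fin (n + 1) → ℂ, AnalyticAt ℂ G z₀ ∧
    ∀ᶠ z in nhds z₀, ∃ h : G z ≠ 0, Projectivization.mk ℂ (G z) h = g z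

/-- Entire holomorphic curves `ℂ → ℙⁿ(ℂ)`. -/
def IsEntireCurve {n : ℕ} (f : ℂ → Pn n) : Prop :=
  ∀ z, HolomorphicCurveAt f z

/-- `f = [F₀ : ⋯ : Fₙ]` with entire functions `Fᵢ` without common zeros. -/
def IsReducedRepresentation {n : ℕ} (F : ℂ → Fin (n + 1) → ℂ) (f : ℂ → Pn n) : Prop :=
  Differentiable ℂ F ∧ ∀ z, ∃ h : F z ≠ 0, Projectivization.mk ℂ (F z) h = f z

/-! ### Hypersurfaces -/

/-- The zero set in `ℙⁿ(ℂ)` of a (homogeneous) polynomial. -/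
def hypersurface {n : ℕ} (Q : MvPolynomial (Fin (n + 1)) ℂ) : Set (Pn n) :=
  {x | ∀ (v : Fin (n + 1) → ℂ) (h : v ≠ 0),
    Projectivization.mk ℂ v h = x → MvPolynomial.eval v Q = 0}

/-- `Q` is a homogeneous equation of degree `d ≥ 1` of a smooth hypersurface. -/
structure IsSmoothEquation {n : ℕ} (Q : MvPolynomial (Fin (n + 1)) ℂ) (d : ℕ) : Prop where
  homogeneous : Q.IsHomogeneous d
  one_le_degree : 1 ≤ d
  smooth : ∀ v : Fin (n + 1) → ℂ, v ≠ 0 → MvPolynomial.eval v Q = 0 →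
    ∃ i, MvPolynomial.eval v (MvPolynomial.pderiv i Q) ≠ 0

/-! ### Jets -/

/-- Local holomorphic coordinates on an open subset of `ℙⁿ(ℂ)`. -/
structure ProjChart (n : ℕ) where
  source : Set (Pn n)
  coord : Pn n → Fin n → ℂ
  isOpen_source : IsOpen (cone source)
  holomorphic : DifferentiableOn ℂ (onCone coord) (cone source)
  injOn : Set.InjOn coord source
  submersive : ∀ v ∈ cone source, Function.Surjective (fderiv ℂ (onCone coord) v)

/-- Germs of holomorphic maps `(ℂ, 0) → ℙⁿ(ℂ)`. -/
def CurveGerm (n : ℕ) : Type := {g : ℂ → Pn n // HolomorphicCurveAt g 0}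

/-- Two germs define the same `k`-jet if they have the same base point and the same Taylor
expansion up to order `k` in local coordinates around it. -/
def jetSetoid (n k : ℕ) : Setoid (CurveGerm n) where
  r g h := g.1 0 = h.1 0 ∧ ∀ c : ProjChart n, g.1 0 ∈ c.source → ∀ j ≤ k, ∀ i : Fin n,
    iteratedDeriv j (fun t => c.coord (g.1 t) i) 0 =
      iteratedDeriv j (fun t => c.coord (h.1 t) i) 0
  iseqv :=
    { refl := fun _ => ⟨rfl, fun _ _ _ _ _ => rfl⟩
      symm := fun H => ⟨H.1.symm, fun c hc j hj i => (H.2 c (H.1 ▸ hc) j hj i).symm⟩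
      trans := fun H K => ⟨H.1.trans K.1, fun c hc j hj i =>
        (H.2 c hc j hj i).trans (K.2 c (H.1 ▸ hc) j hj i)⟩ }

/-- The space `J_k(ℙⁿ(ℂ))` of `k`-jets of holomorphic germs. -/
def JetSpace (n k : ℕ) : Type := Quotient (jetSetoid n k)

/-- The `k`-jet of a germ. -/
def CurveGerm.jet {n : ℕ} (k : ℕ) (g : CurveGerm n) : JetSpace n k :=
  Quotient.mk (jetSetoid n k) g

theorem HolomorphicCurveAt.translate {n : ℕ} {f : ℂ → Pn n} {z : ℂ}
    (hf : HolomorphicCurveAt f z) : HolomorphicCurveAt (fun t => f (z + t)) 0 := by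
  obtain ⟨G, hG, hev⟩ := hf
  have hz : z + (0 : ℂ) = z := add_zero z
  refine ⟨fun t => G (z + t), ?_, ?_⟩
  · have hG' : AnalyticAt ℂ G (z + (0 : ℂ)) := by rwa [hz]
    exact hG'.fun_comp (analyticAt_const.add analyticAt_id)
  · have ht : Filter.Tendsto (fun t : ℂ => z + t) (nhds 0) (nhds z) := by
      have hc : Continuous fun t : ℂ => z + t := by fun_prop
      have h0 := hc.tendsto 0
      rwa [hz] at h0
    exact ht.eventually hev

/-- The `k`-jet `j_k(f)` of an entire curve at `z ∈ ℂ`, that is, of the germ `t ↦ f (z + t)`. -/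
def curveJet {n : ℕ} (k : ℕ) (f : ℂ → Pn n) (hf : IsEntireCurve f) (z : ℂ) : JetSpace n k :=
  CurveGerm.jet k ⟨fun t => f (z + t), (hf z).translate⟩

/-! ### Logarithmic jet differentials -/

/-- Local coordinates adapted to the hypersurface `D = {Q = 0}`: either `D` does not meet the
chart (`logIndex = none`), or `D` is given in the chart by the vanishing of one distinguished
coordinate (`logIndex = some i`). -/
structure LogChart {n : ℕ} (Q : MvPolynomial (Fin (n + 1)) ℂ) extends ProjChart n where
  logIndex : Option (Fin n)
  mem_hypersurface_iff : ∀ x ∈ source, x ∈ hypersurface Q ↔ ∃ i ∈ logIndex, coord x i = 0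

/-- The logarithmic jet-coordinates of a germ `g` with `g(0) ∉ D`. With `xᵢ = (i-th coordinate) ∘ g`,
the coordinate of index `(j, i)` is `(log xᵢ)^(j+1) = (xᵢ' / xᵢ)^(j)` at `0` if `i` is the
distinguished index, and `xᵢ^(j+1)` at `0` otherwise. -/
def LogChart.jetCoord {n : ℕ} {Q : MvPolynomial (Fin (n + 1)) ℂ} (c : LogChart Q) (k : ℕ)
    (g : CurveGerm n) (p : Fin k × Fin n) : ℂ :=
  if p.2 ∈ c.logIndex then
    iteratedDeriv (p.1 : ℕ) (logDeriv fun t => c.coord (g.1 t) p.2) 0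
  else
    iteratedDeriv ((p.1 : ℕ) + 1) (fun t => c.coord (g.1 t) p.2) 0

/-- Global sections of `E^{GG}_{k,m} T^*(log D) ⊗ 𝒪(1)^{-μ}` on `ℙⁿ(ℂ)`, where `D = {Q = 0}`.

Sections of `𝒪(1)^{-μ}` are functions on the cone that are homogeneous of degree `-μ`.
A section is recorded through its values `toFun ξ v` at the `k`-jets `ξ` based at points of
`ℙⁿ(ℂ) ∖ D` and at the vectors `v ≠ 0` on the line that is the base point of `ξ`
(other values play no role). Around every point of `ℙⁿ(ℂ)`, points of `D` included, it has to
be a polynomial in the logarithmic jet-coordinates, weighted homogeneous of degree `m`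
(the coordinates of order `j` having weight `j`), whose coefficients are holomorphic sections of
`𝒪(1)^{-μ}`. -/
structure LogJetDifferential {n : ℕ} (Q : MvPolynomial (Fin (n + 1)) ℂ) (k m μ : ℕ) where
  toFun : JetSpace n k → (Fin (n + 1) → ℂ) → ℂ
  local_form : ∀ x : Pn n, ∃ c : LogChart Q, x ∈ c.source ∧
    ∃ A : (Fin (n + 1) → ℂ) → MvPolynomial (Fin k × Fin n) ℂ,
      (∀ v ∈ cone c.source,
        (A v).IsWeightedHomogeneous (fun p : Fin k × Fin n => (p.1 : ℕ) + 1) m) ∧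
      (∀ α : (Fin k × Fin n) →₀ ℕ,
        DifferentiableOn ℂ (fun v => (A v).coeff α) (cone c.source)) ∧
      (∀ v ∈ cone c.source, ∀ a : ℂ, a ≠ 0 → A (a • v) = (a ^ μ)⁻¹ • A v) ∧
      ∀ g : CurveGerm n, g.1 0 ∈ c.source → g.1 0 ∉ hypersurface Q →
        ∀ (v : Fin (n + 1) → ℂ) (h : v ≠ 0), Projectivization.mk ℂ v h = g.1 0 →
          toFun (g.jet k) v = MvPolynomial.eval (c.jetCoord k g) (A v)

/-! ### Nevanlinna theory -/

/-- The Cartan order function `T_f(r)`, computed from a reduced representation `F` of `f`; the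
norm on `Fin (n + 1) → ℂ` is the maximum norm. -/
def orderFunction {n : ℕ} (F : ℂ → Fin (n + 1) → ℂ) (r : ℝ) : ℝ :=
  (2 * Real.pi)⁻¹ * ∫ θ in (0 : ℝ)..(2 * Real.pi), Real.log ‖F (circleMap 0 r θ)‖

/-- `n^{[K]}(t, E)` for the zero divisor `E` of an entire function `u ≢ 0`. -/
def truncatedDegree (K : ℕ∞) (u : ℂ → ℂ) (t : ℝ) : ℕ :=
  ∑ᶠ a ∈ Metric.ball (0 : ℂ) t, (min K (analyticOrderAt u a)).toNat

/-- `N_f^{[K]}(r, D)` for `D = {Q = 0}`, computed from a reduced representation `F` of `f`. -/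
def countingFunction {n : ℕ} (K : ℕ∞) (F : ℂ → Fin (n + 1) → ℂ)
    (Q : MvPolynomial (Fin (n + 1)) ℂ) (r : ℝ) : ℝ :=
  ∫ t in (1 : ℝ)..r, (truncatedDegree K (fun z => MvPolynomial.eval (F z) Q) t : ℝ) / t

/-- `S` is an error term `S_f(r)` relative to the order function `T = T_f`: there is a constant `C`
such that for every `δ > 0` one has `S(r) ≤ C log T(r) + δ log r` for all `r > 0` outside a set of
finite Lebesgue measure, which may depend on `δ`. -/
def IsSmallErrorTerm (T S : ℝ → ℝ) : Prop :=
  ∃ C : ℝ, ∀ δ : ℝ, 0 < δ → ∃ E : Set ℝ, MeasureTheory.volume E < ⊤ ∧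
    ∀ r : ℝ, 0 < r → r ∉ E → S r ≤ C * Real.log (T r) + δ * Real.log r

end

open Metric Filter Topology MeasureTheory

/-! Put u(z) = P(j_k f)(z), evaluated at the vector F(z). This is a meromorphic function on ℂ, and
the theorem compares two estimates for the circle average of log |u|.

From below, u has poles only at zeros of Q ∘ F. A logarithmic derivative has at most a simple pole
whatever the multiplicity of the zero, so a logarithmic jet-coordinate of weight j has a pole of
order at most j, and weighted homogeneity gives u poles of order at most m
(`LogJetDifferential.poleOrderLE_curveJet`). Jensen's formula then bounds the average of log |u|
below by a constant minus m times the counting function truncated at level 1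
(`LogJetDifferential.circleAverage_log_norm_ge`).

From above, homogeneity of degree -μ gives |u| ‖F‖^μ = |P(j_k f)| at G = F / F_l, where F_l is a
component of maximal modulus at the point, so that ‖G‖ = 1. Near each point of the compact unit
sphere, P is a polynomial in logarithmic jet-coordinates with bounded coefficients. Along D the
distinguished coordinate is Q times the exponential of a holomorphic function (`exists_eq_mul_exp`),
so everything is controlled by derivatives of the logarithmic derivatives of F_s / F_l and Q(F) /
F_l^d (`LogJetDifferential.exists_norm_mul_le`). Taking logarithms and averages, the average of log
|u| plus μ T_f is at most a constant plus a multiple of averages of log(1 + |(h'/h)^(j)|), with h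
among these quotients.

Those averages are error terms by the lemma on the logarithmic derivative
(`DominatedBy.isSmallErrorTerm`). The Poisson–Jensen representation on a larger circle of radius R
bounds (h'/h)^(j) by a Poisson-type integral of |log |h|| and by negative powers of distances to
zeros and poles. Raising to the power α / (j + 1) with α < 1 makes the averages finite, concavity of
log returns to the logarithm, and Borel's growth lemma chooses R. Comparing the two estimates and
dividing by μ gives the theorem. -/

/-! ### Holomorphic functions of several variables. -/

theorem norm_fderiv_le_of_forall_mem_ball {E : Type*} [NormedAddCommGroup E] [NormedSpace ℂ E]
    {H : E → ℂ} {x : E} {ρ M : ℝ} (hρ : 0 < ρ) (hd : DifferentiableOn ℂ H (ball x ρ))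
    (hM : ∀ y ∈ ball x ρ, ‖H y‖ ≤ M) : ‖fderiv ℂ H x‖ ≤ 2 * M / ρ := by
  have hx : x ∈ ball x ρ := mem_ball_self hρ
  have hM0 : 0 ≤ M := (norm_nonneg _).trans (hM x hx)
  refine ContinuousLinearMap.opNorm_le_bound _ (by positivity) fun e => ?_
  rcases eq_or_ne e 0 with rfl | he
  · simp
  have he' : 0 < ‖e‖ := norm_pos_iff.2 he
  set s : ℝ := ρ / (2 * ‖e‖) with hs
  have hs0 : 0 < s := by positivity
  have hmem : ∀ ζ : ℂ, ‖ζ‖ ≤ s → x + ζ • e ∈ ball x ρ := by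
    intro ζ hζ
    rw [mem_ball, dist_self_add_left, norm_smul]
    calc ‖ζ‖ * ‖e‖ ≤ s * ‖e‖ := by gcongr
      _ = ρ / 2 := by rw [hs]; field_simp
      _ < ρ := by linarith
  have hline : ∀ ζ : ℂ, ‖ζ‖ ≤ s → HasDerivAt (fun ζ : ℂ => H (x + ζ • e))
      (fderiv ℂ H (x + ζ • e) e) ζ := by
    intro ζ hζ
    have h1 : HasFDerivAt H (fderiv ℂ H (x + ζ • e)) (x + ζ • e) :=
      (hd.differentiableAt (isOpen_ball.mem_nhds (hmem ζ hζ))).hasFDerivAt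
    have h2 : HasDerivAt (fun ζ : ℂ => x + ζ • e) e ζ := by
      simpa using ((hasDerivAt_id ζ).smul_const e).const_add x
    exact h1.comp_hasDerivAt ζ h2
  have hdc : DiffContOnCl ℂ (fun ζ : ℂ => H (x + ζ • e)) (ball 0 s) := by
    apply DifferentiableOn.diffContOnCl
    rw [closure_ball _ hs0.ne']
    intro ζ hζ
    exact (hline ζ (by simpa using hζ)).differentiableAt.differentiableWithinAt
  have hb := Complex.norm_deriv_le_of_forall_mem_sphere_norm_le hs0 hdc
    (fun ζ hζ => hM _ (hmem ζ (by simpa using (mem_sphere_zero_iff_norm.1 hζ).le)))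
  rw [(hline 0 (by simpa using hs0.le)).deriv] at hb
  simp only [zero_smul, add_zero] at hb
  calc ‖fderiv ℂ H x e‖ ≤ M / s := hb
    _ = 2 * M / ρ * ‖e‖ := by rw [hs]; field_simp

/-- Differentiation under the integral sign. Domination comes from Cauchy's estimate on balls of
radius δ/2 inside a compact thickening of the translated circle, where H is bounded. -/
theorem differentiableAt_circleIntegral_line {E : Type*} [NormedAddCommGroup E] [NormedSpace ℂ E]
    [FiniteDimensional ℂ E] {H : E → ℂ} {W : Set E} (hW : IsOpen W)
    (hH : DifferentiableOn ℂ H W) (e : E) {ε : ℝ} (hε : 0 < ε) {κ : ℂ → ℂ}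
    (hκ : ContinuousOn κ (sphere 0 ε)) {v₀ : E} (hv : ∀ ζ ∈ sphere (0 : ℂ) ε, v₀ + ζ • e ∈ W) :
    DifferentiableAt ℂ (fun v => ∮ ζ in C(0, ε), κ ζ * H (v + ζ • e)) v₀ := by
  have : ProperSpace E := FiniteDimensional.proper ℂ E
  borelize E
  set K : Set E := (fun ζ : ℂ => v₀ + ζ • e) '' sphere 0 ε with hK
  have hKc : IsCompact K := (isCompact_sphere _ _).image (by fun_prop)
  obtain ⟨δ, hδ, hδW⟩ := hKc.exists_cthickening_subset_open hW (by rintro _ ⟨ζ, hζ, rfl⟩; exact hv ζ hζ)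
  have hcomp : IsCompact (cthickening δ K) := hKc.cthickening
  obtain ⟨M, hM⟩ := hcomp.exists_bound_of_continuousOn (hH.continuousOn.mono hδW)
  have hthick : ∀ ζ ∈ sphere (0 : ℂ) ε, ∀ v ∈ ball v₀ (δ / 2), ∀ y ∈ ball (v + ζ • e) (δ / 2),
      y ∈ cthickening δ K := by
    intro ζ hζ v hv y hy
    refine mem_cthickening_of_dist_le y (v₀ + ζ • e) δ K ⟨ζ, hζ, rfl⟩ ?_
    have h1 : dist (v + ζ • e) (v₀ + ζ • e) < δ / 2 := by rw [dist_add_right]; exact hv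
    have := dist_triangle y (v + ζ • e) (v₀ + ζ • e)
    rw [mem_ball] at hy
    linarith
  have hδ2 : 0 < δ / 2 := by positivity
  have hmemW : ∀ ζ ∈ sphere (0 : ℂ) ε, ∀ v ∈ ball v₀ (δ / 2), v + ζ • e ∈ W := fun ζ hζ v hv =>
    hδW (hthick ζ hζ v hv _ (mem_ball_self hδ2))
  have hbd : ∀ ζ ∈ sphere (0 : ℂ) ε, ∀ v ∈ ball v₀ (δ / 2),
      ‖fderiv ℂ H (v + ζ • e)‖ ≤ 2 * M / (δ / 2) := fun ζ hζ v hv =>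
    norm_fderiv_le_of_forall_mem_ball hδ2
      (hH.mono fun y hy => hδW (hthick ζ hζ v hv y hy)) fun y hy => hM y (hthick ζ hζ v hv y hy)
  obtain ⟨B, hB⟩ := (isCompact_sphere (0 : ℂ) ε).exists_bound_of_continuousOn hκ
  have hsph : ∀ θ, circleMap 0 ε θ ∈ sphere (0 : ℂ) ε := fun θ => circleMap_mem_sphere _ hε.le θ
  have hκc : Continuous fun θ => κ (circleMap 0 ε θ) :=
    hκ.comp_continuous (continuous_circleMap 0 ε) hsph
  have hcont : ∀ v ∈ ball v₀ (δ / 2), Continuous fun θ : ℝ =>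
      deriv (circleMap 0 ε) θ • (κ (circleMap 0 ε θ) * H (v + circleMap 0 ε θ • e)) := by
    intro v hv
    have h1 : Continuous fun θ : ℝ => H (v + circleMap 0 ε θ • e) :=
      hH.continuousOn.comp_continuous (by fun_prop) fun θ => hmemW _ (hsph θ) v hv
    simp only [deriv_circleMap]
    exact ((continuous_circleMap 0 ε).mul continuous_const).smul (hκc.mul h1)
  refine HasFDerivAt.differentiableAt (𝕜 := ℂ) (f' := ∫ θ in (0 : ℝ)..2 * Real.pi,
      (deriv (circleMap 0 ε) θ * κ (circleMap 0 ε θ)) • fderiv ℂ H (v₀ + circleMap 0 ε θ • e)) ?_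
  unfold circleIntegral
  refine intervalIntegral.hasFDerivAt_integral_of_dominated_of_fderiv_le
    (F' := fun v θ => (deriv (circleMap 0 ε) θ * κ (circleMap 0 ε θ)) •
      fderiv ℂ H (v + circleMap 0 ε θ • e)) (bound := fun _ => ε * B * (2 * M / (δ / 2)))
    (ball_mem_nhds v₀ hδ2) ?_ ?_ ?_ ?_ ?_ ?_
  · filter_upwards [ball_mem_nhds v₀ hδ2] with v hv using (hcont v hv).aestronglyMeasurable
  · exact (hcont v₀ (mem_ball_self hδ2)).intervalIntegrable _ _
  -- Continuity of the derivative is not known at this stage, but `measurable_fderiv` already gives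
  -- measurability.
  · have hm : Measurable fun θ : ℝ => fderiv ℂ H (v₀ + circleMap 0 ε θ • e) :=
      (measurable_fderiv ℂ H).comp (Continuous.measurable (by fun_prop))
    refine AEMeasurable.aestronglyMeasurable (Measurable.aemeasurable ?_)
    have hc : Continuous fun θ : ℝ => deriv (circleMap 0 ε) θ * κ (circleMap 0 ε θ) := by
      simp only [deriv_circleMap]
      exact ((continuous_circleMap 0 ε).mul continuous_const).mul hκc
    exact hc.measurable.smul hm
  · refine Eventually.of_forall fun θ _ v hv => ?_
    rw [norm_smul, norm_mul]
    have h1 : ‖deriv (circleMap 0 ε) θ‖ = ε := by simp [deriv_circleMap, abs_of_pos hε]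
    rw [h1]
    have hB0 : 0 ≤ B := (norm_nonneg _).trans (hB _ (hsph θ))
    gcongr
    · exact hB _ (hsph θ)
    · exact hbd _ (hsph θ) v hv
  · exact intervalIntegrable_const
  · refine Eventually.of_forall fun θ _ v hv => ?_
    have h1 : HasFDerivAt H (fderiv ℂ H (v + circleMap 0 ε θ • e)) (v + circleMap 0 ε θ • e) :=
      (hH.differentiableAt (hW.mem_nhds (hmemW _ (hsph θ) v hv))).hasFDerivAt
    have h2 : HasFDerivAt (fun v : E => v + circleMap 0 ε θ • e) (ContinuousLinearMap.id ℂ E) v :=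
      (hasFDerivAt_id v).add_const _
    have h3 := (h1.comp v h2).const_mul (deriv (circleMap 0 ε) θ * κ (circleMap 0 ε θ))
    simpa [Function.comp_def, mul_assoc] using h3

/-- Cauchy's formula on the complex line through v in direction e writes the directional derivative
as a circle integral of H, and such an integral is differentiable in v. -/
theorem differentiableOn_fderiv_apply {E : Type*} [NormedAddCommGroup E] [NormedSpace ℂ E]
    [FiniteDimensional ℂ E] {H : E → ℂ} {W : Set E} (hW : IsOpen W)
    (hH : DifferentiableOn ℂ H W) (e : E) :
    DifferentiableOn ℂ (fun v => fderiv ℂ H v e) W := by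
  intro v₀ hv₀
  refine DifferentiableAt.differentiableWithinAt ?_
  obtain ⟨r, hr, hrW⟩ := Metric.isOpen_iff.1 hW v₀ hv₀
  set ε : ℝ := r / 2 / (‖e‖ + 1) with hε
  have he : 0 < ‖e‖ + 1 := by positivity
  have hε0 : 0 < ε := by positivity
  have hmem : ∀ ζ : ℂ, ‖ζ‖ ≤ ε → ∀ v ∈ ball v₀ (r / 2), v + ζ • e ∈ W := by
    intro ζ hζ v hv
    apply hrW
    rw [mem_ball] at hv ⊢
    have h1 : dist (v + ζ • e) v ≤ r / 2 := by
      rw [dist_self_add_left, norm_smul]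
      calc ‖ζ‖ * ‖e‖ ≤ ε * (‖e‖ + 1) := by gcongr; linarith
        _ = r / 2 := by rw [hε]; field_simp
    have := dist_triangle (v + ζ • e) v v₀
    linarith
  have key : ∀ v ∈ ball v₀ (r / 2), fderiv ℂ H v e =
      (2 * Real.pi * Complex.I : ℂ)⁻¹ * ∮ ζ in C(0, ε), ((ζ - 0) ^ 2)⁻¹ * H (v + ζ • e) := by
    intro v hv
    have hline : ∀ ζ : ℂ, ‖ζ‖ ≤ ε → HasDerivAt (fun ζ : ℂ => H (v + ζ • e))
        (fderiv ℂ H (v + ζ • e) e) ζ := by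
      intro ζ hζ
      have h1 : HasFDerivAt H (fderiv ℂ H (v + ζ • e)) (v + ζ • e) :=
        (hH.differentiableAt (hW.mem_nhds (hmem ζ hζ v hv))).hasFDerivAt
      have h2 : HasDerivAt (fun ζ : ℂ => v + ζ • e) e ζ := by
        simpa using ((hasDerivAt_id ζ).smul_const e).const_add v
      exact h1.comp_hasDerivAt ζ h2
    have hdc : DiffContOnCl ℂ (fun ζ : ℂ => H (v + ζ • e)) (ball 0 ε) := by
      apply DifferentiableOn.diffContOnCl
      rw [closure_ball _ hε0.ne']
      intro ζ hζ
      exact (hline ζ (by simpa using hζ)).differentiableAt.differentiableWithinAt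
    have h := hdc.deriv_eq_smul_circleIntegral hε0
    rw [(hline 0 (by simpa using hε0.le)).deriv] at h
    rw [zero_smul, add_zero] at h
    rw [eq_inv_mul_iff_mul_eq₀ (by simp [Real.pi_ne_zero])]
    simpa using h.symm
  have hdiff := differentiableAt_circleIntegral_line hW hH e hε0
    (κ := fun ζ => ((ζ - 0) ^ 2)⁻¹) (v₀ := v₀) ?_ fun ζ hζ =>
      hmem ζ (mem_sphere_zero_iff_norm.1 hζ).le v₀ (mem_ball_self (by positivity))
  · refine (hdiff.const_mul (2 * Real.pi * Complex.I : ℂ)⁻¹).congr_of_eventuallyEq ?_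
    filter_upwards [ball_mem_nhds v₀ (by positivity : 0 < r / 2)] with v hv using key v hv
  · refine ContinuousOn.inv₀ (by fun_prop) fun ζ hζ => ?_
    have : ζ ≠ 0 := by
      rintro rfl
      simp [hε0.ne] at hζ
    simpa using this

theorem contDiffOn_nat_of_differentiableOn_complex {E : Type*} [NormedAddCommGroup E] [NormedSpace ℂ E]
    [FiniteDimensional ℂ E] {W : Set E} (hW : IsOpen W) (N : ℕ) :
    ∀ {H : E → ℂ}, DifferentiableOn ℂ H W → ContDiffOn ℂ N H W := by
  induction N with
  | zero => exact fun hH => contDiffOn_zero.2 hH.continuousOn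
  | succ N ih =>
    intro H hH
    push_cast
    rw [contDiffOn_succ_iff_fderiv_of_isOpen hW]
    refine ⟨hH, by simp, contDiffOn_clm_apply.2 fun e => ih (differentiableOn_fderiv_apply hW hH e)⟩

theorem hasDerivAt_comp_line {E : Type*} [NormedAddCommGroup E] [NormedSpace ℂ E] {H : E → ℂ}
    {v e : E} {ζ : ℂ} (h : DifferentiableAt ℂ H (v + ζ • e)) :
    HasDerivAt (fun ζ : ℂ => H (v + ζ • e)) (fderiv ℂ H (v + ζ • e) e) ζ := by
  have h2 : HasDerivAt (fun ζ : ℂ => v + ζ • e) e ζ := by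
    simpa using ((hasDerivAt_id ζ).smul_const e).const_add v
  exact h.hasFDerivAt.comp_hasDerivAt ζ h2

theorem differentiableOn_div_of_ne_zero {E : Type*} [NormedAddCommGroup E] [NormedSpace ℂ E]
    {a b : E → ℂ} {W : Set E} (ha : DifferentiableOn ℂ a W) (hb : DifferentiableOn ℂ b W) :
    DifferentiableOn ℂ (fun v => a v / b v) (W ∩ b ⁻¹' {0}ᶜ) := by
  simp only [div_eq_mul_inv]
  exact (ha.mono Set.inter_subset_left).mul
    ((hb.mono Set.inter_subset_left).inv fun v hv => hv.2)

/-- The zeros of b are simple and a vanishes there, so the singularities are removable: near such a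
zero the quotient is that of the two `dslope`s. -/
theorem exists_differentiableOn_eq_div {a b : ℂ → ℂ} {U : Set ℂ} (hU : IsOpen U)
    (ha : DifferentiableOn ℂ a U) (hb : DifferentiableOn ℂ b U)
    (hab : ∀ ζ ∈ U, b ζ = 0 → a ζ = 0) (hb' : ∀ ζ ∈ U, b ζ = 0 → deriv b ζ ≠ 0) :
    ∃ κ : ℂ → ℂ, DifferentiableOn ℂ κ U ∧ ∀ ζ, b ζ ≠ 0 → κ ζ = a ζ / b ζ := by
  classical
  refine ⟨fun ζ => if b ζ = 0 then deriv a ζ / deriv b ζ else a ζ / b ζ, ?_, fun ζ hζ => by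
    simp [hζ]⟩
  intro ζ₀ hζ₀
  refine DifferentiableAt.differentiableWithinAt ?_
  have hn : U ∈ 𝓝 ζ₀ := hU.mem_nhds hζ₀
  by_cases h0 : b ζ₀ = 0
  · have hda : DifferentiableAt ℂ (dslope a ζ₀) ζ₀ :=
      ((Complex.differentiableOn_dslope hn).2 ha).differentiableAt hn
    have hdb : DifferentiableAt ℂ (dslope b ζ₀) ζ₀ :=
      ((Complex.differentiableOn_dslope hn).2 hb).differentiableAt hn
    have hne : dslope b ζ₀ ζ₀ ≠ 0 := by rw [dslope_same]; exact hb' ζ₀ hζ₀ h0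
    refine (hda.div hdb hne).congr_of_eventuallyEq ?_
    filter_upwards [hdb.continuousAt.eventually_ne hne] with ζ hζ
    rcases eq_or_ne ζ ζ₀ with rfl | hz
    · simp [h0]
    · have hz' : ζ - ζ₀ ≠ 0 := sub_ne_zero.2 hz
      rw [dslope_of_ne _ hz, slope_def_field, h0, sub_zero] at hζ
      have hbz : b ζ ≠ 0 := fun h => hζ (by simp [h])
      rw [if_neg hbz, Pi.div_apply, dslope_of_ne _ hz, dslope_of_ne _ hz, slope_def_field,
        slope_def_field, h0, hab ζ₀ hζ₀ h0]
      field_simp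
      ring
  · have hda := (ha.differentiableAt hn).div (hb.differentiableAt hn) h0
    refine hda.congr_of_eventuallyEq ?_
    filter_upwards [(hb.differentiableAt hn).continuousAt.eventually_ne h0] with ζ hζ
    simp [hζ]

/-- Choose a direction e transverse to {q = 0}. On each line in direction e near v₀ the zeros of q
are simple, so Φ / q extends holomorphically, and Cauchy's formula on a circle avoiding {q = 0}
recovers its value at the centre. The same circle serves for all nearby v, which makes the quotient
holomorphic in v. -/
theorem exists_eq_mul_of_simple_zero {E : Type*} [NormedAddCommGroup E] [NormedSpace ℂ E]
    [FiniteDimensional ℂ E] {Φ q : E → ℂ} {W : Set E} (hW : IsOpen W)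
    (hΦ : DifferentiableOn ℂ Φ W) (hq : DifferentiableOn ℂ q W) {v₀ : E} (hv₀ : v₀ ∈ W)
    (hq' : fderiv ℂ q v₀ ≠ 0) (hz : ∀ v ∈ W, q v = 0 → Φ v = 0) :
    ∃ (V : Set E) (ψ : E → ℂ), IsOpen V ∧ v₀ ∈ V ∧ V ⊆ W ∧ DifferentiableOn ℂ ψ V ∧
      ∀ v ∈ V, Φ v = q v * ψ v := by
  obtain ⟨e, he⟩ : ∃ e, fderiv ℂ q v₀ e ≠ 0 := by
    by_contra! h
    exact hq' (ContinuousLinearMap.ext h)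
  set W₁ : Set E := W ∩ (fun v => fderiv ℂ q v e) ⁻¹' {0}ᶜ with hW₁
  have hW₁o : IsOpen W₁ :=
    (differentiableOn_fderiv_apply hW hq e).continuousOn.isOpen_inter_preimage hW
      isOpen_compl_singleton
  have hv₁ : v₀ ∈ W₁ := ⟨hv₀, he⟩
  set W₂ : Set E := W ∩ q ⁻¹' {0}ᶜ with hW₂
  have hW₂o : IsOpen W₂ := hq.continuousOn.isOpen_inter_preimage hW isOpen_compl_singleton
  have hline : Continuous fun ζ : ℂ => v₀ + ζ • e := by fun_prop
  have hev₁ : ∀ᶠ ζ : ℂ in 𝓝 0, v₀ + ζ • e ∈ W₁ :=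
    hline.continuousAt.eventually_mem (hW₁o.mem_nhds (by simpa using hv₁))
  have hev₂ : ∀ᶠ ζ : ℂ in 𝓝[≠] 0, q (v₀ + ζ • e) ≠ 0 := by
    have hd : HasDerivAt (fun ζ : ℂ => q (v₀ + ζ • e)) (fderiv ℂ q v₀ e) 0 := by
      simpa using hasDerivAt_comp_line (v := v₀) (e := e) (ζ := 0)
        (by simpa using hq.differentiableAt (hW.mem_nhds hv₀))
    exact hd.eventually_ne (c := 0) he
  obtain ⟨ε', hε', hball⟩ := Metric.eventually_nhds_iff_ball.1
    (hev₁.and (eventually_nhdsWithin_iff.1 hev₂))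
  set ε : ℝ := ε' / 2 with hε
  have hε0 : 0 < ε := by positivity
  have hlt : ε < ε' := by rw [hε]; linarith
  have hK₁ : IsCompact ((fun ζ : ℂ => v₀ + ζ • e) '' closedBall 0 ε) :=
    (isCompact_closedBall _ _).image hline
  have hK₂ : IsCompact ((fun ζ : ℂ => v₀ + ζ • e) '' sphere 0 ε) :=
    (isCompact_sphere _ _).image hline
  obtain ⟨δ₁, hδ₁, hs₁⟩ := hK₁.exists_thickening_subset_open hW₁o (by
    rintro _ ⟨ζ, hζ, rfl⟩
    exact (hball ζ (closedBall_subset_ball hlt hζ)).1)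
  obtain ⟨δ₂, hδ₂, hs₂⟩ := hK₂.exists_thickening_subset_open hW₂o (by
    rintro _ ⟨ζ, hζ, rfl⟩
    have hb := hball ζ (closedBall_subset_ball hlt (sphere_subset_closedBall hζ))
    refine ⟨hb.1.1, hb.2 ?_⟩
    rintro rfl
    simp [hε0.ne] at hζ)
  set δ := min δ₁ δ₂ with hδ
  have hδ0 : 0 < δ := lt_min hδ₁ hδ₂
  have hm₁ : ∀ v ∈ ball v₀ δ, ∀ ζ ∈ closedBall (0 : ℂ) ε, v + ζ • e ∈ W₁ := fun v hv ζ hζ =>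
    hs₁ (mem_thickening_iff.2 ⟨_, ⟨ζ, hζ, rfl⟩, by
      rw [dist_add_right]; exact lt_of_lt_of_le hv (min_le_left _ _)⟩)
  have hm₂ : ∀ v ∈ ball v₀ δ, ∀ ζ ∈ sphere (0 : ℂ) ε, v + ζ • e ∈ W₂ := fun v hv ζ hζ =>
    hs₂ (mem_thickening_iff.2 ⟨_, ⟨ζ, hζ, rfl⟩, by
      rw [dist_add_right]; exact lt_of_lt_of_le hv (min_le_right _ _)⟩)
  have hVW : ball v₀ δ ⊆ W := fun v hv => by
    simpa using (hm₁ v hv 0 (by simpa using hε0.le)).1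
  refine ⟨ball v₀ δ, fun v => (2 * Real.pi * Complex.I : ℂ)⁻¹ *
    ∮ ζ in C(0, ε), ζ⁻¹ * (Φ / q) (v + ζ • e), isOpen_ball, mem_ball_self hδ0, hVW, ?_, ?_⟩
  · intro v hv
    refine DifferentiableAt.differentiableWithinAt (DifferentiableAt.const_mul ?_ _)
    refine differentiableAt_circleIntegral_line hW₂o
      (differentiableOn_div_of_ne_zero hΦ hq) e hε0 ?_ (hm₂ v hv)
    · refine ContinuousOn.inv₀ continuousOn_id fun ζ hζ => ?_
      rintro rfl
      simp [hε0.ne] at hζ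
  · intro v hv
    by_cases hqv : q v = 0
    · rw [hqv, zero_mul, hz v (hVW hv) hqv]
    set U : Set ℂ := (fun ζ : ℂ => v + ζ • e) ⁻¹' W₁ with hUdef
    have hU : IsOpen U := hW₁o.preimage (by fun_prop)
    have hdiffat : ∀ {H : E → ℂ}, DifferentiableOn ℂ H W → ∀ ζ ∈ U,
        HasDerivAt (fun ζ : ℂ => H (v + ζ • e)) (fderiv ℂ H (v + ζ • e) e) ζ := fun hH ζ hζ =>
      hasDerivAt_comp_line (hH.differentiableAt (hW.mem_nhds hζ.1))
    obtain ⟨κ, hκ, hκeq⟩ := exists_differentiableOn_eq_div (a := fun ζ : ℂ => Φ (v + ζ • e))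
      (b := fun ζ : ℂ => q (v + ζ • e)) hU
      (fun ζ hζ => (hdiffat hΦ ζ hζ).differentiableAt.differentiableWithinAt)
      (fun ζ hζ => (hdiffat hq ζ hζ).differentiableAt.differentiableWithinAt)
      (fun ζ hζ h => hz _ hζ.1 h)
      (fun ζ hζ _ => by rw [(hdiffat hq ζ hζ).deriv]; exact hζ.2)
    have hdc : DiffContOnCl ℂ κ (ball 0 ε) := by
      apply DifferentiableOn.diffContOnCl
      rw [closure_ball _ hε0.ne']
      exact hκ.mono fun ζ hζ => hm₁ v hv ζ hζ
    have hcauchy := hdc.circleIntegral_sub_inv_smul (mem_ball_self hε0)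
    have hcongr : (∮ ζ in C(0, ε), ζ⁻¹ * (Φ / q) (v + ζ • e)) =
        ∮ ζ in C(0, ε), (ζ - 0)⁻¹ • κ ζ := by
      refine circleIntegral.integral_congr hε0.le fun ζ hζ => ?_
      simp only [sub_zero, smul_eq_mul, Pi.div_apply]
      rw [hκeq ζ (hm₂ v hv ζ hζ).2]
    dsimp only
    rw [hcongr, hcauchy, hκeq 0 (by simpa using hqv), smul_eq_mul,
      inv_mul_cancel_left₀ (by simp [Real.pi_ne_zero])]
    simp only [zero_smul, add_zero]
    field_simp

/-- Division gives Φ = q ψ. Where both functions vanish, dΦ = ψ dq, so dΦ ≠ 0 forces ψ ≠ 0. The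
neighbourhood is then shrunk until ψ / ψ(v₀) lies in the slit plane and has a logarithm. -/
theorem exists_eq_mul_exp {E : Type*} [NormedAddCommGroup E] [NormedSpace ℂ E]
    [FiniteDimensional ℂ E] {Φ q : E → ℂ} {W : Set E} (hW : IsOpen W)
    (hΦ : DifferentiableOn ℂ Φ W) (hq : DifferentiableOn ℂ q W) {v₀ : E} (hv₀ : v₀ ∈ W)
    (hq' : q v₀ = 0 → fderiv ℂ q v₀ ≠ 0) (hΦ' : Φ v₀ = 0 → fderiv ℂ Φ v₀ ≠ 0)
    (hz : ∀ v ∈ W, q v = 0 ↔ Φ v = 0) :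
    ∃ (V : Set E) (ℓ : E → ℂ), IsOpen V ∧ v₀ ∈ V ∧ V ⊆ W ∧ DifferentiableOn ℂ ℓ V ∧
      ∀ v ∈ V, Φ v = q v * Complex.exp (ℓ v) := by
  obtain ⟨V, ψ, hV, hvV, hVW, hψ, hψ0, hmul⟩ : ∃ (V : Set E) (ψ : E → ℂ), IsOpen V ∧ v₀ ∈ V ∧
      V ⊆ W ∧ DifferentiableOn ℂ ψ V ∧ ψ v₀ ≠ 0 ∧ ∀ v ∈ V, Φ v = q v * ψ v := by
    by_cases h0 : q v₀ = 0
    · obtain ⟨V, ψ, hV, hvV, hVW, hψ, hmul⟩ := exists_eq_mul_of_simple_zero hW hΦ hq hv₀ (hq' h0)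
        fun v hv => (hz v hv).1
      refine ⟨V, ψ, hV, hvV, hVW, hψ, fun hψ0 => ?_, hmul⟩
      refine hΦ' ((hz v₀ hv₀).1 h0) ?_
      have h1 : HasFDerivAt (fun v => q v * ψ v) (q v₀ • fderiv ℂ ψ v₀ + ψ v₀ • fderiv ℂ q v₀) v₀ :=
        (hq.differentiableAt (hW.mem_nhds hv₀)).hasFDerivAt.mul
          (hψ.differentiableAt (hV.mem_nhds hvV)).hasFDerivAt
      have h2 : Φ =ᶠ[𝓝 v₀] fun v => q v * ψ v := eventually_of_mem (hV.mem_nhds hvV) hmul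
      rw [h2.fderiv_eq, h1.fderiv, h0, hψ0]
      refine ContinuousLinearMap.ext fun e => ?_
      change (0 : ℂ) * _ + 0 * _ = 0
      ring
    · refine ⟨W ∩ q ⁻¹' {0}ᶜ, fun v => Φ v / q v,
        hq.continuousOn.isOpen_inter_preimage hW isOpen_compl_singleton, ⟨hv₀, h0⟩,
        Set.inter_subset_left, differentiableOn_div_of_ne_zero hΦ hq, ?_, fun v hv => ?_⟩
      · exact div_ne_zero (fun h => h0 ((hz v₀ hv₀).2 h)) h0
      · have : q v ≠ 0 := hv.2
        field_simp
  set V' : Set E := V ∩ (fun v => ψ v / ψ v₀) ⁻¹' Complex.slitPlane with hV'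
  have hdiv : DifferentiableOn ℂ (fun v => ψ v / ψ v₀) V := by
    simp only [div_eq_mul_inv]
    exact hψ.mul_const _
  refine ⟨V', fun v => Complex.log (ψ v / ψ v₀) + Complex.log (ψ v₀),
    hdiv.continuousOn.isOpen_inter_preimage hV Complex.isOpen_slitPlane, ⟨hvV, ?_⟩,
    Set.inter_subset_left.trans hVW, fun v hv => ?_, fun v hv => ?_⟩
  · simp [hψ0]
  · exact (((hdiv v hv.1).mono Set.inter_subset_left).clog hv.2).add_const _
  · rw [hmul v hv.1, Complex.exp_add, Complex.exp_log (Complex.slitPlane_ne_zero hv.2),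
      Complex.exp_log hψ0, div_mul_cancel₀ _ hψ0]

/-- The estimate for derivatives of a composition, with the derivatives of Φ bounded near v₀. The
constant depends neither on the curve nor on the point, only on the neighbourhood; D ≥ 1 lets all
orders share the power k. -/
theorem exists_bound_iteratedDeriv_comp {E : Type*} [NormedAddCommGroup E] [NormedSpace ℂ E]
    [FiniteDimensional ℂ E] {Φ : E → ℂ} {W : Set E} (hW : IsOpen W)
    (hΦ : DifferentiableOn ℂ Φ W) {v₀ : E} (hv₀ : v₀ ∈ W) (k : ℕ) :
    ∃ V ∈ 𝓝 v₀, ∃ C : ℝ, 0 ≤ C ∧ ∀ (G : ℂ → E) (z : ℂ) (D : ℝ), AnalyticAt ℂ G z → G z ∈ V →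
      1 ≤ D → (∀ i, 1 ≤ i → i ≤ k → ‖iteratedDeriv i G z‖ ≤ D) →
      ∀ j ≤ k, ‖iteratedDeriv j (fun w => Φ (G w)) z‖ ≤ C * D ^ k := by
  have hcd : ContDiffOn ℂ k Φ W := contDiffOn_nat_of_differentiableOn_complex hW k hΦ
  have hcont : ∀ i ≤ k, ContinuousAt (fun v => ‖iteratedFDeriv ℂ i Φ v‖) v₀ := by
    intro i hi
    have hca : ContDiffAt ℂ k Φ v₀ := hcd.contDiffAt (hW.mem_nhds hv₀)
    exact (hca.continuousAt_iteratedFDeriv (by exact_mod_cast hi)).norm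
  set C₀ : ℝ := ∑ i ∈ Finset.range (k + 1), (‖iteratedFDeriv ℂ i Φ v₀‖ + 1) with hC₀
  have hC₀0 : 0 ≤ C₀ := by positivity
  have hle : ∀ i ≤ k, ‖iteratedFDeriv ℂ i Φ v₀‖ + 1 ≤ C₀ := fun i hi =>
    Finset.single_le_sum (f := fun i => ‖iteratedFDeriv ℂ i Φ v₀‖ + 1)
      (fun i _ => by positivity) (Finset.mem_range.2 (by omega))
  have hnear : ∀ᶠ v in 𝓝 v₀, ∀ i ∈ Finset.range (k + 1), ‖iteratedFDeriv ℂ i Φ v‖ ≤ C₀ := by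
    rw [Finset.eventually_all]
    intro i hi
    have hi' : i ≤ k := by have := Finset.mem_range.1 hi; omega
    filter_upwards [(hcont i hi').eventually_lt_const (lt_add_one _)] with v hv
    exact hv.le.trans (hle i hi')
  refine ⟨_, inter_mem hnear (hW.mem_nhds hv₀), k.factorial * C₀, by positivity, ?_⟩
  intro G z D hG hGz hD hGi j hj
  obtain ⟨hGz, hGW⟩ := hGz
  obtain ⟨s, hs, hzs, hGs⟩ : ∃ s : Set ℂ, IsOpen s ∧ z ∈ s ∧
      s ⊆ {w | AnalyticAt ℂ G w ∧ G w ∈ W} := by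
    obtain ⟨s, h1, h2, h3⟩ := _root_.mem_nhds_iff.1
      (hG.eventually_analyticAt.and (hG.continuousAt.eventually_mem (hW.mem_nhds hGW)))
    exact ⟨s, h2, h3, h1⟩
  have hGs' : ContDiffOn ℂ k G s := fun w hw => (hGs hw).1.contDiffAt.contDiffWithinAt
  have hb := norm_iteratedFDerivWithin_comp_le (n := j) (C := C₀) (D := D) hcd hGs'
    (by exact_mod_cast hj) hW.uniqueDiffOn hs.uniqueDiffOn (fun w hw => (hGs hw).2) hzs
    (fun i hi => by
      rw [iteratedFDerivWithin_of_isOpen i hW hGW]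
      exact hGz i (Finset.mem_range.2 (by omega)))
    (fun i hi hij => by
      rw [iteratedFDerivWithin_of_isOpen i hs hzs, norm_iteratedFDeriv_eq_norm_iteratedDeriv]
      exact (hGi i hi (hij.trans hj)).trans (le_self_pow₀ hD (by omega)))
  rw [iteratedFDerivWithin_of_isOpen j hs hzs, norm_iteratedFDeriv_eq_norm_iteratedDeriv] at hb
  refine hb.trans ?_
  gcongr

/-! ### Growth of the order function. -/

/-- Uniform continuity controls each arc separately, so the number of sample points does not depend
on the starting angle θ₀. This uniformity is needed for the maximum principle in
`orderFunction_le_of_le`. -/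
theorem exists_forall_riemannSum_circle_le {g : ℂ → ℝ} (hg : Continuous g) (R : ℝ) {ε : ℝ}
    (hε : 0 < ε) : ∃ N₀ : ℕ, ∀ N : ℕ, N₀ ≤ N → 0 < N → ∀ θ₀ : ℝ,
      |∑ k ∈ Finset.range N, g (circleMap 0 R (θ₀ + k * (2 * Real.pi / N))) -
        N * Real.circleAverage g 0 R| ≤ N * ε := by
  have hpi := Real.pi_pos
  have huc := (isCompact_closedBall (0 : ℂ) |R|).uniformContinuousOn_of_continuous hg.continuousOn
  obtain ⟨η, hη, hgη⟩ := Metric.uniformContinuousOn_iff.1 huc ε hε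
  have hmem : ∀ θ, circleMap 0 R θ ∈ closedBall (0 : ℂ) |R| := fun θ => by simp
  obtain ⟨N₀, hN₀⟩ := exists_nat_gt (2 * Real.pi * (|R| + 1) / η)
  refine ⟨N₀, fun N hN hNpos θ₀ => ?_⟩
  have hNr : (0 : ℝ) < N := by exact_mod_cast hNpos
  set s : ℝ := 2 * Real.pi / N with hs
  have hs0 : 0 < s := by positivity
  have hNs : N * s = 2 * Real.pi := by rw [hs]; field_simp
  have hsη : |R| * s < η := by
    have h1 : 2 * Real.pi * (|R| + 1) / η < N := hN₀.trans_le (by exact_mod_cast hN)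
    rw [div_lt_iff₀ hη] at h1
    have h2 : (|R| + 1) * s < η := by
      rw [hs, mul_div_assoc', div_lt_iff₀ hNr]; linarith
    nlinarith [abs_nonneg R]
  set φ : ℝ → ℝ := fun θ => g (circleMap 0 R θ) with hφ
  have hφc : Continuous φ := hg.comp (continuous_circleMap 0 R)
  have hφu : ∀ θ θ', |θ - θ'| ≤ s → |φ θ - φ θ'| ≤ ε := by
    intro θ θ' h
    have h1 : dist (circleMap 0 R θ) (circleMap 0 R θ') ≤ |R| * |θ - θ'| := by
      simpa [Real.dist_eq, Real.coe_nnabs] using (lipschitzWith_circleMap 0 R).dist_le_mul θ θ'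
    have h2 := hgη _ (hmem θ) _ (hmem θ') (h1.trans_lt (lt_of_le_of_lt (by gcongr) hsη))
    exact (Real.dist_eq _ _ ▸ h2).le
  have hper : Function.Periodic φ (2 * Real.pi) := fun θ => by
    simp only [hφ, periodic_circleMap 0 R θ]
  have hint : ∫ θ in (0 : ℝ)..2 * Real.pi, φ θ =
      ∑ k ∈ Finset.range N, ∫ θ in (θ₀ + k * s)..(θ₀ + (k + 1 : ℕ) * s), φ θ := by
    rw [intervalIntegral.sum_integral_adjacent_intervals (a := fun k : ℕ => θ₀ + k * s)
      fun k _ => hφc.intervalIntegrable _ _, hNs]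
    have := hper.intervalIntegral_add_eq 0 θ₀
    simpa using this
  have havg : (N : ℝ) * Real.circleAverage g 0 R = s⁻¹ * ∫ θ in (0 : ℝ)..2 * Real.pi, φ θ := by
    rw [Real.circleAverage_def, smul_eq_mul, ← mul_assoc, hs]
    congr 1
    field_simp
  rw [havg, hint, Finset.mul_sum, ← Finset.sum_sub_distrib]
  refine (Finset.abs_sum_le_sum_abs _ _).trans ?_
  rw [← nsmul_eq_mul]
  refine (Finset.sum_le_card_nsmul _ _ ε fun k _ => ?_).trans_eq (by simp)
  have hlen : θ₀ + ((k + 1 : ℕ) : ℝ) * s - (θ₀ + k * s) = s := by push_cast; ring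
  have hconst : φ (θ₀ + k * s) =
      s⁻¹ * ∫ θ in (θ₀ + k * s)..(θ₀ + (k + 1 : ℕ) * s), φ (θ₀ + k * s) := by
    rw [intervalIntegral.integral_const, hlen, smul_eq_mul, inv_mul_cancel_left₀ hs0.ne']
  change |φ (θ₀ + k * s) - _| ≤ ε
  rw [hconst, ← mul_sub, ← intervalIntegral.integral_sub (by simp)
    (hφc.intervalIntegrable _ _), abs_mul, abs_inv, abs_of_pos hs0]
  have hb := intervalIntegral.norm_integral_le_of_norm_le_const (a := θ₀ + k * s)
    (b := θ₀ + (k + 1 : ℕ) * s) (C := ε) (f := fun θ => φ (θ₀ + k * s) - φ θ) (by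
      intro θ hθ
      rw [Set.uIoc_of_le (by linarith)] at hθ
      refine hφu _ _ ?_
      rw [abs_le]
      constructor <;> linarith [hθ.1, hθ.2])
  rw [hlen, abs_of_pos hs0, Real.norm_eq_abs] at hb
  calc s⁻¹ * |_| ≤ s⁻¹ * (ε * s) := by gcongr
    _ = ε := by field_simp

theorem exists_norm_apply_eq_norm {ι : Type*} [Fintype ι] [Nonempty ι] (v : ι → ℂ) :
    ∃ i, ‖v i‖ = ‖v‖ := by
  obtain ⟨i, hi⟩ := Finite.exists_max fun i => ‖v i‖
  exact ⟨i, le_antisymm (norm_le_pi_norm v i) ((pi_norm_le_iff_of_nonneg (norm_nonneg _)).2 hi)⟩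

theorem orderFunction_eq_circleAverage {n : ℕ} (F : ℂ → Fin (n + 1) → ℂ) (r : ℝ) :
    orderFunction F r = Real.circleAverage (fun z => Real.log ‖F z‖) 0 r := rfl

/-- Subharmonicity of log ‖F‖ in discrete form. Sample the circle of radius r at N points, pick at
each one a component of maximal modulus, and multiply the corresponding rotated components into one
holomorphic function H. At r its modulus is exactly the product of the sampled norms. On |w| = R it
is at most the product of the norms at N equally spaced points, so the maximum principle compares
the two Riemann sums. -/
theorem orderFunction_le_of_le {n : ℕ} {F : ℂ → Fin (n + 1) → ℂ} (hF : Differentiable ℂ F)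
    (hF0 : ∀ z, F z ≠ 0) {r R : ℝ} (hr : 0 ≤ r) (hrR : r ≤ R) :
    orderFunction F r ≤ orderFunction F R := by
  rcases hrR.eq_or_lt with rfl | hlt
  · exact le_rfl
  simp only [orderFunction_eq_circleAverage]
  set g : ℂ → ℝ := fun z => Real.log ‖F z‖ with hg
  have hgc : Continuous g := hF.continuous.norm.log fun z => norm_ne_zero_iff.2 (hF0 z)
  refine le_of_forall_pos_le_add fun ε' hε' => ?_
  obtain ⟨ε, hε, rfl⟩ : ∃ ε, 0 < ε ∧ ε' = ε + ε := ⟨ε' / 2, by positivity, by ring⟩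
  obtain ⟨N₁, hN₁⟩ := exists_forall_riemannSum_circle_le hgc r hε
  obtain ⟨N₂, hN₂⟩ := exists_forall_riemannSum_circle_le hgc R hε
  set N : ℕ := N₁ + N₂ + 1 with hN
  have hNr : (0 : ℝ) < N := by positivity
  set s : ℝ := 2 * Real.pi / N with hs
  have h1 := (abs_le.1 (hN₁ N (by omega) (by omega) 0)).1
  have h2 : ∀ θ₀, _ := fun θ₀ => (abs_le.1 (hN₂ N (by omega) (by omega) θ₀)).2
  choose c hc using fun k : ℕ => exists_norm_apply_eq_norm (F (circleMap 0 r (0 + k * s)))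
  have hrot : ∀ ρ θ θ' : ℝ, circleMap 0 ρ (θ + θ') =
      circleMap 0 ρ θ * Complex.exp (θ' * Complex.I) := fun ρ θ θ' => by
    simp [circleMap, add_mul, Complex.exp_add, mul_assoc]
  set H : ℂ → ℂ := fun w => ∏ k ∈ Finset.range N,
    F (w * Complex.exp (((k * s : ℝ) : ℂ) * Complex.I)) (c k) with hH
  have hFi : ∀ i, Differentiable ℂ fun z => F z i := fun i => differentiable_pi.1 hF i
  have hHd : Differentiable ℂ H := Differentiable.fun_finsetProd fun k _ =>
    (hFi (c k)).comp (by fun_prop)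
  have hexp : ∀ t : ℕ → ℂ, (∏ k ∈ Finset.range N, ‖F (t k)‖) =
      Real.exp (∑ k ∈ Finset.range N, g (t k)) := fun t => by
    rw [Real.exp_sum]
    exact Finset.prod_congr rfl fun k _ => (Real.exp_log (norm_pos_iff.2 (hF0 _))).symm
  have hbound : ‖H r‖ ≤ Real.exp (N * Real.circleAverage g 0 R + N * ε) := by
    have hR : 0 < R := hr.trans_lt hlt
    refine Complex.norm_le_of_forall_mem_frontier_norm_le (U := ball 0 R) isBounded_ball
      hHd.diffContOnCl ?_ ?_
    · intro w hw
      rw [frontier_ball _ hR.ne'] at hw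
      obtain ⟨θ₀, rfl⟩ : ∃ θ₀, circleMap 0 R θ₀ = w := by
        have : w ∈ Set.range (circleMap 0 R) := by
          rw [range_circleMap, abs_of_pos hR]; exact hw
        exact this
      simp only [hH, norm_prod, ← hrot]
      calc ∏ k ∈ Finset.range N, ‖F (circleMap 0 R (θ₀ + k * s)) (c k)‖
          ≤ ∏ k ∈ Finset.range N, ‖F (circleMap 0 R (θ₀ + k * s))‖ :=
            Finset.prod_le_prod (fun _ _ => norm_nonneg _) fun k _ => norm_le_pi_norm _ _
        _ ≤ _ := by
            rw [hexp fun k => circleMap 0 R (θ₀ + k * s)]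
            exact Real.exp_le_exp.2 (by linarith [h2 θ₀])
    · rw [closure_ball _ hR.ne']
      simpa [abs_of_nonneg hr] using hrR
  have hval : ‖H r‖ = Real.exp (∑ k ∈ Finset.range N, g (circleMap 0 r (0 + k * s))) := by
    rw [← hexp fun k => circleMap 0 r (0 + k * s)]
    simp only [hH, norm_prod]
    refine Finset.prod_congr rfl fun k _ => ?_
    have hr0 : circleMap 0 r 0 = (r : ℂ) := by simp [circleMap]
    rw [← hc k, hrot r 0 (k * s), hr0]
  rw [hval, Real.exp_le_exp] at hbound
  have : N * Real.circleAverage g 0 r ≤ N * (Real.circleAverage g 0 R + (ε + ε)) := by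
    linarith
  exact le_of_mul_le_mul_left this hNr

/-- Borel's growth lemma: a monotone function `τ ≥ 1` satisfies `τ (r + 1 / τ r) ≤ 2 τ r` outside
a set of finite measure. -/
theorem exists_measure_lt_top_forall_growth_le {τ : ℝ → ℝ} (hτ1 : ∀ r, 1 ≤ τ r)
    (hmono : ∀ r s, 1 ≤ r → r ≤ s → τ r ≤ τ s) :
    ∃ E : Set ℝ, MeasureTheory.volume E < ⊤ ∧
      ∀ r, 1 ≤ r → r ∉ E → τ (r + (τ r)⁻¹) ≤ 2 * τ r := by
  -- Dyadic levels of τ. Two exceptional points of level k more than 2^(-k) apart would differ by a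
  -- doubling of τ, which leaves the level. So the diameter is at most 2^(-k), and the measures are
  -- summable.
  set E : ℕ → Set ℝ := fun k =>
    {r | 1 ≤ r ∧ 2 * τ r < τ (r + (τ r)⁻¹) ∧ 2 ^ k ≤ τ r ∧ τ r < 2 ^ (k + 1)} with hE
  refine ⟨⋃ k, E k, ?_, fun r hr hrE => ?_⟩
  · have hmeas : ∀ k, MeasureTheory.volume (E k) ≤ ENNReal.ofReal ((1 / 2 : ℝ) ^ k) := by
      intro k
      rw [one_div, inv_pow]
      refine (Real.volume_le_diam _).trans ?_
      refine Metric.ediam_le fun x hx y hy => ?_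
      have key : ∀ x ∈ E k, ∀ y ∈ E k, x ≤ y → y - x ≤ (2 ^ k)⁻¹ := by
        intro x hx y hy hxy
        by_contra! hcon
        have h1 : (τ x)⁻¹ ≤ (2 ^ k)⁻¹ := inv_anti₀ (by positivity) hx.2.2.1
        have h0 : 0 < (τ x)⁻¹ := inv_pos.2 (by linarith [hτ1 x])
        have h2 : τ (x + (τ x)⁻¹) ≤ τ y := hmono _ _ (by linarith [hx.1]) (by linarith)
        have h3 := hx.2.1
        have h4 := hx.2.2.1
        have h5 := hy.2.2.2
        rw [pow_succ] at h5
        linarith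
      rw [edist_dist, Real.dist_eq]
      refine ENNReal.ofReal_le_ofReal ?_
      rcases le_total x y with h | h
      · rw [abs_sub_comm, abs_of_nonneg (by linarith)]; exact key x hx y hy h
      · rw [abs_of_nonneg (by linarith)]; exact key y hy x hx h
    refine (MeasureTheory.measure_iUnion_le E).trans_lt ?_
    refine (ENNReal.tsum_le_tsum hmeas).trans_lt ?_
    rw [← ENNReal.ofReal_tsum_of_nonneg (fun k => by positivity) summable_geometric_two]
    exact ENNReal.ofReal_lt_top
  · by_contra! hcon
    obtain ⟨k, hk1, hk2⟩ := exists_nat_pow_near (hτ1 r) one_lt_two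
    exact hrE (Set.mem_iUnion.2 ⟨k, hr, hcon, hk1, hk2⟩)

/-! ### Averages of singular kernels over circles. -/

theorem intervalIntegrable_abs_sin_rpow_neg {α : ℝ} (hα0 : 0 < α) (hα1 : α < 1) (a b : ℝ) :
    IntervalIntegrable (fun θ => |Real.sin θ| ^ (-α)) volume a b := by
  have hpi := Real.pi_pos
  have hper : Function.Periodic (fun θ => |Real.sin θ| ^ (-α)) Real.pi := fun θ => by
    simp [Real.sin_add_pi]
  have hmeas : Measurable fun θ => |Real.sin θ| ^ (-α) := by fun_prop
  have h1 : IntervalIntegrable (fun θ => |Real.sin θ| ^ (-α)) volume 0 (Real.pi / 2) := by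
    have hdom : IntervalIntegrable (fun θ : ℝ => (2 / Real.pi) ^ (-α) * θ ^ (-α)) volume 0
        (Real.pi / 2) :=
      (intervalIntegral.intervalIntegrable_rpow' (by linarith)).const_mul _
    refine hdom.mono_fun hmeas.aestronglyMeasurable ?_
    rw [Filter.EventuallyLE, ae_restrict_iff' measurableSet_uIoc]
    refine Eventually.of_forall fun θ hθ => ?_
    rw [Set.uIoc_of_le (by positivity)] at hθ
    have h2 := Real.mul_le_sin hθ.1.le hθ.2
    have h3 : 0 < 2 / Real.pi * θ := mul_pos (by positivity) hθ.1
    rw [← Real.mul_rpow (by positivity) hθ.1.le, Real.norm_of_nonneg (by positivity),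
      Real.norm_of_nonneg (Real.rpow_nonneg h3.le _), abs_of_nonneg (h3.le.trans h2)]
    exact Real.rpow_le_rpow_of_nonpos h3 h2 (by linarith)
  have h2 : IntervalIntegrable (fun θ => |Real.sin θ| ^ (-α)) volume (-(Real.pi / 2)) 0 := by
    have := h1.comp_sub_left 0 (by simp)
    simpa using this.symm
  exact hper.intervalIntegrable hpi.ne' (t := -(Real.pi / 2))
    (by simpa [show -(Real.pi / 2) + Real.pi = Real.pi / 2 by ring] using h2.trans h1) a b

/-- After rotation by -arg a the point a is real, and the modulus of the difference dominates its
imaginary part. -/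
theorem mul_abs_sin_le_norm_circleMap_sub (r θ : ℝ) (a : ℂ) (hr : 0 ≤ r) :
    r * |Real.sin (θ - a.arg)| ≤ ‖circleMap 0 r θ - a‖ := by
  have h1 : ‖circleMap 0 r θ - a‖ =
      ‖(r * Complex.exp ((θ - a.arg : ℝ) * Complex.I) - ‖a‖ : ℂ)‖ := by
    have h2 : circleMap 0 r θ - a = Complex.exp (a.arg * Complex.I) *
        (r * Complex.exp ((θ - a.arg : ℝ) * Complex.I) - ‖a‖) := by
      conv_lhs => rw [← Complex.norm_mul_exp_arg_mul_I a]
      simp only [circleMap, zero_add, mul_sub, Complex.ofReal_sub, sub_mul, Complex.exp_sub]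
      have := Complex.exp_ne_zero (a.arg * Complex.I)
      field_simp
    rw [h2, norm_mul, Complex.norm_exp_ofReal_mul_I, one_mul]
  rw [h1]
  refine le_trans (le_of_eq ?_) (Complex.abs_im_le_norm _)
  simp [Complex.exp_ofReal_mul_I_im, abs_mul, abs_of_nonneg hr, -Complex.ofReal_sub]

/-- The constant is uniform in a, including points arbitrarily close to the circle, so a sum over
zeros and poles costs only their number. -/
theorem exists_circleAverage_norm_sub_rpow_neg_le {α : ℝ} (hα0 : 0 < α) (hα1 : α < 1) :
    ∃ C : ℝ, 0 ≤ C ∧ ∀ (r : ℝ) (a : ℂ), 0 < r → ‖a‖ ≠ r →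
      Real.circleAverage (fun z => ‖z - a‖ ^ (-α)) 0 r ≤ C * r ^ (-α) := by
  have hpi := Real.pi_pos
  refine ⟨(2 * Real.pi)⁻¹ * ∫ θ in (0 : ℝ)..2 * Real.pi, |Real.sin θ| ^ (-α), ?_, ?_⟩
  · exact mul_nonneg (by positivity) (intervalIntegral.integral_nonneg (by positivity)
      fun θ _ => by positivity)
  intro r a hr ha
  have hper : Function.Periodic (fun θ => |Real.sin θ| ^ (-α)) (2 * Real.pi) := fun θ => by
    simp [Real.sin_add_two_pi]
  have hshift : ∫ θ in (0 : ℝ)..2 * Real.pi, |Real.sin (θ - a.arg)| ^ (-α) =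
      ∫ θ in (0 : ℝ)..2 * Real.pi, |Real.sin θ| ^ (-α) := by
    rw [intervalIntegral.integral_comp_sub_right (fun θ => |Real.sin θ| ^ (-α))]
    have := hper.intervalIntegral_add_eq (0 - a.arg) 0
    rw [zero_add] at this
    rw [← this]
    congr 1
    ring
  have hne : ∀ θ, ‖circleMap 0 r θ - a‖ ≠ 0 := fun θ h => ha (by
    rw [← sub_eq_zero.1 (norm_eq_zero.1 h)]; simp [abs_of_pos hr])
  have hint : IntervalIntegrable (fun θ => ‖circleMap 0 r θ - a‖ ^ (-α)) volume 0
      (2 * Real.pi) := by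
    refine Continuous.intervalIntegrable ?_ _ _
    exact Continuous.rpow_const (by fun_prop) fun θ => Or.inl (hne θ)
  have hint2 : IntervalIntegrable (fun θ => r ^ (-α) * |Real.sin (θ - a.arg)| ^ (-α)) volume 0
      (2 * Real.pi) := by
    refine IntervalIntegrable.const_mul ?_ _
    have := (intervalIntegrable_abs_sin_rpow_neg hα0 hα1 (0 - a.arg)
      (2 * Real.pi - a.arg)).comp_sub_right a.arg
    simpa using this
  rw [Real.circleAverage_def, smul_eq_mul, mul_assoc]
  refine mul_le_mul_of_nonneg_left ?_ (by positivity)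
  rw [mul_comm _ (r ^ (-α)), ← hshift, ← intervalIntegral.integral_const_mul]
  refine intervalIntegral.integral_mono_ae (by positivity) hint hint2 ?_
  -- At a zero of the sine the negative power takes the value 0, so the comparison can fail there;
  -- these angles form a null set.
  have hcount : Set.Countable {θ : ℝ | Real.sin (θ - a.arg) = 0} := by
    refine (Set.countable_range fun k : ℤ => k * Real.pi + a.arg).mono fun θ hθ => ?_
    obtain ⟨k, hk⟩ := Real.sin_eq_zero_iff.1 hθ
    exact ⟨k, by simp only; linarith⟩
  filter_upwards [hcount.ae_notMem volume] with θ hθ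
  have hs : 0 < r * |Real.sin (θ - a.arg)| := mul_pos hr (abs_pos.2 hθ)
  rw [← Real.mul_rpow hr.le (abs_nonneg _)]
  exact Real.rpow_le_rpow_of_nonpos hs (mul_abs_sin_le_norm_circleMap_sub r θ a hr.le)
    (by linarith)

/-- Conjugation followed by rotation by θ + φ is an isometry exchanging the two angles. -/
theorem norm_circleMap_sub_circleMap_comm (R r φ θ : ℝ) :
    ‖circleMap 0 R φ - circleMap 0 r θ‖ = ‖circleMap 0 R θ - circleMap 0 r φ‖ := by
  have h1 : ‖circleMap 0 R φ - circleMap 0 r θ‖ =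
      ‖(starRingEnd ℂ) (circleMap 0 R φ - circleMap 0 r θ)‖ := (Complex.norm_conj _).symm
  have h2 : (starRingEnd ℂ) (circleMap 0 R φ - circleMap 0 r θ) *
      Complex.exp ((θ + φ : ℝ) * Complex.I) = circleMap 0 R θ - circleMap 0 r φ := by
    simp only [circleMap, zero_add, map_sub, map_mul, Complex.conj_ofReal, ← Complex.exp_conj,
      Complex.conj_I, sub_mul, mul_assoc, ← Complex.exp_add]
    congr 3 <;> · push_cast; ring_nf
  rw [h1, ← h2, norm_mul, Complex.norm_exp_ofReal_mul_I, mul_one]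

/-- This is the normalization of the Poisson kernel, moved from the outer to the inner circle by
exchanging the angles. -/
theorem circleAverage_inv_norm_sub_sq {r R : ℝ} (hr : 0 ≤ r) (hrR : r < R) (φ : ℝ) :
    Real.circleAverage (fun z => (‖circleMap 0 R φ - z‖ ^ 2)⁻¹) 0 r = (R ^ 2 - r ^ 2)⁻¹ := by
  have hR : 0 < R := hr.trans_lt hrR
  have hpos : 0 < R ^ 2 - r ^ 2 := by nlinarith
  have hw : circleMap 0 r φ ∈ ball (0 : ℂ) R := by simpa [abs_of_nonneg hr] using hrR
  have h1 := (diffContOnCl_const (c := (1 : ℂ)) (s := ball (0 : ℂ) R)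
    (𝕜 := ℂ)).circleAverage_poissonKernel_smul' hw
  have h2 : Real.circleAverage (fun z : ℂ => (R ^ 2 - r ^ 2) *
      (‖z - circleMap 0 r φ‖ ^ 2)⁻¹) 0 R = 1 := by
    have h3 : (Complex.ofRealCLM (Real.circleAverage (fun z : ℂ => (R ^ 2 - r ^ 2) *
      (‖z - circleMap 0 r φ‖ ^ 2)⁻¹) 0 R)) = 1 := by
      rw [← ContinuousLinearMap.circleAverage_comp_comm, ← h1]
      · refine Real.circleAverage_congr_sphere fun z hz => ?_
        have hz' : ‖z‖ = R := by simpa [abs_of_pos hR] using hz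
        simp [hz', abs_of_nonneg hr, div_eq_mul_inv]
      · refine ContinuousOn.circleIntegrable hR.le ?_
        refine ContinuousOn.mul continuousOn_const (ContinuousOn.inv₀ (by fun_prop) fun z hz => ?_)
        have hz' : ‖z‖ = R := by simpa using hz
        have : z - circleMap 0 r φ ≠ 0 := fun h => by
          rw [sub_eq_zero.1 h] at hz'
          simp [abs_of_nonneg hr] at hz'
          linarith
        positivity
    rw [Complex.ofRealCLM_apply] at h3
    exact_mod_cast h3
  rw [Real.circleAverage_def, smul_eq_mul] at h2 ⊢
  rw [intervalIntegral.integral_const_mul] at h2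
  have h4 : ∀ θ, ‖circleMap 0 R φ - circleMap 0 r θ‖ = ‖circleMap 0 R θ - circleMap 0 r φ‖ :=
    norm_circleMap_sub_circleMap_comm R r φ
  simp only [h4]
  field_simp
  field_simp at h2
  linarith

/-! ### The differentiated Poisson–Jensen formula. -/

/-- The Herglotz integral of a real function on the circle `|ζ| = R`. -/
noncomputable def herglotzIntegral (g : ℂ → ℝ) (R : ℝ) (w : ℂ) : ℂ :=
  Real.circleAverage (fun ζ => herglotzRieszKernel 0 w ζ • (g ζ : ℂ)) 0 R

theorem norm_circleAverage_le {f : ℂ → ℂ} {R : ℝ} :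
    ‖Real.circleAverage f 0 R‖ ≤ Real.circleAverage (fun z => ‖f z‖) 0 R := by
  have hpi := Real.pi_pos
  rw [Real.circleAverage_def, Real.circleAverage_def, norm_smul, smul_eq_mul,
    Real.norm_of_nonneg (by positivity)]
  gcongr
  exact intervalIntegral.norm_integral_le_integral_norm (by positivity)

/-- The derivative has kernel 2ζ / (ζ - w)², and Cauchy's estimate is applied on the disc of radius
(R - r)/2 about z. There |ζ - z| ≤ 2 |ζ - w|, which costs a factor 4. The kernel |ζ - z|^(-2) is
kept because its average over z can be computed exactly. -/
theorem norm_iteratedDeriv_deriv_herglotzIntegral_le {g : ℂ → ℝ} {r R : ℝ} (hr : 0 ≤ r)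
    (hrR : r < R) (hg : ContinuousOn g (sphere 0 R)) {z : ℂ} (hz : ‖z‖ = r) (j : ℕ) :
    ‖iteratedDeriv j (deriv (herglotzIntegral g R)) z‖ ≤ j.factorial * (8 * R) /
      ((R - r) / 2) ^ j * Real.circleAverage (fun ζ => |g ζ| * (‖ζ - z‖ ^ 2)⁻¹) 0 R := by
  have hR : 0 < R := hr.trans_lt hrR
  set ρ : ℝ := (R - r) / 2 with hρ
  have hρ0 : 0 < ρ := by rw [hρ]; linarith
  have hgC : ContinuousOn (fun ζ => (g ζ : ℂ)) (sphere 0 R) :=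
    Complex.continuous_ofReal.comp_continuousOn hg
  have hgi : CircleIntegrable (fun ζ => (g ζ : ℂ)) 0 R := hgC.circleIntegrable hR.le
  have hball : ∀ w ∈ closedBall z ρ, w ∈ ball (0 : ℂ) R := by
    intro w hw
    rw [mem_closedBall, dist_eq_norm] at hw
    rw [mem_ball_zero_iff]
    have := norm_add_le (w - z) z
    rw [sub_add_cancel] at this
    rw [hρ] at hw
    linarith
  have hderiv : ∀ w ∈ ball (0 : ℂ) R, deriv (herglotzIntegral g R) w =
      Real.circleAverage (fun ζ => (2 * ζ / (ζ - w) ^ 2) • (g ζ : ℂ)) 0 R := fun w hw =>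
    (hasDerivAt_circleAverage_herglotzRieszKernel_smul hgi hw).deriv
  have hana : AnalyticOnNhd ℂ (deriv (herglotzIntegral g R)) (ball 0 R) :=
    (analyticOnNhd_circleAverage_herglotzRieszKernel_smul hgi).deriv
  have hdc : DiffContOnCl ℂ (deriv (herglotzIntegral g R)) (ball z ρ) := by
    apply DifferentiableOn.diffContOnCl
    rw [closure_ball _ hρ0.ne']
    exact fun w hw => (hana w (hball w hw)).differentiableAt.differentiableWithinAt
  have hsub : ∀ w, ‖w‖ < R → ∀ ζ ∈ sphere (0 : ℂ) R, ζ - w ≠ 0 := by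
    intro w hw ζ hζ h
    rw [← sub_eq_zero.1 h] at hw
    simp only [mem_sphere_zero_iff_norm] at hζ
    linarith
  set B : ℝ := Real.circleAverage (fun ζ => |g ζ| * (‖ζ - z‖ ^ 2)⁻¹) 0 R with hB
  have hbound : ∀ w ∈ sphere z ρ, ‖deriv (herglotzIntegral g R) w‖ ≤ 8 * R * B := by
    intro w hw
    have hwR := hball w (sphere_subset_closedBall hw)
    rw [hderiv w hwR]
    refine norm_circleAverage_le.trans ?_
    rw [hB, ← smul_eq_mul (8 * R), ← Real.circleAverage_fun_smul]
    refine Real.circleAverage_mono ?_ ?_ ?_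
    · refine ContinuousOn.circleIntegrable hR.le ?_
      have hk : ContinuousOn (fun ζ : ℂ => 2 * ζ / (ζ - w) ^ 2) (sphere 0 R) := by
        refine ContinuousOn.div (by fun_prop) (by fun_prop) fun ζ hζ => ?_
        exact pow_ne_zero _ (hsub w (by simpa using hwR) ζ hζ)
      exact (hk.smul hgC).norm
    · refine ContinuousOn.circleIntegrable hR.le ?_
      have hk : ContinuousOn (fun ζ : ℂ => (‖ζ - z‖ ^ 2)⁻¹) (sphere 0 R) := by
        refine ContinuousOn.inv₀ (by fun_prop) fun ζ hζ => ?_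
        exact pow_ne_zero _ (norm_ne_zero_iff.2 (hsub z (by linarith) ζ hζ))
      exact (hg.abs.mul hk).const_smul (8 * R)
    · intro ζ hζ
      rw [abs_of_pos hR] at hζ
      have hζR : ‖ζ‖ = R := by simpa using hζ
      have h1 : 0 < ‖ζ - w‖ := norm_pos_iff.2 (hsub w (by simpa using hwR) ζ hζ)
      have h2 : ‖ζ - z‖ ≤ 2 * ‖ζ - w‖ := by
        have h3 : ‖ζ - z‖ ≤ ‖ζ - w‖ + ‖w - z‖ := norm_sub_le_norm_sub_add_norm_sub _ _ _
        have h4 : ‖w - z‖ = ρ := by rw [← dist_eq_norm]; exact hw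
        have h5 : R - r ≤ ‖ζ - z‖ := by
          have := norm_sub_norm_le ζ z
          rw [hζR, hz] at this
          exact this
        rw [hρ] at h4
        linarith
      have h6 : 0 < ‖ζ - z‖ := norm_pos_iff.2 (hsub z (by linarith) ζ hζ)
      rw [norm_smul, norm_div, norm_mul, norm_pow, hζR, Complex.norm_real, Real.norm_eq_abs,
        smul_eq_mul, Complex.norm_ofNat]
      have h7 : 2 * R / ‖ζ - w‖ ^ 2 ≤ 8 * R * (‖ζ - z‖ ^ 2)⁻¹ := by
        rw [← div_eq_mul_inv, div_le_div_iff₀ (by positivity) (by positivity)]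
        nlinarith [mul_le_mul h2 h2 h6.le (by positivity)]
      calc 2 * R / ‖ζ - w‖ ^ 2 * |g ζ| ≤ 8 * R * (‖ζ - z‖ ^ 2)⁻¹ * |g ζ| := by gcongr
        _ = _ := by ring
  have := Complex.norm_iteratedDeriv_le_of_forall_mem_sphere_norm_le j hρ0 hdc hbound
  calc _ ≤ _ := this
    _ = _ := by ring

/-- `u` is holomorphic and nonzero at every point of `s`. -/
def RegularOn (u : ℂ → ℂ) (s : Set ℂ) : Prop :=
  ∀ z ∈ s, AnalyticAt ℂ u z ∧ u z ≠ 0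

theorem logDeriv_canonicalFactor {R : ℝ} (hR : 0 < R) {a w : ℂ} (ha : ‖a‖ < R) (hw : ‖w‖ < R)
    (haw : w ≠ a) : logDeriv (Complex.canonicalFactor R a) w =
      (if a = 0 then 0 else (w - R ^ 2 / (starRingEnd ℂ) a)⁻¹) - (w - a)⁻¹ := by
  have h1 : (R : ℂ) ^ 2 - (starRingEnd ℂ) a * w ≠ 0 := by
    intro h
    have h2 : ‖(R : ℂ) ^ 2‖ = ‖(starRingEnd ℂ) a * w‖ := by rw [sub_eq_zero.1 h]
    rw [norm_mul, Complex.norm_conj, norm_pow, Complex.norm_real, Real.norm_of_nonneg hR.le] at h2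
    nlinarith [norm_nonneg a, norm_nonneg w]
  have h2 : w - a ≠ 0 := sub_ne_zero.2 haw
  have hRc : (R : ℂ) ≠ 0 := by exact_mod_cast hR.ne'
  rw [Complex.canonicalFactor_def, logDeriv_div (f := fun z => (R : ℂ) ^ 2 - (starRingEnd ℂ) a * z)
    (g := fun z => (R : ℂ) * (z - a)) w h1 (mul_ne_zero hRc h2) (by fun_prop) (by fun_prop),
    logDeriv_apply, logDeriv_apply]
  have hd1 : deriv (fun z : ℂ => (R : ℂ) ^ 2 - (starRingEnd ℂ) a * z) w = -(starRingEnd ℂ) a := by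
    simp
  have hd2 : deriv (fun z : ℂ => (R : ℂ) * (z - a)) w = R := by
    simp
  rw [hd1, hd2]
  congr 1
  · split_ifs with h0
    · simp [h0]
    · have h0' : (starRingEnd ℂ) a ≠ 0 := by simpa using h0
      have h3 : w - R ^ 2 / (starRingEnd ℂ) a ≠ 0 := by
        intro h
        apply h1
        rw [sub_eq_zero.1 h]
        field_simp
        ring
      rw [div_eq_iff h1]
      rw [eq_comm, inv_mul_eq_iff_eq_mul₀ h3]
      field_simp
      ring
  · field_simp

theorem iteratedDeriv_inv_sub (a z : ℂ) (j : ℕ) :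
    ‖iteratedDeriv j (fun w => (w - a)⁻¹) z‖ = j.factorial * (‖z - a‖ ^ (j + 1))⁻¹ := by
  have h := congrFun (iter_deriv_inv_linear_sub j (1 : ℂ) a) z
  simp only [one_mul, one_pow, mul_one] at h
  rw [iteratedDeriv_eq_iterate, h, norm_mul, norm_mul, norm_pow, norm_neg, norm_one, one_pow,
    one_mul, norm_zpow, RCLike.norm_natCast]
  congr 1
  rw [show (-1 - (j : ℤ)) = -((j + 1 : ℕ) : ℤ) by push_cast; ring, zpow_neg, zpow_natCast]

theorem norm_iteratedDeriv_logDeriv_canonicalFactor_le {R : ℝ} (hR : 0 < R) {a z : ℂ}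
    (ha : ‖a‖ < R) (hz : ‖z‖ < R) (haz : z ≠ a) (j : ℕ) :
    ‖iteratedDeriv j (logDeriv (Complex.canonicalFactor R a)) z‖ ≤ j.factorial *
      ((‖z - R ^ 2 / (starRingEnd ℂ) a‖ ^ (j + 1))⁻¹ + (‖z - a‖ ^ (j + 1))⁻¹) := by
  have hev : logDeriv (Complex.canonicalFactor R a) =ᶠ[𝓝 z] fun w =>
      (if a = 0 then 0 else (w - R ^ 2 / (starRingEnd ℂ) a)⁻¹) - (w - a)⁻¹ := by
    filter_upwards [isOpen_ball.mem_nhds (mem_ball_zero_iff.2 hz), isOpen_ne.mem_nhds haz]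
      with w hw hwa
    exact logDeriv_canonicalFactor hR ha (by simpa using hw) hwa
  have hcd : ContDiffAt ℂ j (fun w => (w - a)⁻¹) z :=
    (AnalyticAt.fun_inv (f := fun w => w - a) (by fun_prop) (sub_ne_zero.2 haz)).contDiffAt
  rw [hev.iteratedDeriv_eq]
  -- For a = 0 the reflected point R² / conj a is 0 by the convention on division; its term is
  -- absent from the formula and merely nonnegative in the bound.
  by_cases h0 : a = 0
  · simp only [h0, if_true, zero_sub]
    rw [iteratedDeriv_fun_neg, norm_neg, iteratedDeriv_inv_sub]
    gcongr
    simp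
  · simp only [h0, if_false]
    have hne : z - R ^ 2 / (starRingEnd ℂ) a ≠ 0 := by
      intro h
      have h1 : ‖z‖ = R ^ 2 / ‖a‖ := by
        rw [sub_eq_zero.1 h, norm_div, Complex.norm_conj, norm_pow, Complex.norm_real,
          Real.norm_of_nonneg hR.le]
      have ha0 : 0 < ‖a‖ := norm_pos_iff.2 h0
      rw [h1, div_lt_iff₀ ha0] at hz
      nlinarith
    have hcd2 : ContDiffAt ℂ j (fun w => (w - R ^ 2 / (starRingEnd ℂ) a)⁻¹) z :=
      (AnalyticAt.fun_inv (f := fun w => w - R ^ 2 / (starRingEnd ℂ) a) (by fun_prop)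
        hne).contDiffAt
    rw [iteratedDeriv_fun_sub hcd2 hcd, mul_add]
    refine (norm_sub_le _ _).trans ?_
    rw [iteratedDeriv_inv_sub, iteratedDeriv_inv_sub]

theorem RegularOn.divisor_sphere_eq_zero {u : ℂ → ℂ} {R : ℝ} (hs : RegularOn u (sphere 0 R))
    (hu : Meromorphic u) (i : ℂ) : MeromorphicOn.divisor u (sphere 0 R) i = 0 := by
  by_cases hi : i ∈ sphere (0 : ℂ) R
  · rw [MeromorphicOn.divisor_apply hu.meromorphicOn hi,
      (hs i hi).1.meromorphicNFAt.meromorphicOrderAt_eq_zero_iff.2 (hs i hi).2]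
    simp
  · exact Function.locallyFinsuppWithin.apply_eq_zero_of_notMem _ hi

/-- Zeros and poles are removed by canonical factors, which have modulus 1 on the circle, so
boundary values of |u| are unchanged. The circle itself carries no zeros or poles, so no boundary
factor remains. -/
theorem exists_nonvanishing_factor {u : ℂ → ℂ} {R : ℝ} (hR : 0 < R) (hu : Meromorphic u)
    (hord : ∀ z, meromorphicOrderAt u z ≠ ⊤) (hs : RegularOn u (sphere 0 R)) :
    ∃ h : ℂ → ℂ, AnalyticOnNhd ℂ h (closedBall 0 R) ∧ (∀ w ∈ closedBall (0 : ℂ) R, h w ≠ 0) ∧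
      (∀ w ∈ sphere (0 : ℂ) R, ‖h w‖ = ‖u w‖) ∧
      ∀ w ∈ closedBall (0 : ℂ) R, AnalyticAt ℂ u w → u w ≠ 0 →
        h w = (∏ a ∈ (hu.meromorphicOn (s := closedBall 0 R)).divisor_ball_support_finite.toFinset,
          Complex.canonicalFactor R a w ^ MeromorphicOn.divisor u (ball 0 R) a) * u w := by
  obtain ⟨h, D⟩ := (hu.meromorphicOn (s := closedBall 0 R)).exists_ecanonicalDecomp
    fun z => hord z
  have hprod : ∀ w ∈ closedBall (0 : ℂ) R, AnalyticAt ℂ u w → u w ≠ 0 →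
        h w = (∏ a ∈ (hu.meromorphicOn (s := closedBall 0 R)).divisor_ball_support_finite.toFinset,
          Complex.canonicalFactor R a w ^ MeromorphicOn.divisor u (ball 0 R) a) * u w := by
    intro w hw hwa hw0
    rw [D.eq_smul_meromorphicTrailingCoeffAt_of_meromorphicOrderAt hw
      (hwa.meromorphicNFAt.meromorphicOrderAt_eq_zero_iff.2 hw0) hR,
      hwa.meromorphicTrailingCoeffAt_of_ne_zero hw0, smul_eq_mul]
    congr 1
    have h2 : ∏ᶠ i, (w - i) ^ (-MeromorphicOn.divisor u (sphere 0 R)) i = 1 := by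
      simp [hs.divisor_sphere_eq_zero hu]
    rw [h2, mul_one]
    refine finprod_eq_prod_of_mulSupport_subset _ fun a ha => ?_
    simp only [Set.Finite.coe_toFinset, Function.mem_support]
    intro h0
    simp [h0] at ha
  refine ⟨h, D.analyticOnNhd, D.ne_zero, fun w hw => ?_, hprod⟩
  rw [hprod w (sphere_subset_closedBall hw) (hs w hw).1 (hs w hw).2, norm_mul, norm_prod,
    Finset.prod_eq_one, one_mul]
  intro a ha
  have ha' : a ∈ ball (0 : ℂ) R :=
    (MeromorphicOn.divisor u (ball 0 R)).supportWithinDomain (by simpa using ha)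
  rw [norm_zpow, Complex.norm_canonicalFactor_eval_circle_eq_one ha' hw, one_zpow]

/-- Since log |h| is harmonic, it is the real part of its Herglotz integral L. Then h exp(-L) has
modulus 1 throughout the disc, hence is constant by the maximum principle, and h'/h = L'. -/
theorem logDeriv_eq_deriv_herglotzIntegral {h : ℂ → ℂ} {R : ℝ}
    (hh : AnalyticOnNhd ℂ h (closedBall 0 R)) (h0 : ∀ w ∈ closedBall (0 : ℂ) R, h w ≠ 0)
    {w : ℂ} (hw : w ∈ ball (0 : ℂ) R) :
    logDeriv h w = deriv (herglotzIntegral (fun ζ => Real.log ‖h ζ‖) R) w := by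
  have hR : 0 < R := pos_of_mem_ball hw
  set g : ℂ → ℝ := fun ζ => Real.log ‖h ζ‖ with hg
  have hgc : ContinuousOn g (sphere 0 R) := by
    refine ContinuousOn.log (hh.continuousOn.mono sphere_subset_closedBall).norm fun ζ hζ => ?_
    exact norm_ne_zero_iff.2 (h0 ζ (sphere_subset_closedBall hζ))
  have hgi : CircleIntegrable g 0 R := hgc.circleIntegrable hR.le
  have hgi' : CircleIntegrable (fun ζ => (g ζ : ℂ)) 0 R :=
    (Complex.continuous_ofReal.comp_continuousOn hgc).circleIntegrable hR.le
  have hL : AnalyticOnNhd ℂ (herglotzIntegral g R) (ball 0 R) :=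
    analyticOnNhd_circleAverage_herglotzRieszKernel_smul hgi'
  have hre : ∀ w ∈ ball (0 : ℂ) R, (herglotzIntegral g R w).re = g w := by
    intro w hw
    rw [herglotzIntegral, re_circleAverage_herglotzRieszKernel_smul hgi hw]
    exact InnerProductSpace.HarmonicOnNhd.circleAverage_re_herglotzRieszKernel_smul
      (fun x hx => (hh x hx).harmonicAt_log_norm (h0 x hx)) hw
  set p : ℂ → ℂ := fun w => h w * Complex.exp (-herglotzIntegral g R w) with hp
  have hpn : ∀ w ∈ ball (0 : ℂ) R, ‖p w‖ = 1 := by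
    intro w hw
    have h1 : 0 < ‖h w‖ := norm_pos_iff.2 (h0 w (ball_subset_closedBall hw))
    rw [hp, norm_mul, Complex.norm_exp, Complex.neg_re, hre w hw, hg, Real.exp_neg,
      Real.exp_log h1, mul_inv_cancel₀ h1.ne']
  have hpd : DifferentiableOn ℂ p (ball 0 R) := by
    intro x hx
    exact (((hh x (ball_subset_closedBall hx)).differentiableAt).mul
      ((hL x hx).differentiableAt.neg.cexp)).differentiableWithinAt
  have hconst := Complex.eqOn_of_isPreconnected_of_isMaxOn_norm
    (convex_ball (0 : ℂ) R).isPreconnected isOpen_ball hpd hw (fun x hx => by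
      simp [hpn x hx, hpn w hw])
  have hev : h =ᶠ[𝓝 w] fun x => p w * Complex.exp (herglotzIntegral g R x) := by
    filter_upwards [isOpen_ball.mem_nhds hw] with x hx
    have h1 : p x = p w := hconst hx
    rw [← h1, hp, mul_assoc, ← Complex.exp_add, neg_add_cancel, Complex.exp_zero, mul_one]
  have hpw : p w ≠ 0 := fun h => by simpa [h] using hpn w hw
  have hd : HasDerivAt (fun x => p w * Complex.exp (herglotzIntegral g R x))
      (p w * (Complex.exp (herglotzIntegral g R w) * deriv (herglotzIntegral g R) w)) w :=
    ((hL w hw).differentiableAt.hasDerivAt.cexp).const_mul _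
  rw [logDeriv_apply, hev.deriv_eq, hd.deriv, hev.eq_of_nhds]
  have := Complex.exp_ne_zero (herglotzIntegral g R w)
  field_simp

theorem herglotzIntegral_congr {g₁ g₂ : ℂ → ℝ} {R : ℝ} (hR : 0 < R)
    (h : ∀ ζ ∈ sphere (0 : ℂ) R, g₁ ζ = g₂ ζ) : herglotzIntegral g₁ R = herglotzIntegral g₂ R := by
  funext w
  refine Real.circleAverage_congr_sphere fun ζ hζ => ?_
  rw [abs_of_pos hR] at hζ
  simp only [h ζ hζ]

/-- Logarithmic differentiation of the factorization by canonical factors. The identity holds on a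
neighbourhood of z, so it can be differentiated further. -/
theorem logDeriv_eventuallyEq_herglotzIntegral_sub_sum {u : ℂ → ℂ} {R : ℝ} (hR : 0 < R)
    (hu : Meromorphic u) (hord : ∀ z, meromorphicOrderAt u z ≠ ⊤) (hs : RegularOn u (sphere 0 R))
    {z : ℂ} (hz : ‖z‖ < R) (hza : AnalyticAt ℂ u z) (hz0 : u z ≠ 0) :
    logDeriv u =ᶠ[𝓝 z] fun w => deriv (herglotzIntegral (fun ζ => Real.log ‖u ζ‖) R) w -
      ∑ a ∈ (hu.meromorphicOn (s := closedBall 0 R)).divisor_ball_support_finite.toFinset,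
        (MeromorphicOn.divisor u (ball 0 R) a : ℂ) * logDeriv (Complex.canonicalFactor R a) w := by
  obtain ⟨h, hh, hh0, hnorm, hprod⟩ := exists_nonvanishing_factor hR hu hord hs
  set s := (hu.meromorphicOn (s := closedBall 0 R)).divisor_ball_support_finite.toFinset with hsdef
  have hcongr : herglotzIntegral (fun ζ => Real.log ‖u ζ‖) R =
      herglotzIntegral (fun ζ => Real.log ‖h ζ‖) R :=
    herglotzIntegral_congr hR fun ζ hζ => by rw [hnorm ζ hζ]
  rw [hcongr]
  have hreg : ∀ᶠ w in 𝓝 z, w ∈ ball (0 : ℂ) R ∧ AnalyticAt ℂ u w ∧ u w ≠ 0 :=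
    (isOpen_ball.eventually_mem (mem_ball_zero_iff.2 hz)).and
      (hza.eventually_analyticAt.and (hza.continuousAt.eventually_ne hz0))
  filter_upwards [hreg.eventually_nhds] with w hw
  obtain ⟨hwR, hwa, hw0⟩ := hw.self_of_nhds
  have hev : h =ᶠ[𝓝 w] fun x => (∏ a ∈ s,
      Complex.canonicalFactor R a x ^ MeromorphicOn.divisor u (ball 0 R) a) * u x := by
    filter_upwards [hw] with x hx
    exact hprod x (ball_subset_closedBall hx.1) hx.2.1 hx.2.2
  have hmem : ∀ a ∈ s, a ∈ ball (0 : ℂ) R ∧ w ≠ a := by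
    intro a ha
    have ha' : MeromorphicOn.divisor u (ball 0 R) a ≠ 0 := by simpa [hsdef] using ha
    have haR : a ∈ ball (0 : ℂ) R :=
      (MeromorphicOn.divisor u (ball 0 R)).supportWithinDomain (by simpa using ha')
    refine ⟨haR, ?_⟩
    rintro rfl
    apply ha'
    rw [MeromorphicOn.divisor_apply hu.meromorphicOn haR,
      hwa.meromorphicNFAt.meromorphicOrderAt_eq_zero_iff.2 hw0]
    simp
  have hcd : ∀ a ∈ s, DifferentiableAt ℂ (Complex.canonicalFactor R a) w := fun a ha =>
    (Complex.analyticOnNhd_canonicalFactor R a w (hmem a ha).2).differentiableAt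
  have hc0 : ∀ a ∈ s, Complex.canonicalFactor R a w ≠ 0 := fun a ha =>
    Complex.canonicalFactor_ne_zero (hmem a ha).1 (ball_subset_closedBall hwR) (hmem a ha).2
  have hcz : ∀ a ∈ s, DifferentiableAt ℂ (fun x =>
      Complex.canonicalFactor R a x ^ MeromorphicOn.divisor u (ball 0 R) a) w := fun a ha =>
    (hcd a ha).zpow (Or.inl (hc0 a ha))
  have hlog : logDeriv h w = (∑ a ∈ s, (MeromorphicOn.divisor u (ball 0 R) a : ℂ) *
      logDeriv (Complex.canonicalFactor R a) w) + logDeriv u w := by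
    have h1 : logDeriv h w = logDeriv (fun x => (∏ a ∈ s,
        Complex.canonicalFactor R a x ^ MeromorphicOn.divisor u (ball 0 R) a) * u x) w := by
      rw [logDeriv_apply, logDeriv_apply, hev.deriv_eq, hev.eq_of_nhds]
    rw [h1, logDeriv_mul w (Finset.prod_ne_zero_iff.2 fun a ha => zpow_ne_zero _ (hc0 a ha)) hw0
      (DifferentiableAt.fun_finsetProd hcz) hwa.differentiableAt,
      logDeriv_prod (f := fun a x => Complex.canonicalFactor R a x ^
        MeromorphicOn.divisor u (ball 0 R) a) (fun a ha => zpow_ne_zero _ (hc0 a ha)) hcz]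
    congr 1
    exact Finset.sum_congr rfl fun a ha => logDeriv_fun_zpow (hcd a ha) _
  rw [← logDeriv_eq_deriv_herglotzIntegral hh hh0 hwR, hlog]
  ring

/-- Pointwise bound for the derivatives of a logarithmic derivative. -/
theorem norm_iteratedDeriv_logDeriv_le {u : ℂ → ℂ} {r R : ℝ} (hr : 0 ≤ r) (hrR : r < R)
    (hu : Meromorphic u) (hord : ∀ z, meromorphicOrderAt u z ≠ ⊤) (hs : RegularOn u (sphere 0 R))
    {z : ℂ} (hz : ‖z‖ = r) (hza : AnalyticAt ℂ u z) (hz0 : u z ≠ 0) (j : ℕ) :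
    ‖iteratedDeriv j (logDeriv u) z‖ ≤ j.factorial * (8 * R) / ((R - r) / 2) ^ j *
        Real.circleAverage (fun ζ => |Real.log ‖u ζ‖| * (‖ζ - z‖ ^ 2)⁻¹) 0 R +
      ∑ a ∈ (hu.meromorphicOn (s := closedBall 0 R)).divisor_ball_support_finite.toFinset,
        |(MeromorphicOn.divisor u (ball 0 R) a : ℝ)| * (j.factorial *
      ((‖z - R ^ 2 / (starRingEnd ℂ) a‖ ^ (j + 1))⁻¹ + (‖z - a‖ ^ (j + 1))⁻¹)) := by
  have hR : 0 < R := hr.trans_lt hrR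
  have hzR : ‖z‖ < R := hz ▸ hrR
  set s := (hu.meromorphicOn (s := closedBall 0 R)).divisor_ball_support_finite.toFinset with hsdef
  have hmem : ∀ a ∈ s, a ∈ ball (0 : ℂ) R ∧ z ≠ a := by
    intro a ha
    have ha' : MeromorphicOn.divisor u (ball 0 R) a ≠ 0 := by simpa [hsdef] using ha
    have haR : a ∈ ball (0 : ℂ) R :=
      (MeromorphicOn.divisor u (ball 0 R)).supportWithinDomain (by simpa using ha')
    refine ⟨haR, ?_⟩
    rintro rfl
    apply ha'
    rw [MeromorphicOn.divisor_apply hu.meromorphicOn haR,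
      hza.meromorphicNFAt.meromorphicOrderAt_eq_zero_iff.2 hz0]
    simp
  have hgc : ContinuousOn (fun ζ => Real.log ‖u ζ‖) (sphere 0 R) := fun ζ hζ =>
    ((hs ζ hζ).1.continuousAt.norm.log (norm_ne_zero_iff.2 (hs ζ hζ).2)).continuousWithinAt
  have hgi : CircleIntegrable (fun ζ => ((Real.log ‖u ζ‖ : ℝ) : ℂ)) 0 R :=
    (Complex.continuous_ofReal.comp_continuousOn hgc).circleIntegrable hR.le
  have hLd : ContDiffAt ℂ j (deriv (herglotzIntegral (fun ζ => Real.log ‖u ζ‖) R)) z :=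
    ((analyticOnNhd_circleAverage_herglotzRieszKernel_smul hgi).deriv z
      (mem_ball_zero_iff.2 hzR)).contDiffAt
  have hcf : ∀ a ∈ s, ContDiffAt ℂ j (logDeriv (Complex.canonicalFactor R a)) z := by
    intro a ha
    have h1 := Complex.analyticOnNhd_canonicalFactor R a z (hmem a ha).2
    have h2 : AnalyticAt ℂ (logDeriv (Complex.canonicalFactor R a)) z :=
      h1.deriv.div h1 (Complex.canonicalFactor_ne_zero (hmem a ha).1
        (by simpa using hzR.le) (hmem a ha).2)
    exact h2.contDiffAt
  rw [(logDeriv_eventuallyEq_herglotzIntegral_sub_sum hR hu hord hs hzR hza hz0).iteratedDeriv_eq,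
    iteratedDeriv_fun_sub hLd (ContDiffAt.sum fun a ha => contDiffAt_const.mul (hcf a ha))]
  refine (norm_sub_le _ _).trans (add_le_add
    (norm_iteratedDeriv_deriv_herglotzIntegral_le hr hrR hgc hz j) ?_)
  rw [iteratedDeriv_fun_sum fun a ha => contDiffAt_const.mul (hcf a ha)]
  refine (norm_sum_le _ _).trans (Finset.sum_le_sum fun a ha => ?_)
  rw [iteratedDeriv_const_mul_field, norm_mul, Complex.norm_intCast]
  gcongr
  exact norm_iteratedDeriv_logDeriv_canonicalFactor_le hR (by simpa using (hmem a ha).1) hzR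
    (hmem a ha).2 j

/-! ### Averaging the bound for logarithmic derivatives. -/

theorem Real.rpow_finset_sum_le_sum_rpow {ι : Type*} (s : Finset ι) {f : ι → ℝ} {p : ℝ} (hp0 : 0 < p)
    (hp1 : p ≤ 1) (hf : ∀ i ∈ s, 0 ≤ f i) : (∑ i ∈ s, f i) ^ p ≤ ∑ i ∈ s, f i ^ p := by
  classical
  induction s using Finset.induction_on with
  | empty => simp [Real.zero_rpow hp0.ne']
  | insert a s ha ih =>
    rw [Finset.sum_insert ha, Finset.sum_insert ha]
    have h1 : 0 ≤ ∑ i ∈ s, f i :=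
      Finset.sum_nonneg fun i hi => hf i (Finset.mem_insert_of_mem hi)
    exact (Real.rpow_add_le_add_rpow (hf a (Finset.mem_insert_self _ _)) h1 hp0.le hp1).trans
      (by gcongr; exact ih fun i hi => hf i (Finset.mem_insert_of_mem hi))

/-- A form of Jensen's inequality for the logarithm. -/
theorem circleAverage_log_one_add_le {x y : ℂ → ℝ} {β r M : ℝ} (hβ0 : 0 < β) (hβ1 : β ≤ 1)
    (hx : ∀ z ∈ sphere (0 : ℂ) |r|, 0 ≤ x z) (hxy : ∀ z ∈ sphere (0 : ℂ) |r|, x z ^ β ≤ y z)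
    (hxi : CircleIntegrable (fun z => Real.log (1 + x z)) 0 r) (hyi : CircleIntegrable y 0 r)
    (hM0 : 0 ≤ M) (hM : Real.circleAverage y 0 r ≤ M) :
    Real.circleAverage (fun z => Real.log (1 + x z)) 0 r ≤ β⁻¹ * Real.log (1 + M) := by
  -- The tangent line to log at 1 + M replaces Jensen's inequality: it is affine in y and returns
  -- log(1 + M) when the average of y equals M.
  have h1 : ∀ z ∈ sphere (0 : ℂ) |r|, Real.log (1 + x z) ≤
      β⁻¹ * (Real.log (1 + M) + -1 + (1 + M)⁻¹) + (β⁻¹ * (1 + M)⁻¹) • y z := by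
    intro z hz
    have hx0 := hx z hz
    have hy0 : 0 ≤ y z := (Real.rpow_nonneg hx0 _).trans (hxy z hz)
    have h2 : (1 + x z) ^ β ≤ 1 + y z := by
      refine (Real.rpow_add_le_add_rpow zero_le_one hx0 hβ0.le hβ1).trans ?_
      rw [Real.one_rpow]
      linarith [hxy z hz]
    have h3 : β * Real.log (1 + x z) ≤ Real.log (1 + y z) := by
      rw [← Real.log_rpow (by linarith)]
      exact Real.log_le_log (by positivity) h2
    have h4 : Real.log (1 + y z) ≤ Real.log (1 + M) + ((1 + y z) / (1 + M) - 1) := by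
      have := Real.log_le_sub_one_of_pos (x := (1 + y z) / (1 + M)) (by positivity)
      rw [Real.log_div (by positivity) (by positivity)] at this
      linarith
    have h5 : Real.log (1 + x z) ≤ β⁻¹ * (Real.log (1 + M) + ((1 + y z) / (1 + M) - 1)) := by
      rw [← div_eq_inv_mul, le_div_iff₀ hβ0]
      linarith
    refine h5.trans (le_of_eq ?_)
    simp only [smul_eq_mul]
    ring
  have hyi' : CircleIntegrable (fun z => (β⁻¹ * (1 + M)⁻¹) • y z) 0 r := hyi.const_fun_smul
  refine (Real.circleAverage_mono hxi ((circleIntegrable_const _ _ _).add hyi') h1).trans ?_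
  rw [Real.circleAverage_add (circleIntegrable_const _ _ _) hyi', Real.circleAverage_const,
    Real.circleAverage_fun_smul, smul_eq_mul]
  have h6 : β⁻¹ * (1 + M)⁻¹ * Real.circleAverage y 0 r ≤ β⁻¹ * (1 + M)⁻¹ * M := by gcongr
  refine (add_le_add_right h6 _).trans (le_of_eq ?_)
  field_simp
  ring

theorem norm_circleMap_sub_pos {r R : ℝ} (hr : 0 ≤ r) (hrR : r < R) (θ φ : ℝ) :
    0 < ‖circleMap 0 R φ - circleMap 0 r θ‖ := by
  rw [norm_pos_iff, sub_ne_zero]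
  intro h
  have := congrArg norm h
  simp [abs_of_nonneg hr, abs_of_nonneg (hr.trans hrR.le)] at this
  linarith

theorem continuous_mul_inv_norm_circleMap_sub_sq {w : ℂ → ℝ} {r R : ℝ} (hr : 0 ≤ r) (hrR : r < R)
    (hw : ContinuousOn w (sphere 0 R)) :
    Continuous fun p : ℝ × ℝ =>
      w (circleMap 0 R p.2) * (‖circleMap 0 R p.2 - circleMap 0 r p.1‖ ^ 2)⁻¹ := by
  have hw' : Continuous fun p : ℝ × ℝ => w (circleMap 0 R p.2) :=
    hw.comp_continuous (by fun_prop) fun p => circleMap_mem_sphere _ (hr.trans hrR.le) _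
  refine hw'.mul (Continuous.inv₀ (by fun_prop) fun p => ?_)
  have := norm_circleMap_sub_pos hr hrR p.1 p.2
  positivity

theorem circleIntegrable_circleAverage_mul_inv_norm_sub_sq {w : ℂ → ℝ} {r R : ℝ} (hr : 0 ≤ r)
    (hrR : r < R) (hw : ContinuousOn w (sphere 0 R)) :
    CircleIntegrable (fun z => Real.circleAverage (fun ζ => w ζ * (‖ζ - z‖ ^ 2)⁻¹) 0 R) 0 r := by
  refine Continuous.intervalIntegrable ?_ _ _
  simp only [Real.circleAverage_def, smul_eq_mul]
  refine Continuous.mul continuous_const ?_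
  exact intervalIntegral.continuous_parametric_intervalIntegral_of_continuous'
    (f := fun θ φ => w (circleMap 0 R φ) * (‖circleMap 0 R φ - circleMap 0 r θ‖ ^ 2)⁻¹)
    (continuous_mul_inv_norm_circleMap_sub_sq hr hrR hw) _ _

/-- Fubini, followed by the exact inner average of the Poisson-type kernel. -/
theorem circleAverage_circleAverage_mul_inv_norm_sub_sq {w : ℂ → ℝ} {r R : ℝ} (hr : 0 ≤ r)
    (hrR : r < R) (hw : ContinuousOn w (sphere 0 R)) :
    Real.circleAverage (fun z => Real.circleAverage (fun ζ => w ζ * (‖ζ - z‖ ^ 2)⁻¹) 0 R) 0 r =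
      (R ^ 2 - r ^ 2)⁻¹ * Real.circleAverage w 0 R := by
  have hswap := MeasureTheory.intervalIntegral_intervalIntegral_swap
    (F := fun θ φ => w (circleMap 0 R φ) * (‖circleMap 0 R φ - circleMap 0 r θ‖ ^ 2)⁻¹)
    (a := 0) (b := 2 * Real.pi) (c := 0) (d := 2 * Real.pi) (by
      have := (continuous_mul_inv_norm_circleMap_sub_sq hr hrR hw).continuousOn.integrableOn_compact
        (μ := volume) ((isCompact_uIcc (a := (0 : ℝ)) (b := 2 * Real.pi)).prod
          (isCompact_uIcc (a := (0 : ℝ)) (b := 2 * Real.pi)))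
      exact this.mono_set (Set.prod_mono Set.uIoc_subset_uIcc Set.uIoc_subset_uIcc))
  simp only [Real.circleAverage_def, smul_eq_mul, intervalIntegral.integral_const_mul]
  rw [hswap]
  have h1 : ∀ φ, ∫ θ in (0 : ℝ)..2 * Real.pi,
      w (circleMap 0 R φ) * (‖circleMap 0 R φ - circleMap 0 r θ‖ ^ 2)⁻¹ =
      w (circleMap 0 R φ) * (2 * Real.pi * (R ^ 2 - r ^ 2)⁻¹) := by
    intro φ
    rw [intervalIntegral.integral_const_mul, ← circleAverage_inv_norm_sub_sq hr hrR φ,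
      Real.circleAverage_def, smul_eq_mul]
    field_simp
  simp only [h1, intervalIntegral.integral_mul_const]
  field_simp

theorem AnalyticAt.logDeriv_of_ne_zero {u : ℂ → ℂ} {z : ℂ} (hu : AnalyticAt ℂ u z) (h0 : u z ≠ 0) :
    AnalyticAt ℂ (logDeriv u) z :=
  hu.deriv.div hu h0

theorem AnalyticAt.iteratedDeriv_complex {u : ℂ → ℂ} {z : ℂ} (hu : AnalyticAt ℂ u z) (j : ℕ) :
    AnalyticAt ℂ (iteratedDeriv j u) z := by
  rw [iteratedDeriv_eq_iterate]
  exact hu.iterated_deriv j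

theorem RegularOn.continuousOn_iteratedDeriv_logDeriv {u : ℂ → ℂ} {s : Set ℂ} (hu : RegularOn u s)
    (j : ℕ) : ContinuousOn (iteratedDeriv j (logDeriv u)) s := fun z hz =>
  (((hu z hz).1.logDeriv_of_ne_zero (hu z hz).2).iteratedDeriv_complex
    j).continuousAt.continuousWithinAt

theorem RegularOn.continuousOn_log_norm {u : ℂ → ℂ} {s : Set ℂ} (hu : RegularOn u s) :
    ContinuousOn (fun z => Real.log ‖u z‖) s := fun z hz =>
  ((hu z hz).1.continuousAt.norm.log (norm_ne_zero_iff.2 (hu z hz).2)).continuousWithinAt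

/-- The exponent α / (j + 1) turns a pole of order j + 1 into an integrable singularity. The
coefficient c will be |ord| · j!, an integer, so a power with exponent at most 1 does not exceed it.
-/
theorem rpow_mul_inv_pow_le {c t α : ℝ} (hc : c = 0 ∨ 1 ≤ c) (ht : 0 ≤ t) (hα0 : 0 < α) (hα1 : α < 1)
    (j : ℕ) : (c * (t ^ (j + 1))⁻¹) ^ (α / (j + 1)) ≤ c * t ^ (-α) := by
  have hβ0 : 0 < α / (j + 1) := by positivity
  have hβ1 : α / (j + 1) ≤ 1 := by
    rw [div_le_one (by positivity)]
    have : (0 : ℝ) ≤ j := by positivity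
    linarith
  rcases hc with rfl | hc
  · simp [Real.zero_rpow hβ0.ne']
  · rw [Real.mul_rpow (by linarith) (by positivity)]
    have h1 : ((t ^ (j + 1))⁻¹) ^ (α / (j + 1)) = t ^ (-α) := by
      rw [Real.inv_rpow (by positivity), ← Real.rpow_natCast, ← Real.rpow_mul ht,
        Real.rpow_neg ht]
      congr 2
      push_cast
      field_simp
    rw [h1]
    gcongr
    exact (Real.rpow_le_rpow_of_exponent_le hc hβ1).trans (Real.rpow_one c).le

/-- The averaged form of the lemma on the logarithmic derivative. -/
theorem exists_circleAverage_log_iteratedDeriv_logDeriv_le (j : ℕ) {α : ℝ} (hα0 : 0 < α)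
    (hα1 : α < 1) : ∃ C : ℝ, 0 ≤ C ∧ ∀ (u : ℂ → ℂ) (r R : ℝ) (hu : Meromorphic u), 0 < r → r < R →
      (∀ z, meromorphicOrderAt u z ≠ ⊤) → RegularOn u (sphere 0 r) → RegularOn u (sphere 0 R) →
      Real.circleAverage (fun z => Real.log (1 + ‖iteratedDeriv j (logDeriv u) z‖)) 0 r ≤
        (j + 1) / α * Real.log (2 + C *
          (∑ a ∈ (hu.meromorphicOn (s := closedBall 0 R)).divisor_ball_support_finite.toFinset,
            |(MeromorphicOn.divisor u (ball 0 R) a : ℝ)|) * r ^ (-α) +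
          C * ((R - r) ^ (j + 1))⁻¹ * Real.circleAverage (fun z => |Real.log ‖u z‖|) 0 R) := by
  obtain ⟨K, hK0, hK⟩ := exists_circleAverage_norm_sub_rpow_neg_le hα0 hα1
  refine ⟨j.factorial * (2 * K + 8 * 2 ^ j), by positivity, ?_⟩
  intro u r R hu hr hrR hord hsr hsR
  have hR : 0 < R := hr.trans hrR
  set s := (hu.meromorphicOn (s := closedBall 0 R)).divisor_ball_support_finite.toFinset with hsdef
  set D := MeromorphicOn.divisor u (ball 0 R) with hD
  set W := Real.circleAverage (fun z => |Real.log ‖u z‖|) 0 R with hW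
  have hW0 : 0 ≤ W := Real.circleAverage_nonneg_of_nonneg fun z _ => abs_nonneg _
  have hβ0 : 0 < α / (j + 1) := by positivity
  have hβ1 : α / (j + 1) ≤ 1 := by
    rw [div_le_one (by positivity)]
    have : (0 : ℝ) ≤ j := by positivity
    linarith
  have hj1 : (1 : ℝ) ≤ j.factorial := by exact_mod_cast Nat.one_le_iff_ne_zero.2 j.factorial_ne_zero
  have hc : ∀ a, |(D a : ℝ)| * j.factorial = 0 ∨ 1 ≤ |(D a : ℝ)| * j.factorial := by
    intro a
    rcases eq_or_ne (D a) 0 with h | h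
    · left; simp [h]
    · right
      have : (1 : ℝ) ≤ |(D a : ℝ)| := by exact_mod_cast Int.one_le_abs h
      nlinarith
  have hmem : ∀ a ∈ s, a ∈ ball (0 : ℂ) R ∧ ‖a‖ ≠ r := by
    intro a ha
    have ha' : MeromorphicOn.divisor u (ball 0 R) a ≠ 0 := by simpa [hsdef] using ha
    have haR : a ∈ ball (0 : ℂ) R :=
      (MeromorphicOn.divisor u (ball 0 R)).supportWithinDomain (by simpa using ha')
    refine ⟨haR, fun har => ?_⟩
    obtain ⟨h1, h2⟩ := hsr a (by simpa using har)
    apply ha'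
    rw [MeromorphicOn.divisor_apply hu.meromorphicOn haR,
      h1.meromorphicNFAt.meromorphicOrderAt_eq_zero_iff.2 h2]
    simp
  have hstar : ∀ a ∈ s, ‖(R : ℂ) ^ 2 / (starRingEnd ℂ) a‖ ≠ r := by
    intro a ha
    rw [norm_div, norm_pow, Complex.norm_conj, Complex.norm_real, Real.norm_of_nonneg hR.le]
    have haR : ‖a‖ < R := by simpa using (hmem a ha).1
    rcases eq_or_lt_of_le (norm_nonneg a) with h | h
    · rw [← h, div_zero]; exact hr.ne
    · refine (hrR.trans ?_).ne'
      rw [lt_div_iff₀ h]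
      nlinarith
  set Y : ℂ → ℝ := fun z => Real.circleAverage (fun ζ => |Real.log ‖u ζ‖| * (‖ζ - z‖ ^ 2)⁻¹) 0 R
    with hY
  set A : ℝ := j.factorial * (8 * R) / ((R - r) / 2) ^ j with hA
  have hRr : 0 < R - r := sub_pos.2 hrR
  have hA0 : 0 ≤ A := by positivity
  have hwc : ContinuousOn (fun z => |Real.log ‖u z‖|) (sphere 0 R) := hsR.continuousOn_log_norm.abs
  have hY0 : ∀ z, 0 ≤ Y z := fun z => Real.circleAverage_nonneg_of_nonneg fun ζ _ => by positivity
  have hYi : CircleIntegrable Y 0 r :=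
    circleIntegrable_circleAverage_mul_inv_norm_sub_sq hr.le hrR hwc
  have hcont : ∀ a, ‖a‖ ≠ r → CircleIntegrable (fun z => ‖z - a‖ ^ (-α)) 0 r := by
    intro a ha
    refine ContinuousOn.circleIntegrable hr.le (ContinuousOn.rpow_const (by fun_prop)
      fun z hz => Or.inl fun h => ha ?_)
    rw [← sub_eq_zero.1 (norm_eq_zero.1 h)]
    simpa using hz
  -- A majorant for the power α / (j + 1) of the pointwise bound: subadditivity separates the terms,
  -- and the leading 1 covers the case A · Y ≤ 1.
  set y : ℂ → ℝ := fun z => 1 + A • Y z + ∑ a ∈ s, (|(D a : ℝ)| * j.factorial) •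
    (‖z - R ^ 2 / (starRingEnd ℂ) a‖ ^ (-α) + ‖z - a‖ ^ (-α)) with hy
  have hAYi : CircleIntegrable (fun z => A • Y z) 0 r := hYi.const_fun_smul
  have h1Yi : CircleIntegrable (fun z => 1 + A • Y z) 0 r :=
    (circleIntegrable_const (1 : ℝ) 0 r).add hAYi
  have hai : ∀ a ∈ s, CircleIntegrable (fun z =>
      ‖z - R ^ 2 / (starRingEnd ℂ) a‖ ^ (-α) + ‖z - a‖ ^ (-α)) 0 r := fun a ha =>
    (hcont _ (hstar a ha)).add (hcont _ (hmem a ha).2)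
  have hai' : ∀ a ∈ s, CircleIntegrable (fun z => (|(D a : ℝ)| * j.factorial) •
      (‖z - R ^ 2 / (starRingEnd ℂ) a‖ ^ (-α) + ‖z - a‖ ^ (-α))) 0 r := fun a ha =>
    (hai a ha).const_fun_smul
  have hsum : CircleIntegrable (fun z => ∑ a ∈ s, (|(D a : ℝ)| * j.factorial) •
      (‖z - R ^ 2 / (starRingEnd ℂ) a‖ ^ (-α) + ‖z - a‖ ^ (-α))) 0 r :=
    CircleIntegrable.fun_sum s hai'
  have hbound : Real.circleAverage y 0 r ≤ 1 + A * ((R ^ 2 - r ^ 2)⁻¹ * W) +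
      ∑ a ∈ s, |(D a : ℝ)| * j.factorial * (2 * K * r ^ (-α)) := by
    rw [hy, Real.circleAverage_fun_add h1Yi hsum,
      Real.circleAverage_fun_add (circleIntegrable_const _ _ _) hAYi, Real.circleAverage_const,
      Real.circleAverage_fun_smul, Real.circleAverage_fun_sum hai', hY,
      circleAverage_circleAverage_mul_inv_norm_sub_sq hr.le hrR hwc, smul_eq_mul]
    gcongr with a ha
    rw [Real.circleAverage_fun_smul, smul_eq_mul,
      Real.circleAverage_fun_add (hcont _ (hstar a ha)) (hcont _ (hmem a ha).2)]
    gcongr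
    linarith [hK r _ hr (hstar a ha), hK r a hr (hmem a ha).2]
  have hpt : ∀ z ∈ sphere (0 : ℂ) |r|,
      ‖iteratedDeriv j (logDeriv u) z‖ ^ (α / (j + 1)) ≤ y z := by
    intro z hz
    rw [abs_of_pos hr] at hz
    have hz' : ‖z‖ = r := by simpa using hz
    have hb := norm_iteratedDeriv_logDeriv_le hr.le hrR hu hord hsR hz' (hsr z hz).1 (hsr z hz).2 j
    refine (Real.rpow_le_rpow (norm_nonneg _) hb hβ0.le).trans ?_
    have hAY : 0 ≤ A * Y z := mul_nonneg hA0 (hY0 z)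
    have hterm : ∀ a, 0 ≤ |(D a : ℝ)| * (j.factorial *
      ((‖z - R ^ 2 / (starRingEnd ℂ) a‖ ^ (j + 1))⁻¹ + (‖z - a‖ ^ (j + 1))⁻¹)) :=
      fun a => by positivity
    refine (Real.rpow_add_le_add_rpow hAY (Finset.sum_nonneg fun a _ => hterm a) hβ0.le
      hβ1).trans (add_le_add ?_ ?_)
    · rw [smul_eq_mul]
      rcases le_total (A * Y z) 1 with h | h
      · exact (Real.rpow_le_one hAY h hβ0.le).trans (by linarith)
      · exact ((Real.rpow_le_rpow_of_exponent_le h hβ1).trans (Real.rpow_one _).le).trans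
          (by linarith)
    · refine (Real.rpow_finset_sum_le_sum_rpow s hβ0 hβ1 fun a _ => hterm a).trans
        (Finset.sum_le_sum fun a _ => ?_)
      rw [← mul_assoc, mul_add, smul_eq_mul, mul_add]
      refine (Real.rpow_add_le_add_rpow (by positivity) (by positivity) hβ0.le hβ1).trans ?_
      exact add_le_add (rpow_mul_inv_pow_le (hc a) (norm_nonneg _) hα0 hα1 j)
        (rpow_mul_inv_pow_le (hc a) (norm_nonneg _) hα0 hα1 j)
  have hxi : CircleIntegrable (fun z => Real.log (1 + ‖iteratedDeriv j (logDeriv u) z‖)) 0 r := by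
    refine ContinuousOn.circleIntegrable hr.le (ContinuousOn.log ?_ fun z _ => ?_)
    · exact continuousOn_const.add (hsr.continuousOn_iteratedDeriv_logDeriv j).norm
    · positivity
  have hS0 : 0 ≤ ∑ a ∈ s, |(D a : ℝ)| := Finset.sum_nonneg fun _ _ => abs_nonneg _
  have hrα : 0 ≤ r ^ (-α) := Real.rpow_nonneg hr.le _
  -- One factor R - r comes from R² - r², and R / (R + r) ≤ 1 absorbs the R in A, so the resulting
  -- constant is independent of R.
  have hAle : A * (R ^ 2 - r ^ 2)⁻¹ ≤ j.factorial * (8 * 2 ^ j) * ((R - r) ^ (j + 1))⁻¹ := by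
    have h1 : A * (R ^ 2 - r ^ 2)⁻¹ =
        j.factorial * (8 * 2 ^ j) * ((R - r) ^ (j + 1))⁻¹ * (R / (R + r)) := by
      rw [hA, show R ^ 2 - r ^ 2 = (R - r) * (R + r) by ring, div_pow]
      field_simp
      ring
    rw [h1]
    exact mul_le_of_le_one_right (by positivity) ((div_le_one (by positivity)).2 (by linarith))
  refine (circleAverage_log_one_add_le hβ0 hβ1 (fun z _ => norm_nonneg _) hpt hxi (h1Yi.add hsum)
    (M := 1 + j.factorial * (2 * K + 8 * 2 ^ j) * (∑ a ∈ s, |(D a : ℝ)|) *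
      r ^ (-α) + j.factorial * (2 * K + 8 * 2 ^ j) * ((R - r) ^ (j + 1))⁻¹ * W) ?_ (hbound.trans ?_)).trans
    (le_of_eq ?_)
  · positivity
  · rw [← Finset.sum_mul, ← Finset.sum_mul, ← mul_assoc A]
    have h1 : A * (R ^ 2 - r ^ 2)⁻¹ * W ≤
        j.factorial * (2 * K + 8 * 2 ^ j) * ((R - r) ^ (j + 1))⁻¹ * W := by
      refine mul_le_mul_of_nonneg_right (hAle.trans ?_) hW0
      gcongr
      linarith
    have h2 : (∑ a ∈ s, |(D a : ℝ)|) * j.factorial * (2 * K * r ^ (-α)) ≤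
        j.factorial * (2 * K + 8 * 2 ^ j) * (∑ a ∈ s, |(D a : ℝ)|) * r ^ (-α) := by
      rw [show (∑ a ∈ s, |(D a : ℝ)|) * j.factorial * (2 * K * r ^ (-α)) =
        j.factorial * (2 * K) * (∑ a ∈ s, |(D a : ℝ)|) * r ^ (-α) by ring]
      gcongr
      linarith [show (0 : ℝ) ≤ 8 * 2 ^ j by positivity]
    linarith
  · rw [inv_div]
    congr 2
    ring

/-! ### Jensen's formula and estimates of first main theorem type. -/

theorem countable_setOf_not_of_eventually_nhdsNE {p : ℂ → Prop}
    (hp : ∀ z, ∀ᶠ w in 𝓝[≠] z, p w) : {z | ¬ p z}.Countable := by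
  have h1 : {z | p z} ∈ codiscrete ℂ := by
    rw [mem_codiscrete]
    intro z
    rw [disjoint_principal_right, compl_compl]
    exact hp z
  exact (HereditarilyLindelofSpace.isLindelof _).countable_of_isDiscrete (mem_codiscrete'.1 h1).2

/-- Circles through an exceptional point have countably many radii; they form a null set and can be
added to any exceptional set. -/
theorem countable_norm_image_setOf_not {p : ℂ → Prop} (hp : ∀ z, ∀ᶠ w in 𝓝[≠] z, p w) :
    {r : ℝ | ∃ z : ℂ, ‖z‖ = r ∧ ¬ p z}.Countable := by
  refine ((countable_setOf_not_of_eventually_nhdsNE hp).image norm).mono ?_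
  rintro r ⟨z, hz, hpz⟩
  exact ⟨z, hpz, hz⟩

theorem eventually_nhdsNE_ne_zero_of_entire {h : ℂ → ℂ} (hd : Differentiable ℂ h)
    (h0 : ∃ z, h z ≠ 0) (z : ℂ) : ∀ᶠ w in 𝓝[≠] z, h w ≠ 0 := by
  have ha : AnalyticOnNhd ℂ h Set.univ := fun w _ => hd.analyticAt w
  rcases (ha z (Set.mem_univ z)).eventually_eq_zero_or_eventually_ne_zero with h1 | h1
  · obtain ⟨w, hw⟩ := h0
    exact absurd (ha.eqOn_zero_of_preconnected_of_eventuallyEq_zero isPreconnected_univ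
      (Set.mem_univ z) h1 (Set.mem_univ w)) hw
  · exact h1

theorem meromorphicOrderAt_ne_top_of_entire {h : ℂ → ℂ} (hd : Differentiable ℂ h)
    (h0 : ∃ z, h z ≠ 0) (z : ℂ) : meromorphicOrderAt h z ≠ ⊤ :=
  (meromorphicOrderAt_ne_top_iff_eventually_ne_zero (hd.analyticAt z).meromorphicAt).2
    (eventually_nhdsNE_ne_zero_of_entire hd h0 z)

/-- Jensen's formula, as a difference of averages. -/
theorem circleAverage_log_norm_sub_eq_sum {u : ℂ → ℂ} (hu : Meromorphic u) {r : ℝ} (hr : 1 ≤ r) :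
    Real.circleAverage (fun z => Real.log ‖u z‖) 0 r -
      Real.circleAverage (fun z => Real.log ‖u z‖) 0 1 =
    ∑ a ∈ ((MeromorphicOn.divisor u (closedBall 0 r)).finiteSupport
      (isCompact_closedBall 0 r)).toFinset,
      ((meromorphicOrderAt u a).untop₀ : ℝ) * Real.log (r / max 1 ‖a‖) := by
  have hr0 : 0 < r := by linarith
  set s := ((MeromorphicOn.divisor u (closedBall 0 r)).finiteSupport
      (isCompact_closedBall 0 r)).toFinset with hs
  have hmem : ∀ a, a ∉ s → ‖a‖ ≤ r → (meromorphicOrderAt u a).untop₀ = 0 := by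
    intro a ha har
    have h1 : MeromorphicOn.divisor u (closedBall 0 r) a = 0 := by simpa [hs] using ha
    rwa [MeromorphicOn.divisor_apply hu.meromorphicOn (by simpa using har)] at h1
  have hsr : ∀ a ∈ s, ‖a‖ ≤ r := by
    intro a ha
    have ha' : MeromorphicOn.divisor u (closedBall 0 r) a ≠ 0 := by simpa [hs] using ha
    simpa using (MeromorphicOn.divisor u (closedBall 0 r)).supportWithinDomain (by simpa using ha')
  have key : ∀ ρ, 1 ≤ ρ → ρ ≤ r → Real.circleAverage (fun z => Real.log ‖u z‖) 0 ρ =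
      ∑ a ∈ s, ((meromorphicOrderAt u a).untop₀ : ℝ) * (if ‖a‖ ≤ ρ then Real.log (ρ * ‖a‖⁻¹) else 0)
        + (meromorphicOrderAt u 0).untop₀ * Real.log ρ
        + Real.log ‖meromorphicTrailingCoeffAt u 0‖ := by
    intro ρ h1 h2
    have hρ0 : 0 < ρ := by linarith
    rw [MeromorphicOn.circleAverage_log_norm hρ0.ne' hu.meromorphicOn, abs_of_pos hρ0,
      MeromorphicOn.divisor_apply hu.meromorphicOn (by simpa using hρ0.le),
      finsum_eq_sum_of_support_subset (s := s)]
    · congr 2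
      refine Finset.sum_congr rfl fun a _ => ?_
      by_cases ha : ‖a‖ ≤ ρ
      · rw [MeromorphicOn.divisor_apply hu.meromorphicOn (by simpa using ha)]
        simp [ha]
      · rw [Function.locallyFinsuppWithin.apply_eq_zero_of_notMem _ (by simpa using ha)]
        simp [ha]
    · intro a ha
      by_contra has
      apply ha
      by_cases ha' : ‖a‖ ≤ ρ
      · simp only
        rw [MeromorphicOn.divisor_apply hu.meromorphicOn (by simpa using ha'),
          hmem a (by simpa using has) (ha'.trans h2)]
        simp
      · simp only
        rw [Function.locallyFinsuppWithin.apply_eq_zero_of_notMem _ (by simpa using ha')]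
        simp
  -- The origin contributes 0 to the sum in `key`, since log(ρ · 0⁻¹) = 0 by convention. Its
  -- separate term log r is folded back in here, in agreement with log(r / max 1 0).
  have h0 : ((meromorphicOrderAt u 0).untop₀ : ℝ) * Real.log r =
      ∑ a ∈ s, if a = 0 then ((meromorphicOrderAt u a).untop₀ : ℝ) * Real.log r else 0 := by
    rw [Finset.sum_ite_eq' s]
    split_ifs with h
    · rfl
    · rw [hmem 0 h (by simpa using hr0.le)]; simp
  rw [key r hr le_rfl, key 1 le_rfl hr, h0, Real.log_one, mul_zero, add_zero,
    add_sub_add_right_eq_sub, ← Finset.sum_add_distrib, ← Finset.sum_sub_distrib]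
  refine Finset.sum_congr rfl fun a ha => ?_
  rw [if_pos (hsr a ha), one_mul]
  rcases eq_or_ne a 0 with rfl | ha0
  · simp
  · have hn : 0 < ‖a‖ := norm_pos_iff.2 ha0
    rw [if_neg ha0]
    rcases le_or_gt ‖a‖ 1 with h1 | h1
    · rw [if_pos h1, max_eq_left h1, div_one, Real.log_mul hr0.ne' (by positivity)]
      ring
    · rw [if_neg h1.not_ge, max_eq_right h1.le, div_eq_mul_inv]
      ring

theorem untop₀_meromorphicOrderAt_nonneg {h : ℂ → ℂ} (hd : Differentiable ℂ h) (a : ℂ) :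
    (0 : ℝ) ≤ ((meromorphicOrderAt h a).untop₀ : ℝ) := by
  have h1 := (hd.analyticAt a).meromorphicOrderAt_nonneg
  exact_mod_cast WithTop.untop₀_nonneg.2 h1

/-- A nonzero entire function of growth at most that of `‖F‖ ^ d`. -/
structure DominatedBy {n : ℕ} (F : ℂ → Fin (n + 1) → ℂ) (d : ℕ) (h : ℂ → ℂ) : Prop where
  differentiable : Differentiable ℂ h
  exists_ne_zero : ∃ z, h z ≠ 0
  exists_le : ∃ B : ℝ, 0 < B ∧ ∀ z, ‖h z‖ ≤ B * ‖F z‖ ^ d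

theorem circleIntegrable_log_norm_of_ne_zero {n : ℕ} {F : ℂ → Fin (n + 1) → ℂ}
    (hF : Differentiable ℂ F) (hF0 : ∀ z, F z ≠ 0) (r : ℝ) :
    CircleIntegrable (fun z => Real.log ‖F z‖) 0 r := by
  refine Continuous.intervalIntegrable ?_ _ _
  exact (hF.continuous.comp (continuous_circleMap 0 r)).norm.log fun θ => norm_ne_zero_iff.2 (hF0 _)

theorem circleIntegrable_log_norm_of_meromorphic {u : ℂ → ℂ} (hu : Meromorphic u) (r : ℝ) :
    CircleIntegrable (fun z => Real.log ‖u z‖) 0 r :=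
  MeromorphicOn.circleIntegrable_log_norm hu.meromorphicOn

theorem circleAverage_log_norm_one_le {h : ℂ → ℂ} (hd : Differentiable ℂ h) {r : ℝ} (hr : 1 ≤ r) :
    Real.circleAverage (fun z => Real.log ‖h z‖) 0 1 ≤
      Real.circleAverage (fun z => Real.log ‖h z‖) 0 r := by
  have hm : Meromorphic h := fun z => (hd.analyticAt z).meromorphicAt
  have h1 := circleAverage_log_norm_sub_eq_sum hm hr
  have h2 : 0 ≤ ∑ a ∈ ((MeromorphicOn.divisor h (closedBall 0 r)).finiteSupport
      (isCompact_closedBall 0 r)).toFinset,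
      ((meromorphicOrderAt h a).untop₀ : ℝ) * Real.log (r / max 1 ‖a‖) := by
    refine Finset.sum_nonneg fun a ha => mul_nonneg (untop₀_meromorphicOrderAt_nonneg hd a) ?_
    have ha' : MeromorphicOn.divisor h (closedBall 0 r) a ≠ 0 := by simpa using ha
    have har : ‖a‖ ≤ r := by
      simpa using (MeromorphicOn.divisor h (closedBall 0 r)).supportWithinDomain
        (by simpa using ha')
    exact Real.log_nonneg ((one_le_div (by positivity)).2 (max_le hr har))
  linarith

/-- In Jensen's formula on |z| = R', every zero of modulus less than R ≥ 1 has weight at least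
log(R'/R) ≥ (R' - R)/R'. All other contributions are nonnegative because h is entire. -/
theorem sum_meromorphicOrderAt_mul_le {h : ℂ → ℂ} (hd : Differentiable ℂ h) {R R' : ℝ} (hR : 1 ≤ R)
    (hRR : R < R') (s : Finset ℂ) (hs : ∀ a ∈ s, ‖a‖ < R) :
    (∑ a ∈ s, ((meromorphicOrderAt h a).untop₀ : ℝ)) * ((R' - R) / R') ≤
      Real.circleAverage (fun z => Real.log ‖h z‖) 0 R' -
        Real.circleAverage (fun z => Real.log ‖h z‖) 0 1 := by
  classical
  have hm : Meromorphic h := fun z => (hd.analyticAt z).meromorphicAt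
  have hR0 : 0 < R := by linarith
  have hR'0 : 0 < R' := by linarith
  rw [circleAverage_log_norm_sub_eq_sum hm (hR.trans hRR.le)]
  set t := ((MeromorphicOn.divisor h (closedBall 0 R')).finiteSupport
      (isCompact_closedBall 0 R')).toFinset with ht
  have hmem : ∀ a ∈ s, a ∉ t → ((meromorphicOrderAt h a).untop₀ : ℝ) = 0 := by
    intro a has ha
    have h1 : MeromorphicOn.divisor h (closedBall 0 R') a = 0 := by simpa [ht] using ha
    rw [MeromorphicOn.divisor_apply hm.meromorphicOn
      (by simpa using (hs a has).le.trans hRR.le)] at h1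
    exact_mod_cast h1
  rw [Finset.sum_mul, ← Finset.sum_filter_add_sum_filter_not s (· ∈ t),
    Finset.sum_eq_zero (s := s.filter (· ∉ t)) fun a ha => by
      rw [Finset.mem_filter] at ha
      rw [hmem a ha.1 ha.2, zero_mul], add_zero]
  have hlog : (R' - R) / R' ≤ Real.log (R' / R) := by
    have := Real.one_sub_inv_le_log_of_pos (x := R' / R) (by positivity)
    refine le_trans (le_of_eq ?_) this
    field_simp
  have hsub : s.filter (· ∈ t) ⊆ t := fun a ha => (Finset.mem_filter.1 ha).2
  refine le_trans (Finset.sum_le_sum fun a ha => ?_) (Finset.sum_le_sum_of_subset_of_nonneg hsub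
    fun a ha _ => mul_nonneg (untop₀_meromorphicOrderAt_nonneg hd a) ?_)
  · refine mul_le_mul_of_nonneg_left (hlog.trans (Real.log_le_log (by positivity) ?_))
      (untop₀_meromorphicOrderAt_nonneg hd a)
    gcongr
    exact max_le hR (hs a (Finset.mem_filter.1 ha).1).le
  · have ha' : MeromorphicOn.divisor h (closedBall 0 R') a ≠ 0 := by simpa [ht] using ha
    have har : ‖a‖ ≤ R' := by
      simpa using (MeromorphicOn.divisor h (closedBall 0 R')).supportWithinDomain
        (by simpa using ha')
    exact Real.log_nonneg ((one_le_div (by positivity)).2 (max_le (hR.trans hRR.le) har))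

/-- Estimates of first main theorem type for an entire function bounded by a power of `‖F‖`. -/
theorem exists_forall_circleAverage_sub_log_norm_le {n : ℕ} {F : ℂ → Fin (n + 1) → ℂ}
    (hF : Differentiable ℂ F) (hF0 : ∀ z, F z ≠ 0) {h : ℂ → ℂ} (hd : Differentiable ℂ h)
    (h0 : ∃ z, h z ≠ 0) {B : ℝ} (hB : 0 < B) {d : ℕ} (hle : ∀ z, ‖h z‖ ≤ B * ‖F z‖ ^ d) :
    ∃ K : ℝ, 0 ≤ K ∧
      (∀ R, 1 ≤ R → Real.circleAverage
        (fun z => Real.log B + d * Real.log ‖F z‖ - Real.log ‖h z‖) 0 R ≤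
          K * max (orderFunction F R) 1) ∧
      ∀ R R' : ℝ, 1 ≤ R → R < R' → ∀ s : Finset ℂ, (∀ a ∈ s, ‖a‖ < R) →
        (∑ a ∈ s, ((meromorphicOrderAt h a).untop₀ : ℝ)) ≤
          K * max (orderFunction F R') 1 * (R' / (R' - R)) := by
  have hm : Meromorphic h := fun z => (hd.analyticAt z).meromorphicAt
  set c := Real.circleAverage (fun z => Real.log ‖h z‖) 0 1 with hc
  have hgi : ∀ R, CircleIntegrable (fun z => Real.log B + (d : ℝ) • Real.log ‖F z‖) 0 R := fun R =>
    (circleIntegrable_const _ _ _).add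
      (circleIntegrable_log_norm_of_ne_zero hF hF0 R).const_fun_smul
  have hgavg : ∀ R, Real.circleAverage (fun z => Real.log B + (d : ℝ) • Real.log ‖F z‖) 0 R =
      Real.log B + d * orderFunction F R := by
    intro R
    rw [Real.circleAverage_fun_add (circleIntegrable_const _ _ _)
      (circleIntegrable_log_norm_of_ne_zero hF hF0 R).const_fun_smul, Real.circleAverage_const,
      Real.circleAverage_fun_smul, smul_eq_mul, orderFunction_eq_circleAverage]
  have hK : ∀ R, Real.log B + d * orderFunction F R - c ≤
      (|Real.log B| + d + |c|) * max (orderFunction F R) 1 := by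
    intro R
    have h1 : 1 ≤ max (orderFunction F R) 1 := le_max_right _ _
    have h2 : (d : ℝ) * orderFunction F R ≤ d * max (orderFunction F R) 1 := by
      gcongr; exact le_max_left _ _
    nlinarith [le_abs_self (Real.log B), neg_abs_le c, abs_nonneg (Real.log B), abs_nonneg c]
  have hle' : ∀ R, 1 ≤ R → Real.circleAverage (fun z => Real.log ‖h z‖) 0 R ≤
      Real.log B + d * orderFunction F R := by
    intro R hR
    rw [← hgavg]
    -- At a zero of h the convention log 0 = 0 may violate the upper bound. The minimum repairs this
    -- on a discrete set without changing the average.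
    have hcd : (fun z => min (Real.log ‖h z‖) (Real.log B + (d : ℝ) • Real.log ‖F z‖))
        =ᶠ[codiscreteWithin (sphere (0 : ℂ) |R|)] fun z => Real.log ‖h z‖ := by
      have h1 : {z | h z ≠ 0} ∈ codiscrete ℂ := by
        rw [mem_codiscrete]
        intro z
        rw [disjoint_principal_right, compl_compl]
        exact eventually_nhdsNE_ne_zero_of_entire hd h0 z
      filter_upwards [codiscreteWithin_mono (Set.subset_univ (sphere (0 : ℂ) |R|)) h1] with z hz
      have h2 := Real.log_le_log (norm_pos_iff.2 hz) (hle z)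
      rw [Real.log_mul hB.ne' (pow_ne_zero _ (norm_ne_zero_iff.2 (hF0 z))), Real.log_pow] at h2
      exact min_eq_left h2
    rw [← Real.circleAverage_congr_codiscreteWithin hcd (by linarith)]
    refine Real.circleAverage_mono ?_ (hgi R) fun z _ => min_le_right _ _
    exact (circleIntegrable_log_norm_of_meromorphic hm R).congr_codiscreteWithin hcd.symm
  refine ⟨|Real.log B| + d + |c|, by positivity, ?_, ?_⟩
  · intro R hR
    refine le_trans ?_ (hK R)
    have h1 := Real.circleAverage_sub (hgi R) (circleIntegrable_log_norm_of_meromorphic hm R)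
    rw [hgavg] at h1
    have h2 := circleAverage_log_norm_one_le hd hR
    have h3 : Real.circleAverage (fun z => Real.log B + d * Real.log ‖F z‖ - Real.log ‖h z‖) 0 R =
      Real.log B + d * orderFunction F R - Real.circleAverage (fun z => Real.log ‖h z‖) 0 R := h1
    linarith
  · intro R R' hR hRR s hs
    have h1 := sum_meromorphicOrderAt_mul_le hd hR hRR s hs
    have h2 := hle' R' (hR.trans hRR.le)
    have h3 := hK R'
    have hpos : 0 < (R' - R) / R' := div_pos (by linarith) (by linarith)
    rw [← le_div_iff₀ hpos] at h1
    refine h1.trans ?_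
    rw [div_eq_mul_inv, inv_div]
    have : 0 ≤ R' / (R' - R) := div_nonneg (by linarith) (by linarith)
    gcongr
    linarith

theorem meromorphicOrderAt_div_ne_top {h₁ h₂ : ℂ → ℂ} (hd₁ : Differentiable ℂ h₁)
    (hd₂ : Differentiable ℂ h₂) (h₁0 : ∃ z, h₁ z ≠ 0) (h₂0 : ∃ z, h₂ z ≠ 0) (z : ℂ) :
    meromorphicOrderAt (fun z => h₁ z / h₂ z) z ≠ ⊤ := by
  rw [meromorphicOrderAt_ne_top_iff_eventually_ne_zero
    ((hd₁.analyticAt z).meromorphicAt.fun_div (hd₂.analyticAt z).meromorphicAt)]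
  filter_upwards [eventually_nhdsNE_ne_zero_of_entire hd₁ h₁0 z,
    eventually_nhdsNE_ne_zero_of_entire hd₂ h₂0 z] with w h1 h2
  exact div_ne_zero h1 h2

theorem abs_untop₀_meromorphicOrderAt_div_le {h₁ h₂ : ℂ → ℂ} (hd₁ : Differentiable ℂ h₁)
    (hd₂ : Differentiable ℂ h₂) (h₁0 : ∃ z, h₁ z ≠ 0) (h₂0 : ∃ z, h₂ z ≠ 0) (a : ℂ) :
    |((meromorphicOrderAt (fun z => h₁ z / h₂ z) a).untop₀ : ℝ)| ≤
      (meromorphicOrderAt h₁ a).untop₀ + (meromorphicOrderAt h₂ a).untop₀ := by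
  have h1 := untop₀_meromorphicOrderAt_nonneg hd₁ a
  have h2 := untop₀_meromorphicOrderAt_nonneg hd₂ a
  obtain ⟨p, hp⟩ := WithTop.ne_top_iff_exists.1 (meromorphicOrderAt_ne_top_of_entire hd₁ h₁0 a)
  obtain ⟨q, hq⟩ := WithTop.ne_top_iff_exists.1 (meromorphicOrderAt_ne_top_of_entire hd₂ h₂0 a)
  have h3 : meromorphicOrderAt (fun z => h₁ z / h₂ z) a = ((p - q : ℤ) : WithTop ℤ) := by
    rw [fun_meromorphicOrderAt_div (hd₁.analyticAt a).meromorphicAt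
      (hd₂.analyticAt a).meromorphicAt, ← hp, ← hq]
    rfl
  rw [← hp] at h1
  rw [← hq] at h2
  rw [h3, ← hp, ← hq]
  simp only [WithTop.untop₀_coe, Int.cast_sub] at h1 h2 ⊢
  rw [abs_le]
  constructor <;> linarith

theorem RegularOn.fun_div {h₁ h₂ : ℂ → ℂ} {s : Set ℂ} (hs₁ : RegularOn h₁ s)
    (hs₂ : RegularOn h₂ s) : RegularOn (fun z => h₁ z / h₂ z) s := fun z hz =>
  ⟨(hs₁ z hz).1.fun_div (hs₂ z hz).1 (hs₂ z hz).2, div_ne_zero (hs₁ z hz).2 (hs₂ z hz).2⟩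

/-- The functions log B + d log ‖F‖ - log |h_i| are nonnegative where h_i ≠ 0, and their difference
is log |h₁ / h₂| up to sign. Their sum therefore dominates its absolute value. -/
theorem DominatedBy.exists_bound_div {n : ℕ} {F : ℂ → Fin (n + 1) → ℂ}
    (hF : Differentiable ℂ F) (hF0 : ∀ z, F z ≠ 0) {d : ℕ} {h₁ h₂ : ℂ → ℂ}
    (hh₁ : DominatedBy F d h₁) (hh₂ : DominatedBy F d h₂) :
    ∃ K : ℝ, 0 ≤ K ∧ (∀ R, 1 ≤ R → RegularOn h₁ (sphere 0 R) → RegularOn h₂ (sphere 0 R) →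
        Real.circleAverage (fun z => |Real.log ‖h₁ z / h₂ z‖|) 0 R ≤
          K * max (orderFunction F R) 1) ∧
      ∀ R R' : ℝ, 1 ≤ R → R < R' → ∀ s : Finset ℂ, (∀ a ∈ s, ‖a‖ < R) →
        ∑ a ∈ s, |((meromorphicOrderAt (fun z => h₁ z / h₂ z) a).untop₀ : ℝ)| ≤
          K * max (orderFunction F R') 1 * (R' / (R' - R)) := by
  obtain ⟨hd₁, h₁0, B₁, hB₁, hle₁⟩ := hh₁
  obtain ⟨hd₂, h₂0, B₂, hB₂, hle₂⟩ := hh₂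
  set B := max B₁ B₂ with hBdef
  have hB : 0 < B := hB₁.trans_le (le_max_left _ _)
  have hle₁' : ∀ z, ‖h₁ z‖ ≤ B * ‖F z‖ ^ d := fun z => (hle₁ z).trans (by
    gcongr; exact le_max_left _ _)
  have hle₂' : ∀ z, ‖h₂ z‖ ≤ B * ‖F z‖ ^ d := fun z => (hle₂ z).trans (by
    gcongr; exact le_max_right _ _)
  obtain ⟨K₁, hK₁, hA₁, hS₁⟩ :=
    exists_forall_circleAverage_sub_log_norm_le hF hF0 hd₁ h₁0 hB hle₁'
  obtain ⟨K₂, hK₂, hA₂, hS₂⟩ :=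
    exists_forall_circleAverage_sub_log_norm_le hF hF0 hd₂ h₂0 hB hle₂'
  refine ⟨K₁ + K₂, by positivity, ?_, ?_⟩
  · intro R hR hs₁ hs₂
    have hR0 : 0 ≤ R := by linarith
    have hcF : ContinuousOn (fun z => Real.log ‖F z‖) (sphere 0 R) :=
      (hF.continuous.norm.log fun z => norm_ne_zero_iff.2 (hF0 z)).continuousOn
    have hi : ∀ {h : ℂ → ℂ}, RegularOn h (sphere 0 R) → CircleIntegrable (fun z =>
        Real.log B + d * Real.log ‖F z‖ - Real.log ‖h z‖) 0 R := fun hs =>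
      ((continuousOn_const.add (continuousOn_const.mul hcF)).sub
        hs.continuousOn_log_norm).circleIntegrable hR0
    have hpos : ∀ {h : ℂ → ℂ}, (∀ z, ‖h z‖ ≤ B * ‖F z‖ ^ d) → ∀ z, h z ≠ 0 →
        0 ≤ Real.log B + d * Real.log ‖F z‖ - Real.log ‖h z‖ := by
      intro h hle z hz
      have h2 := Real.log_le_log (norm_pos_iff.2 hz) (hle z)
      rw [Real.log_mul hB.ne' (pow_ne_zero _ (norm_ne_zero_iff.2 (hF0 z))), Real.log_pow] at h2
      linarith
    have h1 : ∀ z ∈ sphere (0 : ℂ) |R|, |Real.log ‖h₁ z / h₂ z‖| ≤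
        (Real.log B + d * Real.log ‖F z‖ - Real.log ‖h₁ z‖) +
        (Real.log B + d * Real.log ‖F z‖ - Real.log ‖h₂ z‖) := by
      intro z hz
      rw [abs_of_nonneg hR0] at hz
      have hz₁ := (hs₁ z hz).2
      have hz₂ := (hs₂ z hz).2
      rw [norm_div, Real.log_div (norm_ne_zero_iff.2 hz₁) (norm_ne_zero_iff.2 hz₂), abs_le]
      have := hpos hle₁' z hz₁
      have := hpos hle₂' z hz₂
      constructor <;> linarith
    have h2 : CircleIntegrable (fun z => |Real.log ‖h₁ z / h₂ z‖|) 0 R :=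
      ((hs₁.fun_div hs₂).continuousOn_log_norm.abs).circleIntegrable hR0
    refine (Real.circleAverage_mono h2 ((hi hs₁).add (hi hs₂)) h1).trans ?_
    rw [Real.circleAverage_add (hi hs₁) (hi hs₂), add_mul]
    exact add_le_add (hA₁ R hR) (hA₂ R hR)
  · intro R R' hR hRR s hs
    refine (Finset.sum_le_sum fun a _ =>
      abs_untop₀_meromorphicOrderAt_div_le hd₁ hd₂ h₁0 h₂0 a).trans ?_
    rw [Finset.sum_add_distrib]
    refine (add_le_add (hS₁ R R' hR hRR s hs) (hS₂ R R' hR hRR s hs)).trans (le_of_eq ?_)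
    ring

/-! Calculus of error terms relative to a function `τ ≥ 1`. -/

theorem IsSmallErrorTerm.add {τ S₁ S₂ : ℝ → ℝ} (h₁ : IsSmallErrorTerm τ S₁)
    (h₂ : IsSmallErrorTerm τ S₂) : IsSmallErrorTerm τ fun r => S₁ r + S₂ r := by
  obtain ⟨C₁, h₁⟩ := h₁
  obtain ⟨C₂, h₂⟩ := h₂
  refine ⟨C₁ + C₂, fun δ hδ => ?_⟩
  obtain ⟨E₁, hE₁, h₁⟩ := h₁ (δ / 2) (by positivity)
  obtain ⟨E₂, hE₂, h₂⟩ := h₂ (δ / 2) (by positivity)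
  refine ⟨E₁ ∪ E₂, measure_union_lt_top hE₁ hE₂, fun r hr hrE => ?_⟩
  have := h₁ r hr fun h => hrE (Or.inl h)
  have := h₂ r hr fun h => hrE (Or.inr h)
  linarith

theorem IsSmallErrorTerm.const_mul {τ S : ℝ → ℝ} (h : IsSmallErrorTerm τ S) {c : ℝ} (hc : 0 < c) :
    IsSmallErrorTerm τ fun r => c * S r := by
  obtain ⟨C, h⟩ := h
  refine ⟨c * C, fun δ hδ => ?_⟩
  obtain ⟨E, hE, h⟩ := h (δ / c) (by positivity)
  refine ⟨E, hE, fun r hr hrE => (mul_le_mul_of_nonneg_left (h r hr hrE) hc.le).trans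
    (le_of_eq ?_)⟩
  field_simp

theorem isSmallErrorTerm_zero (τ : ℝ → ℝ) : IsSmallErrorTerm τ fun _ => 0 := by
  refine ⟨0, fun δ hδ => ⟨Set.Ioo 0 1, by simp, fun r hr hrE => ?_⟩⟩
  have h1 : 1 ≤ r := by
    by_contra h
    exact hrE ⟨hr, not_le.1 h⟩
  have := Real.log_nonneg h1
  rw [zero_mul, zero_add]
  positivity

theorem isSmallErrorTerm_const (τ : ℝ → ℝ) (c : ℝ) : IsSmallErrorTerm τ fun _ => c := by
  refine ⟨0, fun δ hδ => ⟨Set.Ioo 0 (Real.exp (c / δ)), by simp, fun r hr hrE => ?_⟩⟩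
  have h1 : Real.exp (c / δ) ≤ r := by
    by_contra h
    exact hrE ⟨hr, not_le.1 h⟩
  have h2 := (Real.le_log_iff_exp_le hr).2 h1
  rw [div_le_iff₀ hδ] at h2
  linarith

theorem IsSmallErrorTerm.sum {ι : Type*} {τ : ℝ → ℝ} (s : Finset ι) {S : ι → ℝ → ℝ}
    (h : ∀ i ∈ s, IsSmallErrorTerm τ (S i)) : IsSmallErrorTerm τ fun r => ∑ i ∈ s, S i r := by
  classical
  induction s using Finset.induction_on with
  | empty => simpa using isSmallErrorTerm_zero τ
  | insert a s ha ih =>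
    simp only [Finset.sum_insert ha]
    exact (h a (Finset.mem_insert_self _ _)).add
      (ih fun i hi => h i (Finset.mem_insert_of_mem hi))

theorem IsSmallErrorTerm.mono {τ S S' : ℝ → ℝ} (h : IsSmallErrorTerm τ S) {E : Set ℝ}
    (hE : volume E < ⊤) (hS : ∀ r, 1 ≤ r → r ∉ E → S' r ≤ S r) : IsSmallErrorTerm τ S' := by
  obtain ⟨C, h⟩ := h
  refine ⟨C, fun δ hδ => ?_⟩
  obtain ⟨E', hE', h⟩ := h δ hδ
  refine ⟨Set.Ioo 0 1 ∪ E ∪ E', measure_union_lt_top (measure_union_lt_top (by simp) hE) hE',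
    fun r hr hrE => ?_⟩
  have h1 : 1 ≤ r := by
    by_contra hr1
    exact hrE (Or.inl (Or.inl ⟨hr, not_le.1 hr1⟩))
  exact (hS r h1 fun h => hrE (Or.inl (Or.inr h))).trans (h r hr fun h => hrE (Or.inr h))

/-- The set of radii of circles on which an entire function has zeros. -/
def zeroRadii (h : ℂ → ℂ) : Set ℝ := {r | ∃ z : ℂ, ‖z‖ = r ∧ ¬ h z ≠ 0}

theorem countable_zeroRadii {h : ℂ → ℂ} (hd : Differentiable ℂ h) (h0 : ∃ z, h z ≠ 0) :
    (zeroRadii h).Countable :=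
  countable_norm_image_setOf_not (eventually_nhdsNE_ne_zero_of_entire hd h0)

theorem regularOn_sphere_of_notMem_zeroRadii {h : ℂ → ℂ} (hd : Differentiable ℂ h) {r : ℝ}
    (hr : r ∉ zeroRadii h) : RegularOn h (sphere 0 r) := fun z hz =>
  ⟨hd.analyticAt z, fun h0 => hr ⟨z, by simpa using hz, not_not.2 h0⟩⟩

theorem exists_mem_Ioo_notMem_of_countable {s : Set ℝ} (hs : s.Countable) {a b : ℝ} (hab : a < b) :
    ∃ x ∈ Set.Ioo a b, x ∉ s := by
  by_contra! h
  have h1 : volume (Set.Ioo a b) = 0 := (hs.mono h).measure_zero _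
  rw [Real.volume_Ioo, ENNReal.ofReal_eq_zero] at h1
  linarith

/-- The coefficient of log τ must not depend on δ, and α ≥ 1/2 keeps it below 2cN. Only α is tuned
to δ: the term (1 - α) log r uses half of δ log r, and for large r the other half absorbs log C. -/
theorem IsSmallErrorTerm.of_forall_log_le {τ S : ℝ → ℝ} (hτ : ∀ r, 1 ≤ τ r) {c : ℝ} {N : ℝ}
    (hc : 0 < c) (hN : 0 ≤ N)
    (h : ∀ α, 1 / 2 ≤ α → α < 1 → ∃ C : ℝ, 1 ≤ C ∧ ∃ E : Set ℝ, volume E < ⊤ ∧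
      ∀ r, 1 ≤ r → r ∉ E → S r ≤ c / α * Real.log (C * τ r ^ N * r ^ (1 - α))) :
    IsSmallErrorTerm τ S := by
  refine ⟨2 * c * N, fun δ hδ => ?_⟩
  set α := max (1 / 2) (1 - δ / (4 * c)) with hα
  have hα1 : α < 1 := max_lt (by norm_num) (by have : 0 < δ / (4 * c) := by positivity
                                               linarith)
  have hα2 : 1 / 2 ≤ α := le_max_left _ _
  have hα3 : 1 - α ≤ δ / (4 * c) := by linarith [le_max_right (1 / 2) (1 - δ / (4 * c))]
  obtain ⟨C, hC, E, hE, h⟩ := h α hα2 hα1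
  set ρ := Real.exp (4 * c * Real.log C / δ)
  refine ⟨Set.Ioo 0 1 ∪ Set.Ioo 0 ρ ∪ E, measure_union_lt_top (measure_union_lt_top (by simp)
    (by simp)) hE, fun r hr hrE => ?_⟩
  have h1 : 1 ≤ r := by
    by_contra hr1
    exact hrE (Or.inl (Or.inl ⟨hr, not_le.1 hr1⟩))
  have h2 : ρ ≤ r := by
    by_contra hr1
    exact hrE (Or.inl (Or.inr ⟨hr, not_le.1 hr1⟩))
  have h3 := h r h1 fun h => hrE (Or.inr h)
  have h4 := (Real.le_log_iff_exp_le hr).2 h2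
  rw [div_le_iff₀ hδ] at h4
  have hτ0 : 0 < τ r := by linarith [hτ r]
  have hlr := Real.log_nonneg h1
  have hlτ := Real.log_nonneg (hτ r)
  have hlC := Real.log_nonneg hC
  rw [Real.log_mul (by positivity) (by positivity), Real.log_mul (by positivity) (by positivity),
    Real.log_rpow hτ0, Real.log_rpow hr] at h3
  have h5 : c / α ≤ 2 * c := by
    rw [div_le_iff₀ (by linarith)]
    nlinarith
  have h6 : (1 - α) * Real.log r ≤ δ / (4 * c) * Real.log r := by gcongr
  have h7 : 0 ≤ Real.log C + N * Real.log (τ r) + (1 - α) * Real.log r := by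
    have : 0 ≤ (1 - α) * Real.log r := mul_nonneg (by linarith) hlr
    positivity
  calc S r ≤ 2 * c * (Real.log C + N * Real.log (τ r) + (1 - α) * Real.log r) :=
        h3.trans (mul_le_mul_of_nonneg_right h5 h7)
    _ ≤ 2 * c * (Real.log C + N * Real.log (τ r) + δ / (4 * c) * Real.log r) := by gcongr
    _ = 2 * c * Real.log C + 2 * c * N * Real.log (τ r) + δ / 2 * Real.log r := by
        field_simp
        ring
    _ ≤ _ := by linarith

/-- The lemma on the logarithmic derivative for quotients of functions dominated by `F`. -/
theorem DominatedBy.isSmallErrorTerm {n : ℕ} {F : ℂ → Fin (n + 1) → ℂ}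
    (hF : Differentiable ℂ F) (hF0 : ∀ z, F z ≠ 0) {d : ℕ} {h₁ h₂ : ℂ → ℂ}
    (hh₁ : DominatedBy F d h₁) (hh₂ : DominatedBy F d h₂) (j : ℕ) :
    IsSmallErrorTerm (fun r => max (orderFunction F r) 1) fun r => Real.circleAverage
      (fun z => Real.log (1 + ‖iteratedDeriv j (logDeriv fun w => h₁ w / h₂ w) z‖)) 0 r := by
  set τ : ℝ → ℝ := fun r => max (orderFunction F r) 1 with hτ
  set u : ℂ → ℂ := fun w => h₁ w / h₂ w with hu
  have hτ1 : ∀ r, 1 ≤ τ r := fun r => le_max_right _ _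
  have hmono : ∀ r s, 1 ≤ r → r ≤ s → τ r ≤ τ s := fun r s h1 h2 =>
    max_le_max_right _ (orderFunction_le_of_le hF hF0 (by linarith) h2)
  obtain ⟨K, hK, hA, hS⟩ := hh₁.exists_bound_div hF hF0 hh₂
  obtain ⟨E, hE, hEτ⟩ := exists_measure_lt_top_forall_growth_le hτ1 hmono
  have hum : Meromorphic u := fun z => (hh₁.differentiable.analyticAt z).meromorphicAt.fun_div
    (hh₂.differentiable.analyticAt z).meromorphicAt
  have hord : ∀ z, meromorphicOrderAt u z ≠ ⊤ := meromorphicOrderAt_div_ne_top hh₁.differentiable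
    hh₂.differentiable hh₁.exists_ne_zero hh₂.exists_ne_zero
  set Z := zeroRadii h₁ ∪ zeroRadii h₂ with hZ
  have hZc : Z.Countable := (countable_zeroRadii hh₁.differentiable hh₁.exists_ne_zero).union
    (countable_zeroRadii hh₂.differentiable hh₂.exists_ne_zero)
  have hZ1 : ∀ r, r ∉ Z → RegularOn h₁ (sphere 0 r) := fun r hr =>
    regularOn_sphere_of_notMem_zeroRadii hh₁.differentiable fun h => hr (Or.inl h)
  have hZ2 : ∀ r, r ∉ Z → RegularOn h₂ (sphere 0 r) := fun r hr =>
    regularOn_sphere_of_notMem_zeroRadii hh₂.differentiable fun h => hr (Or.inr h)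
  -- The exponent j + 2: (R - r)^(-(j+1)) costs τ^(j+1) and the average of |log |u|| one further
  -- power; the count of zeros and poles costs only τ².
  refine IsSmallErrorTerm.of_forall_log_le hτ1 (c := j + 1) (N := j + 2) (by positivity)
    (by positivity) fun α hα1 hα2 => ?_
  obtain ⟨C, hC, hmain⟩ := exists_circleAverage_log_iteratedDeriv_logDeriv_le j
    (α := α) (by linarith) hα2
  refine ⟨2 + C * K * 12 + C * K * (2 * 3 ^ (j + 1)), by
    have : 0 ≤ C * K * 12 + C * K * (2 * 3 ^ (j + 1)) := by positivity
    linarith, E ∪ Z, measure_union_lt_top hE (by rw [hZc.measure_zero]; simp),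
    fun r hr hrE => ?_⟩
  have hrE' : r ∉ E := fun h => hrE (Or.inl h)
  have hrZ : r ∉ Z := fun h => hrE (Or.inr h)
  have hr0 : 0 < r := by linarith
  have hτr := hτ1 r
  have hτ0 : 0 < τ r := by linarith
  have hinv : 0 < (τ r)⁻¹ := by positivity
  have hinv1 : (τ r)⁻¹ ≤ 1 := inv_le_one_of_one_le₀ hτr
  -- R lies in the middle third of the interval from r to r + 1/τ(r), so both R - r and R' - R are
  -- at least 1/(3τ), and the circle of radius R can be chosen free of zeros.
  obtain ⟨R, ⟨hR1, hR2⟩, hRZ⟩ := exists_mem_Ioo_notMem_of_countable hZc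
    (a := r + (τ r)⁻¹ / 3) (b := r + 2 * (τ r)⁻¹ / 3) (by linarith)
  set R' := r + (τ r)⁻¹ with hR'
  have hrR : r < R := by linarith
  have hRR' : R < R' := by linarith
  have hτR' : τ R' ≤ 2 * τ r := hEτ r hr hrE'
  have hτR : τ R ≤ 2 * τ r := (hmono R R' (by linarith) hRR'.le).trans hτR'
  refine (hmain u r R hum hr0 hrR hord ((hZ1 r hrZ).fun_div (hZ2 r hrZ))
    ((hZ1 R hRZ).fun_div (hZ2 R hRZ))).trans ?_
  have hW := hA R (by linarith) (hZ1 R hRZ) (hZ2 R hRZ)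
  set s := (hum.meromorphicOn (s := closedBall 0 R)).divisor_ball_support_finite.toFinset with hs
  have hsR : ∀ a ∈ s, a ∈ ball (0 : ℂ) R := by
    intro a ha
    have ha' : MeromorphicOn.divisor u (ball 0 R) a ≠ 0 := by simpa [hs] using ha
    exact (MeromorphicOn.divisor u (ball 0 R)).supportWithinDomain (by simpa using ha')
  have hN := hS R R' (by linarith) hRR' s fun a ha => by simpa using hsR a ha
  have hDs : ∑ a ∈ s, |(MeromorphicOn.divisor u (ball 0 R) a : ℝ)| =
      ∑ a ∈ s, |((meromorphicOrderAt u a).untop₀ : ℝ)| := Finset.sum_congr rfl fun a ha => by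
    rw [MeromorphicOn.divisor_apply hum.meromorphicOn (hsR a ha)]
  -- The factor r here, against r^(-α) from the averages, leaves r^(1-α), which is negligible as α
  -- tends to 1.
  have hfrac : R' / (R' - R) ≤ 6 * r * τ r := by
    rw [div_le_iff₀ (by linarith)]
    have h1 : (τ r)⁻¹ / 3 ≤ R' - R := by linarith
    have h2 : 2 * r = 6 * r * τ r * ((τ r)⁻¹ / 3) := by field_simp; norm_num
    calc R' ≤ 2 * r := by linarith
      _ = 6 * r * τ r * ((τ r)⁻¹ / 3) := h2
      _ ≤ _ := by gcongr
  have hsum : ∑ a ∈ s, |(MeromorphicOn.divisor u (ball 0 R) a : ℝ)| ≤ K * 12 * τ r ^ 2 * r := by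
    rw [hDs]
    refine hN.trans ?_
    calc K * τ R' * (R' / (R' - R)) ≤ K * (2 * τ r) * (6 * r * τ r) := by
          have : 0 ≤ R' / (R' - R) := div_nonneg (by linarith) (by linarith)
          gcongr
      _ = _ := by ring
  have hpow : ((R - r) ^ (j + 1))⁻¹ ≤ 3 ^ (j + 1) * τ r ^ (j + 1) := by
    rw [← mul_pow, ← inv_pow]
    refine pow_le_pow_left₀ (by rw [inv_nonneg]; linarith) ?_ _
    rw [inv_le_comm₀ (by linarith) (by positivity), mul_inv]
    linarith
  have hW2 : Real.circleAverage (fun z => |Real.log ‖u z‖|) 0 R ≤ K * (2 * τ r) :=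
    hW.trans (by gcongr)
  have hW0 : 0 ≤ Real.circleAverage (fun z => |Real.log ‖u z‖|) 0 R :=
    Real.circleAverage_nonneg_of_nonneg fun z _ => abs_nonneg _
  have hrα : 1 ≤ r ^ (1 - α) := Real.one_le_rpow hr (by linarith)
  have hrr : r * r ^ (-α) = r ^ (1 - α) := by
    rw [sub_eq_add_neg, Real.rpow_add hr0, Real.rpow_one]
  have hτN : τ r ^ ((j : ℝ) + 2) = τ r ^ (j + 2) := by
    rw [← Real.rpow_natCast]; norm_num
  have hT1 : 1 ≤ τ r ^ (j + 2) := one_le_pow₀ hτr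
  have hT2 : τ r ^ 2 ≤ τ r ^ (j + 2) := pow_le_pow_right₀ hτr (by omega)
  refine mul_le_mul_of_nonneg_left (Real.log_le_log ?_ ?_) (by positivity)
  · have : 0 ≤ ∑ a ∈ s, |(MeromorphicOn.divisor u (ball 0 R) a : ℝ)| :=
      Finset.sum_nonneg fun _ _ => abs_nonneg _
    have : 0 < R - r := by linarith
    positivity
  · rw [hτN]
    have e1 : C * (∑ a ∈ s, |(MeromorphicOn.divisor u (ball 0 R) a : ℝ)|) * r ^ (-α) ≤
        C * K * 12 * τ r ^ (j + 2) * r ^ (1 - α) := by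
      calc _ ≤ C * (K * 12 * τ r ^ 2 * r) * r ^ (-α) := by gcongr
        _ = C * K * 12 * τ r ^ 2 * (r * r ^ (-α)) := by ring
        _ ≤ _ := by rw [hrr]; gcongr
    have e2 : C * ((R - r) ^ (j + 1))⁻¹ * Real.circleAverage (fun z => |Real.log ‖u z‖|) 0 R ≤
        C * K * (2 * 3 ^ (j + 1)) * τ r ^ (j + 2) * r ^ (1 - α) := by
      calc _ ≤ C * (3 ^ (j + 1) * τ r ^ (j + 1)) * (K * (2 * τ r)) := by gcongr
        _ = C * K * (2 * 3 ^ (j + 1)) * τ r ^ (j + 2) * 1 := by ring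
        _ ≤ _ := by gcongr
    have e3 : (2 : ℝ) ≤ 2 * τ r ^ (j + 2) * r ^ (1 - α) := by
      nlinarith [mul_nonneg (sub_nonneg.2 hT1) (sub_nonneg.2 hrα)]
    linarith

/-! ### Reduced representations and local forms of jet differentials. -/

theorem MvPolynomial.IsHomogeneous.eval_smul_eq {σ : Type*} [Fintype σ] {Q : MvPolynomial σ ℂ}
    {d : ℕ} (hQ : Q.IsHomogeneous d) (c : ℂ) (v : σ → ℂ) :
    MvPolynomial.eval (c • v) Q = c ^ d * MvPolynomial.eval v Q := by
  rw [MvPolynomial.eval_eq', MvPolynomial.eval_eq', Finset.mul_sum]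
  refine Finset.sum_congr rfl fun α hα => ?_
  have h1 := hQ (MvPolynomial.mem_support_iff.1 hα)
  rw [Finsupp.weight_apply, Finsupp.sum_fintype _ _ (by simp)] at h1
  simp only [Pi.one_apply, smul_eq_mul, mul_one] at h1
  simp only [Pi.smul_apply, smul_eq_mul, mul_pow, Finset.prod_mul_distrib, Finset.prod_pow_eq_pow_sum,
    h1]
  ring

theorem mk_mem_hypersurface_iff {n d : ℕ} {Q : MvPolynomial (Fin (n + 1)) ℂ}
    (hQ : Q.IsHomogeneous d) {v : Fin (n + 1) → ℂ} (hv : v ≠ 0) :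
    Projectivization.mk ℂ v hv ∈ hypersurface Q ↔ MvPolynomial.eval v Q = 0 := by
  refine ⟨fun h => h v hv rfl, fun h w hw hwv => ?_⟩
  obtain ⟨c, rfl⟩ := (Projectivization.mk_eq_mk_iff' ℂ _ _ hw hv).1 hwv
  rw [hQ.eval_smul_eq, h, mul_zero]

theorem onCone_of_ne_zero {n : ℕ} {E : Type*} [Zero E] (φ : Pn n → E) {v : Fin (n + 1) → ℂ}
    (hv : v ≠ 0) : onCone φ v = φ (Projectivization.mk ℂ v hv) := by
  rw [onCone, dif_pos hv]

theorem IsReducedRepresentation.ne_zero {n : ℕ} {F : ℂ → Fin (n + 1) → ℂ} {f : ℂ → Pn n}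
    (hF : IsReducedRepresentation F f) (z : ℂ) : F z ≠ 0 := (hF.2 z).1

theorem IsReducedRepresentation.onCone_eq {n : ℕ} {F : ℂ → Fin (n + 1) → ℂ} {f : ℂ → Pn n}
    (hF : IsReducedRepresentation F f) {E : Type*} [Zero E] (φ : Pn n → E) (z : ℂ) :
    onCone φ (F z) = φ (f z) := by
  rw [onCone_of_ne_zero φ (hF.ne_zero z), (hF.2 z).2]

theorem IsReducedRepresentation.mem_cone_iff {n : ℕ} {F : ℂ → Fin (n + 1) → ℂ} {f : ℂ → Pn n}
    (hF : IsReducedRepresentation F f) {U : Set (Pn n)} {z : ℂ} : F z ∈ cone U ↔ f z ∈ U := by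
  refine ⟨fun ⟨_, h⟩ => by rwa [(hF.2 z).2] at h, fun h => ⟨hF.ne_zero z, by rwa [(hF.2 z).2]⟩⟩

theorem IsReducedRepresentation.mem_hypersurface_iff {n d : ℕ} {F : ℂ → Fin (n + 1) → ℂ}
    {f : ℂ → Pn n} (hF : IsReducedRepresentation F f) {Q : MvPolynomial (Fin (n + 1)) ℂ}
    (hQ : Q.IsHomogeneous d) {z : ℂ} : f z ∈ hypersurface Q ↔ MvPolynomial.eval (F z) Q = 0 := by
  rw [← mk_mem_hypersurface_iff hQ (hF.ne_zero z), (hF.2 z).2]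

/-- The logarithmic jet-coordinates at `z` of a curve. -/
noncomputable def LogChart.jetAlong {n : ℕ} {Q : MvPolynomial (Fin (n + 1)) ℂ} (c : LogChart Q)
    (k : ℕ) (f : ℂ → Pn n) (z : ℂ) (p : Fin k × Fin n) : ℂ :=
  if p.2 ∈ c.logIndex then
    iteratedDeriv (p.1 : ℕ) (logDeriv fun w => c.coord (f w) p.2) z
  else
    iteratedDeriv ((p.1 : ℕ) + 1) (fun w => c.coord (f w) p.2) z

theorem LogChart.jetCoord_translate {n : ℕ} {Q : MvPolynomial (Fin (n + 1)) ℂ} (c : LogChart Q)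
    (k : ℕ) {f : ℂ → Pn n} {z : ℂ} (h : HolomorphicCurveAt (fun t => f (z + t)) 0) :
    c.jetCoord k ⟨fun t => f (z + t), h⟩ = c.jetAlong k f z := by
  funext p
  have h1 : (logDeriv fun t => c.coord (f (z + t)) p.2) =
      fun t => logDeriv (fun w => c.coord (f w) p.2) (z + t) := by
    funext t
    rw [logDeriv_apply, logDeriv_apply,
      deriv_comp_const_add (f := fun w => c.coord (f w) p.2)]
  simp only [LogChart.jetCoord, LogChart.jetAlong, h1]
  rw [iteratedDeriv_comp_const_add (f := logDeriv fun w => c.coord (f w) p.2),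
    iteratedDeriv_comp_const_add (f := fun w => c.coord (f w) p.2)]
  simp only [add_zero]

/-- The conditions on the coefficients of a local expression of a logarithmic jet differential. -/
structure IsLocalForm {n : ℕ} {Q : MvPolynomial (Fin (n + 1)) ℂ} {k m μ : ℕ}
    (P : LogJetDifferential Q k m μ) (c : LogChart Q)
    (A : (Fin (n + 1) → ℂ) → MvPolynomial (Fin k × Fin n) ℂ) : Prop where
  weighted : ∀ v ∈ cone c.source,
    (A v).IsWeightedHomogeneous (fun p : Fin k × Fin n => (p.1 : ℕ) + 1) m
  holomorphic : ∀ α : (Fin k × Fin n) →₀ ℕ,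
    DifferentiableOn ℂ (fun v => (A v).coeff α) (cone c.source)
  smul_eq : ∀ v ∈ cone c.source, ∀ a : ℂ, a ≠ 0 → A (a • v) = (a ^ μ)⁻¹ • A v
  toFun_eq : ∀ g : CurveGerm n, g.1 0 ∈ c.source → g.1 0 ∉ hypersurface Q →
    ∀ (v : Fin (n + 1) → ℂ) (h : v ≠ 0), Projectivization.mk ℂ v h = g.1 0 →
      P.toFun (g.jet k) v = MvPolynomial.eval (c.jetCoord k g) (A v)

theorem LogJetDifferential.exists_isLocalForm {n : ℕ} {Q : MvPolynomial (Fin (n + 1)) ℂ}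
    {k m μ : ℕ} (P : LogJetDifferential Q k m μ) (x : Pn n) :
    ∃ (c : LogChart Q) (A : _), x ∈ c.source ∧ IsLocalForm P c A := by
  obtain ⟨c, hx, A, h1, h2, h3, h4⟩ := P.local_form x
  exact ⟨c, A, hx, h1, h2, h3, h4⟩

theorem IsLocalForm.toFun_curveJet {n : ℕ} {Q : MvPolynomial (Fin (n + 1)) ℂ} {k m μ : ℕ}
    {P : LogJetDifferential Q k m μ} {c : LogChart Q}
    {A : (Fin (n + 1) → ℂ) → MvPolynomial (Fin k × Fin n) ℂ} (hA : IsLocalForm P c A)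
    {f : ℂ → Pn n} (hf : IsEntireCurve f) {F : ℂ → Fin (n + 1) → ℂ}
    (hF : IsReducedRepresentation F f) {z : ℂ} (hz : f z ∈ c.source)
    (hzD : f z ∉ hypersurface Q) :
    P.toFun (curveJet k f hf z) (F z) = MvPolynomial.eval (c.jetAlong k f z) (A (F z)) := by
  have h := hA.toFun_eq ⟨fun t => f (z + t), (hf z).translate⟩ (by simpa using hz)
    (by simpa using hzD) (F z) (hF.ne_zero z) (by simpa using (hF.2 z).2)
  rw [c.jetCoord_translate] at h
  exact h

/-- The exponents of weighted degree `m`, where the variables of index `(j, i)` have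
weight `j + 1`. -/
noncomputable def jetExponents (k n m : ℕ) : Finset ((Fin k × Fin n) →₀ ℕ) :=
  (Finset.Iic (Finsupp.equivFunOnFinite.symm fun _ => m)).filter
    fun α => ∑ p, α p * ((p.1 : ℕ) + 1) = m

theorem mem_jetExponents {k n m : ℕ} {α : (Fin k × Fin n) →₀ ℕ} :
    α ∈ jetExponents k n m ↔ ∑ p, α p * ((p.1 : ℕ) + 1) = m := by
  rw [jetExponents, Finset.mem_filter, and_iff_right_iff_imp, Finset.mem_Iic]
  intro h p
  simp only [Finsupp.equivFunOnFinite_symm_apply_apply]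
  rw [← h]
  have := Finset.single_le_sum (f := fun p : Fin k × Fin n => α p * ((p.1 : ℕ) + 1))
    (fun _ _ => Nat.zero_le _) (Finset.mem_univ p)
  exact le_trans (Nat.le_mul_of_pos_right _ (Nat.succ_pos _)) this

theorem eval_eq_sum_jetExponents {k n m : ℕ} {A : MvPolynomial (Fin k × Fin n) ℂ}
    (hA : A.IsWeightedHomogeneous (fun p : Fin k × Fin n => (p.1 : ℕ) + 1) m)
    (y : Fin k × Fin n → ℂ) :
    MvPolynomial.eval y A = ∑ α ∈ jetExponents k n m, A.coeff α * ∏ p, y p ^ α p := by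
  rw [MvPolynomial.eval_eq']
  refine Finset.sum_subset (fun α hα => ?_) fun α _ hα => ?_
  · rw [mem_jetExponents, ← hA (MvPolynomial.mem_support_iff.1 hα), Finsupp.weight_apply,
      Finsupp.sum_fintype _ _ (by simp)]
    simp
  · rw [MvPolynomial.notMem_support_iff.1 hα, zero_mul]

/-! Lower bounds for the order of meromorphic germs. -/

/-- `u` has at `a` a pole of order at most `p`. -/
def PoleOrderLE (u : ℂ → ℂ) (a : ℂ) (p : ℕ) : Prop :=
  MeromorphicAt u a ∧ ((-(p : ℤ) : ℤ) : WithTop ℤ) ≤ meromorphicOrderAt u a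

theorem AnalyticAt.poleOrderLE {u : ℂ → ℂ} {a : ℂ} (h : AnalyticAt ℂ u a) (p : ℕ) :
    PoleOrderLE u a p :=
  ⟨h.meromorphicAt, le_trans (by exact_mod_cast (by omega : (-(p : ℤ)) ≤ 0))
    h.meromorphicOrderAt_nonneg⟩

theorem PoleOrderLE.congr {u v : ℂ → ℂ} {a : ℂ} {p : ℕ} (h : PoleOrderLE u a p)
    (huv : u =ᶠ[𝓝[≠] a] v) : PoleOrderLE v a p :=
  ⟨h.1.congr huv, by rw [← meromorphicOrderAt_congr huv]; exact h.2⟩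

theorem PoleOrderLE.mul {u v : ℂ → ℂ} {a : ℂ} {p p' : ℕ} (hu : PoleOrderLE u a p)
    (hv : PoleOrderLE v a p') : PoleOrderLE (fun z => u z * v z) a (p + p') := by
  refine ⟨hu.1.fun_mul hv.1, ?_⟩
  rw [fun_meromorphicOrderAt_mul hu.1 hv.1]
  refine le_trans (le_of_eq ?_) (add_le_add hu.2 hv.2)
  rw [← WithTop.coe_add]
  congr 1
  push_cast
  ring

theorem PoleOrderLE.pow {u : ℂ → ℂ} {a : ℂ} {p : ℕ} (hu : PoleOrderLE u a p) (N : ℕ) :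
    PoleOrderLE (fun z => u z ^ N) a (N * p) := by
  induction N with
  | zero => simpa using (analyticAt_const (v := (1 : ℂ))).poleOrderLE (u := fun _ => (1 : ℂ)) 0
  | succ N ih =>
    simp only [pow_succ]
    rw [add_mul, one_mul]
    exact ih.mul hu

theorem PoleOrderLE.prod {ι : Type*} (s : Finset ι) {u : ι → ℂ → ℂ} {a : ℂ} {p : ι → ℕ}
    (hu : ∀ i ∈ s, PoleOrderLE (u i) a (p i)) :
    PoleOrderLE (fun z => ∏ i ∈ s, u i z) a (∑ i ∈ s, p i) := by
  classical
  induction s using Finset.induction_on with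
  | empty => simpa using (analyticAt_const (v := (1 : ℂ))).poleOrderLE (u := fun _ => (1 : ℂ)) 0
  | insert i s hi ih =>
    simp only [Finset.prod_insert hi, Finset.sum_insert hi]
    exact (hu i (Finset.mem_insert_self _ _)).mul
      (ih fun j hj => hu j (Finset.mem_insert_of_mem hj))

theorem PoleOrderLE.add {u v : ℂ → ℂ} {a : ℂ} {p : ℕ} (hu : PoleOrderLE u a p)
    (hv : PoleOrderLE v a p) : PoleOrderLE (fun z => u z + v z) a p :=
  ⟨hu.1.fun_add hv.1, (le_min hu.2 hv.2).trans (meromorphicOrderAt_add hu.1 hv.1)⟩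

theorem PoleOrderLE.sum {ι : Type*} (s : Finset ι) {u : ι → ℂ → ℂ} {a : ℂ} {p : ℕ}
    (hu : ∀ i ∈ s, PoleOrderLE (u i) a p) : PoleOrderLE (fun z => ∑ i ∈ s, u i z) a p := by
  classical
  induction s using Finset.induction_on with
  | empty => simpa using (analyticAt_const (v := (0 : ℂ))).poleOrderLE (u := fun _ => (0 : ℂ)) p
  | insert i s hi ih =>
    simp only [Finset.sum_insert hi]
    exact (hu i (Finset.mem_insert_self _ _)).add
      (ih fun j hj => hu j (Finset.mem_insert_of_mem hj))

/-- Without a genuine pole, u agrees near a with an analytic function away from a, and so do the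
derivatives. A negative order drops by exactly one. -/
theorem PoleOrderLE.deriv {u : ℂ → ℂ} {a : ℂ} {p : ℕ} (hu : PoleOrderLE u a p) :
    PoleOrderLE (deriv u) a (p + 1) := by
  rcases le_or_gt 0 (meromorphicOrderAt u a) with h0 | h0
  · obtain ⟨g, hg, hug⟩ := hu.1.meromorphicOrderAt_nonneg_iff.1 h0
    exact (hg.deriv.poleOrderLE _).congr hug.symm.nhdsNE_deriv
  · refine ⟨hu.1.deriv, ?_⟩
    obtain ⟨q, hq⟩ := WithTop.ne_top_iff_exists.1 (h0.trans (WithTop.coe_lt_top 0)).ne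
    have h1 := hu.2
    rw [← hq] at h0 h1
    have h0' : q < 0 := by exact_mod_cast h0
    have h1' : -(p : ℤ) ≤ q := by exact_mod_cast h1
    rw [meromorphicOrderAt_deriv_eq_sub_one (n := q) (by exact_mod_cast h0'.ne) hq.symm]
    exact_mod_cast (by omega : -((p + 1 : ℕ) : ℤ) ≤ q - 1)

theorem PoleOrderLE.iteratedDeriv {u : ℂ → ℂ} {a : ℂ} {p : ℕ} (hu : PoleOrderLE u a p) (j : ℕ) :
    PoleOrderLE (iteratedDeriv j u) a (p + j) := by
  induction j with
  | zero => simpa using hu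
  | succ j ih =>
    rw [iteratedDeriv_succ]
    exact ih.deriv

/-- The pole is at most simple whatever the multiplicity of the zero or pole of u: this is the
source of truncation at level 1. -/
theorem poleOrderLE_logDeriv {u : ℂ → ℂ} {a : ℂ} (hu : MeromorphicAt u a) :
    PoleOrderLE (logDeriv u) a 1 := by
  refine ⟨hu.deriv.div hu, ?_⟩
  by_cases h0 : meromorphicOrderAt u a = 0
  · refine le_trans ?_ (meromorphicOrderAt_logDeriv_nonneg hu h0)
    exact_mod_cast (by norm_num : -((1 : ℕ) : ℤ) ≤ 0)
  by_cases ht : meromorphicOrderAt u a = ⊤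
  · have h1 : u =ᶠ[𝓝[≠] a] fun _ => 0 := meromorphicOrderAt_eq_top_iff.1 ht
    rw [meromorphicOrderAt_congr (logDeriv_congr_nhdsNE h1)]
    have : logDeriv (fun _ : ℂ => (0 : ℂ)) = fun _ => 0 := by
      funext z; simp [logDeriv_apply]
    rw [this, meromorphicOrderAt_eq_top_iff.2 (by simp)]
    exact le_top
  · rw [meromorphicOrderAt_logDeriv_eq_neg_one hu h0 ht]
    norm_num

/-! ### Poles of a jet differential along the curve. -/

theorem analyticAt_comp_of_differentiableOn {E : Type*} [NormedAddCommGroup E] [NormedSpace ℂ E]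
    [CompleteSpace E] {G : ℂ → E} {a : ℂ} (hG : AnalyticAt ℂ G a) {H : E → ℂ} {W : Set E}
    (hW : IsOpen W) (hH : DifferentiableOn ℂ H W) (ha : G a ∈ W) :
    AnalyticAt ℂ (fun z => H (G z)) a := by
  rw [Complex.analyticAt_iff_eventually_differentiableAt]
  filter_upwards [hG.eventually_analyticAt,
    hG.continuousAt.preimage_mem_nhds (hW.mem_nhds ha)] with z hz hzW
  exact (hH.differentiableAt (hW.mem_nhds hzW)).comp z hz.differentiableAt

theorem LogChart.analyticAt_coord {n : ℕ} {Q : MvPolynomial (Fin (n + 1)) ℂ} (c : LogChart Q)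
    {F : ℂ → Fin (n + 1) → ℂ} {f : ℂ → Pn n} (hF : IsReducedRepresentation F f) {a : ℂ}
    (ha : f a ∈ c.source) (i : Fin n) : AnalyticAt ℂ (fun w => c.coord (f w) i) a := by
  have h1 : DifferentiableOn ℂ (fun v => onCone c.coord v i) (cone c.source) :=
    differentiableOn_pi.1 c.holomorphic i
  have h2 := analyticAt_comp_of_differentiableOn (hF.1.analyticAt _) c.isOpen_source h1 (hF.mem_cone_iff.2 ha)
  simpa only [hF.onCone_eq] using h2

theorem LogChart.coord_ne_zero {n : ℕ} {Q : MvPolynomial (Fin (n + 1)) ℂ} (c : LogChart Q)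
    {x : Pn n} (hx : x ∈ c.source) (hD : x ∉ hypersurface Q) {i : Fin n} (hi : i ∈ c.logIndex) :
    c.coord x i ≠ 0 := fun h => hD ((c.mem_hypersurface_iff x hx).2 ⟨i, hi, h⟩)

theorem LogChart.analyticAt_jetAlong {n : ℕ} {Q : MvPolynomial (Fin (n + 1)) ℂ} (c : LogChart Q)
    {k : ℕ} {F : ℂ → Fin (n + 1) → ℂ} {f : ℂ → Pn n} (hF : IsReducedRepresentation F f) {a : ℂ}
    (ha : f a ∈ c.source) (hD : f a ∉ hypersurface Q) (p : Fin k × Fin n) :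
    AnalyticAt ℂ (fun z => c.jetAlong k f z p) a := by
  have h1 := c.analyticAt_coord hF ha p.2
  by_cases hp : p.2 ∈ c.logIndex
  · simp only [LogChart.jetAlong, hp, if_true]
    exact (h1.logDeriv_of_ne_zero (c.coord_ne_zero ha hD hp)).iteratedDeriv_complex _
  · simp only [LogChart.jetAlong, hp, if_false]
    exact h1.iteratedDeriv_complex _

/-- The pole order is bounded by the weight of the coordinate, even when the base point lies on D:
one for the logarithmic derivative and one for each further derivative. -/
theorem LogChart.poleOrderLE_jetAlong {n : ℕ} {Q : MvPolynomial (Fin (n + 1)) ℂ} (c : LogChart Q)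
    {k : ℕ} {F : ℂ → Fin (n + 1) → ℂ} {f : ℂ → Pn n} (hF : IsReducedRepresentation F f) {a : ℂ}
    (ha : f a ∈ c.source) (p : Fin k × Fin n) :
    PoleOrderLE (fun z => c.jetAlong k f z p) a ((p.1 : ℕ) + 1) := by
  have h1 := c.analyticAt_coord hF ha p.2
  by_cases hp : p.2 ∈ c.logIndex
  · simp only [LogChart.jetAlong, hp, if_true]
    rw [add_comm]
    exact (poleOrderLE_logDeriv h1.meromorphicAt).iteratedDeriv _
  · simp only [LogChart.jetAlong, hp, if_false]
    exact (h1.iteratedDeriv_complex _).poleOrderLE _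

section CurveJet

variable {n d k m μ : ℕ} {Q : MvPolynomial (Fin (n + 1)) ℂ} {P : LogJetDifferential Q k m μ}
  {c : LogChart Q} {A : (Fin (n + 1) → ℂ) → MvPolynomial (Fin k × Fin n) ℂ}
  {F : ℂ → Fin (n + 1) → ℂ} {f : ℂ → Pn n}

theorem IsReducedRepresentation.eventually_mem_source (hF : IsReducedRepresentation F f) {a : ℂ}
    (c : LogChart Q) (ha : f a ∈ c.source) : ∀ᶠ z in 𝓝 a, f z ∈ c.source := by
  filter_upwards [hF.1.continuous.continuousAt.preimage_mem_nhds
    (c.isOpen_source.mem_nhds (hF.mem_cone_iff.2 ha))] with z hz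
  exact hF.mem_cone_iff.1 hz

theorem differentiable_eval (hF : Differentiable ℂ F) (Q : MvPolynomial (Fin (n + 1)) ℂ) :
    Differentiable ℂ fun z => MvPolynomial.eval (F z) Q := by
  simp only [MvPolynomial.eval_eq']
  have : ∀ i, Differentiable ℂ fun z => F z i := fun i => differentiable_pi.1 hF i
  fun_prop

theorem IsLocalForm.toFun_curveJet_eq_sum (hA : IsLocalForm P c A) (hf : IsEntireCurve f)
    (hF : IsReducedRepresentation F f) {z : ℂ} (hz : f z ∈ c.source)
    (hzD : f z ∉ hypersurface Q) :
    P.toFun (curveJet k f hf z) (F z) = ∑ α ∈ jetExponents k n m,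
      (A (F z)).coeff α * ∏ p, c.jetAlong k f z p ^ α p := by
  rw [hA.toFun_curveJet hf hF hz hzD,
    eval_eq_sum_jetExponents (hA.weighted _ (hF.mem_cone_iff.2 hz))]

theorem LogJetDifferential.analyticAt_curveJet (P : LogJetDifferential Q k m μ)
    (hQ : Q.IsHomogeneous d) (hf : IsEntireCurve f) (hF : IsReducedRepresentation F f) {a : ℂ}
    (ha : MvPolynomial.eval (F a) Q ≠ 0) :
    AnalyticAt ℂ (fun z => P.toFun (curveJet k f hf z) (F z)) a := by
  obtain ⟨c, A, hac, hA⟩ := P.exists_isLocalForm (f a)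
  have hD : ∀ z, MvPolynomial.eval (F z) Q ≠ 0 → f z ∉ hypersurface Q := fun z hz h =>
    hz ((hF.mem_hypersurface_iff hQ).1 h)
  have h1 : AnalyticAt ℂ (fun z => ∑ α ∈ jetExponents k n m,
      (A (F z)).coeff α * ∏ p, c.jetAlong k f z p ^ α p) a := by
    refine Finset.analyticAt_fun_sum _ fun α _ => ?_
    refine (analyticAt_comp_of_differentiableOn (hF.1.analyticAt _) c.isOpen_source (hA.holomorphic α)
      (hF.mem_cone_iff.2 hac)).fun_mul (Finset.analyticAt_fun_prod _ fun p _ => ?_)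
    exact (c.analyticAt_jetAlong hF hac (hD a ha) p).fun_pow _
  refine h1.congr ?_
  filter_upwards [hF.eventually_mem_source c hac,
    ((differentiable_eval hF.1 Q).continuous.continuousAt (x := a)).eventually_ne ha] with z hz hqz
  exact (hA.toFun_curveJet_eq_sum hf hF hz (hD z hqz)).symm

/-- Each monomial has pole order at most the sum of the weights of its factors, which is m, and the
coefficients are holomorphic along the curve. The local formula is available only off D, so the
comparison is made on a punctured neighbourhood. -/
theorem LogJetDifferential.poleOrderLE_curveJet (P : LogJetDifferential Q k m μ)
    (hQ : Q.IsHomogeneous d) (hf : IsEntireCurve f) (hF : IsReducedRepresentation F f)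
    (hq : ∃ z, MvPolynomial.eval (F z) Q ≠ 0) (a : ℂ) :
    PoleOrderLE (fun z => P.toFun (curveJet k f hf z) (F z)) a m := by
  obtain ⟨c, A, hac, hA⟩ := P.exists_isLocalForm (f a)
  have h1 : PoleOrderLE (fun z => ∑ α ∈ jetExponents k n m,
      (A (F z)).coeff α * ∏ p, c.jetAlong k f z p ^ α p) a m := by
    refine PoleOrderLE.sum _ fun α hα => ?_
    have h2 := (analyticAt_comp_of_differentiableOn (hF.1.analyticAt _) c.isOpen_source (hA.holomorphic α)
      (hF.mem_cone_iff.2 hac)).poleOrderLE 0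
    have h3 := PoleOrderLE.prod Finset.univ
      fun p _ => (c.poleOrderLE_jetAlong (k := k) hF hac p).pow (α p)
    have h4 := h2.mul h3
    rwa [mem_jetExponents.1 hα, zero_add] at h4
  refine h1.congr ?_
  filter_upwards [(hF.eventually_mem_source c hac).filter_mono nhdsWithin_le_nhds,
    eventually_nhdsNE_ne_zero_of_entire (differentiable_eval hF.1 Q) hq a] with z hz hqz
  exact (hA.toFun_curveJet_eq_sum hf hF hz
    fun h => hqz ((hF.mem_hypersurface_iff hQ).1 h)).symm

end CurveJet

/-! The truncated counting function. -/

theorem intervalIntegrable_indicator_div (ρ : ℝ) {r : ℝ} (hr : 1 ≤ r) :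
    IntervalIntegrable (fun t : ℝ => (if ρ < t then (1 : ℝ) else 0) / t) volume 1 r := by
  have h1 : IntervalIntegrable (fun t : ℝ => t⁻¹) volume 1 r := by
    refine intervalIntegral.intervalIntegrable_inv (fun x hx => ?_) continuousOn_id
    rw [Set.uIcc_of_le hr] at hx
    exact (by linarith [hx.1] : (0 : ℝ) < x).ne'
  have hm : Measurable fun t : ℝ => (if ρ < t then (1 : ℝ) else 0) / t :=
    (Measurable.ite measurableSet_Ioi measurable_const measurable_const).div measurable_id
  refine h1.mono_fun hm.aestronglyMeasurable (Eventually.of_forall fun t => ?_)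
  by_cases h : ρ < t <;> simp [h]

theorem integral_indicator_div {ρ r : ℝ} (hr : 1 ≤ r) (hρ : ρ ≤ r) :
    ∫ t in (1 : ℝ)..r, (if ρ < t then (1 : ℝ) else 0) / t = Real.log (r / max 1 ρ) := by
  set M := max 1 ρ with hM
  have hM1 : 1 ≤ M := le_max_left _ _
  have hMr : M ≤ r := max_le hr hρ
  have hi := intervalIntegrable_indicator_div ρ hr
  rw [← intervalIntegral.integral_add_adjacent_intervals (b := M)
    (hi.mono_set (by rw [Set.uIcc_of_le hM1, Set.uIcc_of_le hr]; exact Set.Icc_subset_Icc_right hMr))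
    (hi.mono_set (by rw [Set.uIcc_of_le hMr, Set.uIcc_of_le hr]; exact Set.Icc_subset_Icc_left hM1))]
  have h1 : ∫ t in (1 : ℝ)..M, (if ρ < t then (1 : ℝ) else 0) / t = ∫ t in (1 : ℝ)..M, (0 : ℝ) := by
    refine intervalIntegral.integral_congr_Ioo_of_le hM1 fun t ht => ?_
    have : ¬ ρ < t := by
      rcases max_choice 1 ρ with h | h
      · rw [hM, h] at ht; exact absurd (ht.1.trans ht.2) (lt_irrefl _)
      · rw [hM, h] at ht; exact ht.2.not_gt
    simp [this]
  have h2 : ∫ t in M..r, (if ρ < t then (1 : ℝ) else 0) / t = ∫ t in M..r, t⁻¹ := by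
    refine intervalIntegral.integral_congr_Ioo_of_le hMr fun t ht => ?_
    have : ρ < t := (le_max_right 1 ρ).trans_lt ht.1
    simp [this]
  rw [h1, h2, intervalIntegral.integral_zero, zero_add,
    integral_inv_of_pos (by linarith) (by linarith)]

theorem finite_zeros_ball {h : ℂ → ℂ} (hd : Differentiable ℂ h) (h0 : ∃ z, h z ≠ 0) (r : ℝ) :
    {a : ℂ | ‖a‖ < r ∧ h a = 0}.Finite := by
  have hm : MeromorphicOn h (closedBall 0 r) := fun z _ => (hd.analyticAt z).meromorphicAt
  refine ((MeromorphicOn.divisor h (closedBall 0 r)).finiteSupport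
    (isCompact_closedBall 0 r)).subset fun a ha => ?_
  have hne : meromorphicOrderAt h a ≠ 0 := fun h1 =>
    (hd.analyticAt a).meromorphicNFAt.meromorphicOrderAt_eq_zero_iff.1 h1 ha.2
  simp only [Function.mem_support]
  rw [MeromorphicOn.divisor_apply hm (by simpa using ha.1.le)]
  intro h1
  rcases WithTop.untop₀_eq_zero.1 h1 with h2 | h2
  · exact hne h2
  · exact meromorphicOrderAt_ne_top_of_entire hd h0 a h2

theorem truncatedDegree_one_eq_sum {h : ℂ → ℂ} (hd : Differentiable ℂ h) (h0 : ∃ z, h z ≠ 0)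
    {t r : ℝ} (htr : t ≤ r) :
    (truncatedDegree 1 h t : ℝ) =
      ∑ a ∈ (finite_zeros_ball hd h0 r).toFinset, if ‖a‖ < t then (1 : ℝ) else 0 := by
  have hval : ∀ a, (min 1 (analyticOrderAt h a)).toNat = if h a = 0 then 1 else 0 := by
    intro a
    split_ifs with ha
    · have h1 : 1 ≤ analyticOrderAt h a := by
        rw [Order.one_le_iff_ne_zero]
        exact fun h1 => (hd.analyticAt a).analyticOrderAt_eq_zero.1 h1 ha
      rw [min_eq_left h1]; rfl
    · rw [(hd.analyticAt a).analyticOrderAt_eq_zero.2 ha]; simp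
  have h1 : truncatedDegree 1 h t =
      ∑ a ∈ (finite_zeros_ball hd h0 r).toFinset, if ‖a‖ < t then 1 else 0 := by
    rw [truncatedDegree, finsum_eq_sum_of_support_subset (s := (finite_zeros_ball hd h0 r).toFinset)]
    · refine Finset.sum_congr rfl fun a ha => ?_
      have ha' := ((Set.Finite.mem_toFinset _).1 ha).2
      simp only [finsum_eq_if, hval, ha', if_true, mem_ball_zero_iff]
    · intro a ha
      simp only [Function.mem_support, finsum_eq_if, hval, mem_ball_zero_iff] at ha
      simp only [Set.Finite.coe_toFinset, Set.mem_ofPred_eq]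
      by_cases h1 : ‖a‖ < t <;> by_cases h2 : h a = 0 <;> simp [h1, h2] at ha ⊢
      exact h1.trans_le htr
  rw [h1]
  push_cast
  rfl

/-- Exchanging the finite sum with the integral produces the same weights as in Jensen's formula, so
the two can be compared point by point. -/
theorem countingFunction_one_eq_sum {n : ℕ} {F : ℂ → Fin (n + 1) → ℂ} (hF : Differentiable ℂ F)
    {Q : MvPolynomial (Fin (n + 1)) ℂ} (hq : ∃ z, MvPolynomial.eval (F z) Q ≠ 0) {r : ℝ}
    (hr : 1 ≤ r) :
    countingFunction 1 F Q r = ∑ a ∈ (finite_zeros_ball (differentiable_eval hF Q) hq r).toFinset,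
      Real.log (r / max 1 ‖a‖) := by
  set s := (finite_zeros_ball (differentiable_eval hF Q) hq r).toFinset with hs
  have h1 : countingFunction 1 F Q r =
      ∫ t in (1 : ℝ)..r, ∑ a ∈ s, (if ‖a‖ < t then (1 : ℝ) else 0) / t := by
    refine intervalIntegral.integral_congr fun t ht => ?_
    rw [Set.uIcc_of_le hr] at ht
    rw [truncatedDegree_one_eq_sum (differentiable_eval hF Q) hq ht.2, Finset.sum_div]
  rw [h1, intervalIntegral.integral_finsetSum fun a _ => intervalIntegrable_indicator_div _ hr]
  refine Finset.sum_congr rfl fun a ha => integral_indicator_div hr ?_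
  exact ((Set.Finite.mem_toFinset _).1 ha).1.le

/-- In Jensen's formula the order is at least -m at zeros of Q ∘ F and nonnegative elsewhere. -/
theorem LogJetDifferential.circleAverage_log_norm_ge {n d k m μ : ℕ}
    {Q : MvPolynomial (Fin (n + 1)) ℂ} {F : ℂ → Fin (n + 1) → ℂ} {f : ℂ → Pn n}
    (P : LogJetDifferential Q k m μ) (hQ : Q.IsHomogeneous d) (hf : IsEntireCurve f)
    (hF : IsReducedRepresentation F f) (hq : ∃ z, MvPolynomial.eval (F z) Q ≠ 0) {r : ℝ}
    (hr : 1 ≤ r) :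
    Real.circleAverage (fun z => Real.log ‖P.toFun (curveJet k f hf z) (F z)‖) 0 1 -
        m * countingFunction 1 F Q r ≤
      Real.circleAverage (fun z => Real.log ‖P.toFun (curveJet k f hf z) (F z)‖) 0 r := by
  classical
  set u : ℂ → ℂ := fun z => P.toFun (curveJet k f hf z) (F z) with hu
  have hp : ∀ a, PoleOrderLE u a m := P.poleOrderLE_curveJet hQ hf hF hq
  have hum : Meromorphic u := fun a => (hp a).1
  have hJ := circleAverage_log_norm_sub_eq_sum hum hr
  set s := ((MeromorphicOn.divisor u (closedBall 0 r)).finiteSupport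
      (isCompact_closedBall 0 r)).toFinset with hs
  have hsr : ∀ a ∈ s, ‖a‖ ≤ r := by
    intro a ha
    have ha' : MeromorphicOn.divisor u (closedBall 0 r) a ≠ 0 := by simpa [hs] using ha
    simpa using (MeromorphicOn.divisor u (closedBall 0 r)).supportWithinDomain (by simpa using ha')
  rw [countingFunction_one_eq_sum hF.1 hq hr]
  set t := (finite_zeros_ball (differentiable_eval hF.1 Q) hq r).toFinset with ht
  have hL : ∀ a : ℂ, ‖a‖ ≤ r → 0 ≤ Real.log (r / max 1 ‖a‖) := fun a ha =>
    Real.log_nonneg ((one_le_div (by positivity)).2 (max_le hr ha))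
  have h1 : ∀ a ∈ s, -((if a ∈ t then (m : ℝ) else 0) * Real.log (r / max 1 ‖a‖)) ≤
      ((meromorphicOrderAt u a).untop₀ : ℝ) * Real.log (r / max 1 ‖a‖) := by
    intro a ha
    have hLa := hL a (hsr a ha)
    -- Points with |a| = r lie in the closed disc of Jensen's formula but not in the open disc of
    -- the counting function; their weight is log 1 = 0.
    rcases (hsr a ha).eq_or_lt with har | har
    · have : Real.log (r / max 1 ‖a‖) = 0 := by
        rw [har, max_eq_right hr, div_self (by linarith), Real.log_one]
      simp [this]
    · rw [← neg_mul]
      refine mul_le_mul_of_nonneg_right ?_ hLa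
      by_cases hqa : MvPolynomial.eval (F a) Q = 0
      · have hat : a ∈ t := (Set.Finite.mem_toFinset _).2 ⟨har, hqa⟩
        rw [if_pos hat]
        have h2 := (hp a).2
        rcases eq_or_ne (meromorphicOrderAt u a) ⊤ with h3 | h3
        · rw [h3]; simp
        · obtain ⟨e, he⟩ := WithTop.ne_top_iff_exists.1 h3
          rw [← he] at h2 ⊢
          have h4 : -(m : ℤ) ≤ e := by exact_mod_cast h2
          simp only [WithTop.untop₀_coe]
          exact_mod_cast h4
      · have hat : a ∉ t := fun h => hqa ((Set.Finite.mem_toFinset _).1 h).2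
        rw [if_neg hat]
        have h2 := (P.analyticAt_curveJet hQ hf hF hqa).meromorphicOrderAt_nonneg
        rw [neg_zero]
        exact_mod_cast WithTop.untop₀_nonneg.2 h2
  have h2 : ∑ a ∈ s, (if a ∈ t then (m : ℝ) else 0) * Real.log (r / max 1 ‖a‖) ≤
      m * ∑ a ∈ t, Real.log (r / max 1 ‖a‖) := by
    simp only [ite_mul, zero_mul]
    rw [← Finset.sum_filter, Finset.mul_sum]
    refine Finset.sum_le_sum_of_subset_of_nonneg (fun a ha => (Finset.mem_filter.1 ha).2)
      fun a ha _ => mul_nonneg (by positivity) (hL a ?_)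
    exact ((Set.Finite.mem_toFinset _).1 ha).1.le
  have h3 := Finset.sum_le_sum h1
  rw [Finset.sum_neg_distrib] at h3
  linarith

/-! ### Bounds along normalized representations. -/

theorem hasDerivAt_eval_add_smul_single {n : ℕ} (Q : MvPolynomial (Fin n) ℂ) (v : Fin n → ℂ)
    (i : Fin n) : HasDerivAt (fun t : ℂ => MvPolynomial.eval (v + t • Pi.single i 1) Q)
      (MvPolynomial.eval v (MvPolynomial.pderiv i Q)) 0 := by
  induction Q using MvPolynomial.induction_on with
  | C a => simpa using hasDerivAt_const (0 : ℂ) a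
  | add p q hp hq => simpa using hp.fun_add hq
  | mul_X p j hp =>
    have h1 : HasDerivAt (fun t : ℂ => v j + t * (Pi.single i (1 : ℂ) : Fin n → ℂ) j)
        ((Pi.single i (1 : ℂ) : Fin n → ℂ) j) 0 := by
      simpa using ((hasDerivAt_id (0 : ℂ)).mul_const
        ((Pi.single i (1 : ℂ) : Fin n → ℂ) j)).const_add (v j)
    have h2 := hp.fun_mul h1
    simp only [zero_smul, add_zero, zero_mul] at h2
    simp only [map_mul, MvPolynomial.eval_X, Pi.add_apply, Pi.smul_apply, smul_eq_mul]
    refine h2.congr_deriv ?_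
    rw [Derivation.leibniz, MvPolynomial.pderiv_X]
    simp only [smul_eq_mul, map_add, map_mul, MvPolynomial.eval_X]
    have h3 : MvPolynomial.eval v ((Pi.single i 1 : Fin n → MvPolynomial (Fin n) ℂ) j) =
        (Pi.single i (1 : ℂ) : Fin n → ℂ) j := by
      by_cases hij : j = i
      · subst hij; simp
      · simp [Pi.single_eq_of_ne hij]
    rw [h3]
    ring

theorem differentiable_eval_mvPolynomial {n : ℕ} (Q : MvPolynomial (Fin n) ℂ) :
    Differentiable ℂ fun v : Fin n → ℂ => MvPolynomial.eval v Q := by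
  simp only [MvPolynomial.eval_eq']
  fun_prop

theorem fderiv_eval_ne_zero {n : ℕ} {Q : MvPolynomial (Fin n) ℂ} {v : Fin n → ℂ} {i : Fin n}
    (h : MvPolynomial.eval v (MvPolynomial.pderiv i Q) ≠ 0) :
    fderiv ℂ (fun v : Fin n → ℂ => MvPolynomial.eval v Q) v ≠ 0 := by
  intro h0
  apply h
  have h1 := ((differentiable_eval_mvPolynomial Q) (v + (0 : ℂ) • Pi.single i 1)).hasFDerivAt
  have h2 : HasDerivAt (fun t : ℂ => v + t • (Pi.single i (1 : ℂ) : Fin n → ℂ)) (Pi.single i 1) 0 := by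
    simpa using ((hasDerivAt_id (0 : ℂ)).smul_const (Pi.single i (1 : ℂ) : Fin n → ℂ)).const_add v
  have h3 := h1.comp_hasDerivAt 0 h2
  have h4 := (hasDerivAt_eval_add_smul_single Q v i).unique h3
  rw [h4]
  simp [h0]

section LocalBound

variable {n d k m μ : ℕ} {Q : MvPolynomial (Fin (n + 1)) ℂ}

/-- `G` represents `f` near `z`. -/
def RepresentsAt (G : ℂ → Fin (n + 1) → ℂ) (f : ℂ → Pn n) (z : ℂ) : Prop :=
  AnalyticAt ℂ G z ∧ ∀ᶠ w in 𝓝 z, ∃ h : G w ≠ 0, Projectivization.mk ℂ (G w) h = f w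

theorem RepresentsAt.onCone_eventuallyEq {G : ℂ → Fin (n + 1) → ℂ} {f : ℂ → Pn n} {z : ℂ}
    (hG : RepresentsAt G f z) (φ : Pn n → Fin n → ℂ) (i : Fin n) :
    (fun w => φ (f w) i) =ᶠ[𝓝 z] fun w => onCone φ (G w) i := by
  filter_upwards [hG.2] with w ⟨h, hw⟩
  rw [onCone_of_ne_zero φ h, hw]

/-- Near D the distinguished coordinate is Q · exp ℓ with ℓ holomorphic. Its logarithmic derivative
along the curve is that of Q(G) plus the derivative of ℓ(G), and only the latter needs a local
bound, which survives on D. The other coordinates are holomorphic compositions. -/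
theorem LogChart.exists_bound_jetAlong (hQ : IsSmoothEquation Q d) (c : LogChart Q)
    {v₀ : Fin (n + 1) → ℂ} (hv₀ : v₀ ∈ cone c.source) (p : Fin k × Fin n) :
    ∃ V ∈ 𝓝 v₀, ∃ C : ℝ, 0 ≤ C ∧ ∀ (f : ℂ → Pn n) (G : ℂ → Fin (n + 1) → ℂ) (z : ℂ) (D : ℝ),
      RepresentsAt G f z → G z ∈ V → MvPolynomial.eval (G z) Q ≠ 0 → 1 ≤ D →
      (∀ i, 1 ≤ i → i ≤ k → ‖iteratedDeriv i G z‖ ≤ D) →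
      (∀ j < k, ‖iteratedDeriv j (logDeriv fun w => MvPolynomial.eval (G w) Q) z‖ ≤ D) →
      ‖c.jetAlong k f z p‖ ≤ C * D ^ k := by
  have hk : 1 ≤ k := Nat.one_le_iff_ne_zero.2 fun h => by
    have := p.1.2
    omega
  have hΦ : DifferentiableOn ℂ (fun v => onCone c.coord v p.2) (cone c.source) :=
    differentiableOn_pi.1 c.holomorphic p.2
  by_cases hp : p.2 ∈ c.logIndex
  -- Submersivity of the chart on the cone makes the distinguished coordinate vanish only to first
  -- order, as the division argument requires.
  · have hΦ' : fderiv ℂ (fun v => onCone c.coord v p.2) v₀ ≠ 0 := by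
      intro h0
      obtain ⟨w, hw⟩ := c.submersive v₀ hv₀ (Pi.single p.2 1)
      have h1 : HasFDerivAt (fun v => onCone c.coord v p.2)
          ((ContinuousLinearMap.proj p.2).comp (fderiv ℂ (onCone c.coord) v₀)) v₀ :=
        hasFDerivAt_pi'.1 ((c.holomorphic.differentiableAt
          (c.isOpen_source.mem_nhds hv₀)).hasFDerivAt) p.2
      rw [h1.fderiv] at h0
      have h2 := congrArg (fun L => L w) h0
      simp [hw] at h2
    have hzero : ∀ v ∈ cone c.source,
        MvPolynomial.eval v Q = 0 ↔ onCone c.coord v p.2 = 0 := by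
      rintro v ⟨hv0, hv⟩
      rw [← mk_mem_hypersurface_iff hQ.homogeneous hv0, c.mem_hypersurface_iff _ hv,
        onCone_of_ne_zero c.coord hv0]
      refine ⟨fun ⟨i, hi, h⟩ => ?_, fun h => ⟨p.2, hp, h⟩⟩
      rwa [Option.mem_unique hp hi]
    obtain ⟨V, ℓ, hV, hvV, hVW, hℓ, hmul⟩ := exists_eq_mul_exp c.isOpen_source hΦ
      (differentiable_eval_mvPolynomial Q).differentiableOn hv₀
      (fun h => by
        obtain ⟨i, hi⟩ := hQ.smooth v₀ hv₀.1 h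
        exact fderiv_eval_ne_zero hi) (fun _ => hΦ') hzero
    obtain ⟨V', hV', C, hC, hbound⟩ := exists_bound_iteratedDeriv_comp hV hℓ hvV k
    refine ⟨V ∩ V', inter_mem (hV.mem_nhds hvV) hV', 1 + C, by positivity, ?_⟩
    intro f G z D hG hGz hqz hD hGD hqD
    have hqa : AnalyticAt ℂ (fun w => MvPolynomial.eval (G w) Q) z :=
      analyticAt_comp_of_differentiableOn hG.1 isOpen_univ
        (differentiable_eval_mvPolynomial Q).differentiableOn (Set.mem_univ _)
    have hℓa : AnalyticAt ℂ (fun w => ℓ (G w)) z :=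
      analyticAt_comp_of_differentiableOn hG.1 hV hℓ hGz.1
    have hX : (fun w => c.coord (f w) p.2) =ᶠ[𝓝 z]
        fun w => MvPolynomial.eval (G w) Q * Complex.exp (ℓ (G w)) := by
      filter_upwards [hG.onCone_eventuallyEq c.coord p.2,
        hG.1.continuousAt.preimage_mem_nhds (hV.mem_nhds hGz.1)] with w h1 h2
      rw [h1, hmul _ h2]
    have hlog : (logDeriv fun w => c.coord (f w) p.2) =ᶠ[𝓝 z]
        fun w => logDeriv (fun w => MvPolynomial.eval (G w) Q) w + deriv (fun w => ℓ (G w)) w := by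
      filter_upwards [hX.eventuallyEq_nhds, hqa.eventually_analyticAt,
        hℓa.eventually_analyticAt, hqa.continuousAt.eventually_ne hqz] with w h1 h2 h3 h4
      rw [logDeriv_apply, h1.deriv_eq, h1.eq_of_nhds, ← logDeriv_apply,
        logDeriv_mul (g := fun w => Complex.exp (ℓ (G w))) w h4 (Complex.exp_ne_zero _) h2.differentiableAt
          h3.differentiableAt.cexp]
      congr 1
      rw [logDeriv_apply, h3.differentiableAt.hasDerivAt.cexp.deriv,
        mul_div_cancel_left₀ _ (Complex.exp_ne_zero _)]
    simp only [LogChart.jetAlong, hp, if_true]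
    rw [hlog.iteratedDeriv_eq, iteratedDeriv_fun_add
      (hqa.logDeriv_of_ne_zero hqz).contDiffAt hℓa.deriv.contDiffAt]
    have h1 := hqD p.1 p.1.2
    have h2 := hbound G z D hG.1 hGz.2 hD hGD (p.1 + 1) p.1.2
    rw [iteratedDeriv_succ'] at h2
    have h3 : D ≤ D ^ k := le_self_pow₀ hD (by omega)
    refine (norm_add_le _ _).trans ?_
    rw [add_mul, one_mul]
    exact add_le_add (h1.trans h3) h2
  · obtain ⟨V, hV, C, hC, hbound⟩ := exists_bound_iteratedDeriv_comp c.isOpen_source hΦ hv₀ k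
    refine ⟨V, hV, C, hC, fun f G z D hG hGz _ hD hGD _ => ?_⟩
    simp only [LogChart.jetAlong, hp, if_false]
    rw [(hG.onCone_eventuallyEq c.coord p.2).iteratedDeriv_eq]
    exact hbound G z D hG.1 hGz hD hGD _ p.1.2

theorem IsLocalForm.toFun_curveJet_of_mk {P : LogJetDifferential Q k m μ} {c : LogChart Q}
    {A : (Fin (n + 1) → ℂ) → MvPolynomial (Fin k × Fin n) ℂ} (hA : IsLocalForm P c A)
    {f : ℂ → Pn n} (hf : IsEntireCurve f) {z : ℂ} {v : Fin (n + 1) → ℂ} (hv : v ≠ 0)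
    (hvf : Projectivization.mk ℂ v hv = f z) (hz : f z ∈ c.source)
    (hzD : f z ∉ hypersurface Q) :
    P.toFun (curveJet k f hf z) v = ∑ α ∈ jetExponents k n m,
      (A v).coeff α * ∏ p, c.jetAlong k f z p ^ α p := by
  have h := hA.toFun_eq ⟨fun t => f (z + t), (hf z).translate⟩ (by simpa using hz)
    (by simpa using hzD) v hv (by simpa using hvf)
  rw [c.jetCoord_translate] at h
  rw [← eval_eq_sum_jetExponents (hA.weighted v ⟨hv, by rwa [hvf]⟩)]
  exact h

theorem LogJetDifferential.toFun_smul (P : LogJetDifferential Q k m μ) {f : ℂ → Pn n}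
    (hf : IsEntireCurve f) {z : ℂ} {v : Fin (n + 1) → ℂ} (hv : v ≠ 0)
    (hvf : Projectivization.mk ℂ v hv = f z) (hzD : f z ∉ hypersurface Q) {a : ℂ} (ha : a ≠ 0) :
    P.toFun (curveJet k f hf z) (a • v) = (a ^ μ)⁻¹ * P.toFun (curveJet k f hf z) v := by
  obtain ⟨c, A, hc, hA⟩ := P.exists_isLocalForm (f z)
  have hav : Projectivization.mk ℂ (a • v) (smul_ne_zero ha hv) = f z := by
    rw [← hvf, Projectivization.mk_eq_mk_iff']
    exact ⟨a, rfl⟩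
  rw [hA.toFun_curveJet_of_mk hf hv hvf hc hzD,
    hA.toFun_curveJet_of_mk hf (smul_ne_zero ha hv) hav hc hzD,
    hA.smul_eq v ⟨hv, by rwa [hvf]⟩ a ha, Finset.mul_sum]
  refine Finset.sum_congr rfl fun α _ => ?_
  rw [MvPolynomial.coeff_smul, smul_eq_mul, mul_assoc]

/-- All weights are at least 1, so the ordinary degree is at most m. -/
theorem prod_pow_le_of_mem_jetExponents {α : (Fin k × Fin n) →₀ ℕ} (hα : α ∈ jetExponents k n m)
    {y : Fin k × Fin n → ℂ} {M : ℝ} (hM : 1 ≤ M) (hy : ∀ p, ‖y p‖ ≤ M) :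
    ‖∏ p, y p ^ α p‖ ≤ M ^ m := by
  rw [norm_prod]
  calc ∏ p, ‖y p ^ α p‖ ≤ ∏ p, M ^ α p := by
        refine Finset.prod_le_prod (fun _ _ => norm_nonneg _) fun p _ => ?_
        rw [norm_pow]
        exact pow_le_pow_left₀ (norm_nonneg _) (hy p) _
    _ = M ^ ∑ p, α p := Finset.prod_pow_eq_pow_sum _ _ _
    _ ≤ M ^ m := by
        refine pow_le_pow_right₀ hM ?_
        rw [← mem_jetExponents.1 hα]
        exact Finset.sum_le_sum fun p _ => Nat.le_mul_of_pos_right _ (Nat.succ_pos _)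

/-- Coefficients are bounded near v₀ and jet-coordinates by the preceding bound. Arbitrary local
representations G are allowed because the normalization will change with the point z. -/
theorem LogJetDifferential.exists_local_bound (hQ : IsSmoothEquation Q d)
    (P : LogJetDifferential Q k m μ) {v₀ : Fin (n + 1) → ℂ} (hv₀ : v₀ ≠ 0) :
    ∃ V ∈ 𝓝 v₀, ∃ C : ℝ, 0 ≤ C ∧ ∀ (f : ℂ → Pn n) (hf : IsEntireCurve f)
      (G : ℂ → Fin (n + 1) → ℂ) (z : ℂ) (D : ℝ),
      RepresentsAt G f z → G z ∈ V → MvPolynomial.eval (G z) Q ≠ 0 → 1 ≤ D →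
      (∀ i, 1 ≤ i → i ≤ k → ‖iteratedDeriv i G z‖ ≤ D) →
      (∀ j < k, ‖iteratedDeriv j (logDeriv fun w => MvPolynomial.eval (G w) Q) z‖ ≤ D) →
      ‖P.toFun (curveJet k f hf z) (G z)‖ ≤ C * (D ^ k) ^ m := by
  obtain ⟨c, A, hc, hA⟩ := P.exists_isLocalForm (Projectivization.mk ℂ v₀ hv₀)
  have hv₀c : v₀ ∈ cone c.source := ⟨hv₀, hc⟩
  choose V hV C hC hb using fun p : Fin k × Fin n => c.exists_bound_jetAlong hQ hv₀c p
  have hcoef : ∀ α : (Fin k × Fin n) →₀ ℕ,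
      ∀ᶠ v in 𝓝 v₀, ‖(A v).coeff α‖ < ‖(A v₀).coeff α‖ + 1 := fun α =>
    (((hA.holomorphic α).continuousOn.continuousAt
      (c.isOpen_source.mem_nhds hv₀c)).norm).eventually_lt continuousAt_const (lt_add_one _)
  set M : ℝ := 1 + ∑ p, C p with hM
  have hM1 : 1 ≤ M := by
    have : 0 ≤ ∑ p, C p := Finset.sum_nonneg fun p _ => hC p
    linarith
  refine ⟨(⋂ p, V p) ∩ {v | ∀ α ∈ jetExponents k n m, ‖(A v).coeff α‖ < ‖(A v₀).coeff α‖ + 1} ∩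
    cone c.source, inter_mem (inter_mem (Filter.iInter_mem.2 hV) ((Filter.eventually_all_finset _).2
      fun α _ => hcoef α)) (c.isOpen_source.mem_nhds hv₀c),
    (∑ α ∈ jetExponents k n m, (‖(A v₀).coeff α‖ + 1)) * M ^ m, by positivity, ?_⟩
  intro f hf G z D hG hGz hqz hD hGD hqD
  obtain ⟨h0, hmk⟩ := hG.2.self_of_nhds
  have hsrc : f z ∈ c.source := by
    obtain ⟨_, h⟩ := hGz.2
    rwa [hmk] at h
  have hnD : f z ∉ hypersurface Q := by
    rw [← hmk, mk_mem_hypersurface_iff hQ.homogeneous h0]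
    exact hqz
  rw [hA.toFun_curveJet_of_mk hf h0 hmk hsrc hnD]
  have hDk : 1 ≤ D ^ k := one_le_pow₀ hD
  have hy : ∀ p, ‖c.jetAlong k f z p‖ ≤ M * D ^ k := by
    intro p
    refine (hb p f G z D hG (Set.mem_iInter.1 hGz.1.1 p) hqz hD hGD hqD).trans ?_
    gcongr
    have := Finset.single_le_sum (f := C) (fun p _ => hC p) (Finset.mem_univ p)
    linarith
  refine (norm_sum_le _ _).trans ?_
  rw [mul_assoc, ← mul_pow, Finset.sum_mul]
  refine Finset.sum_le_sum fun α hα => ?_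
  rw [norm_mul]
  gcongr
  · exact (hGz.1.2 α hα).le
  · exact prod_pow_le_of_mem_jetExponents hα (one_le_mul_of_one_le_of_one_le hM1 hDk) hy

/-- A bound for a logarithmic jet differential along normalized representations of a curve. -/
theorem LogJetDifferential.exists_bound (hQ : IsSmoothEquation Q d)
    (P : LogJetDifferential Q k m μ) :
    ∃ C : ℝ, 0 ≤ C ∧ ∀ (f : ℂ → Pn n) (hf : IsEntireCurve f)
      (G : ℂ → Fin (n + 1) → ℂ) (z : ℂ) (D : ℝ),
      RepresentsAt G f z → ‖G z‖ = 1 → MvPolynomial.eval (G z) Q ≠ 0 → 1 ≤ D →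
      (∀ i, 1 ≤ i → i ≤ k → ‖iteratedDeriv i G z‖ ≤ D) →
      (∀ j < k, ‖iteratedDeriv j (logDeriv fun w => MvPolynomial.eval (G w) Q) z‖ ≤ D) →
      ‖P.toFun (curveJet k f hf z) (G z)‖ ≤ C * (D ^ k) ^ m := by
  -- Having such a bound passes to subsets and binary unions, so compactness of the unit sphere
  -- reduces it to the local one.
  have key := (isCompact_sphere (0 : Fin (n + 1) → ℂ) 1).induction_on
    (p := fun s => ∃ C : ℝ, 0 ≤ C ∧ ∀ (f : ℂ → Pn n) (hf : IsEntireCurve f)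
      (G : ℂ → Fin (n + 1) → ℂ) (z : ℂ) (D : ℝ),
      RepresentsAt G f z → G z ∈ s → MvPolynomial.eval (G z) Q ≠ 0 → 1 ≤ D →
      (∀ i, 1 ≤ i → i ≤ k → ‖iteratedDeriv i G z‖ ≤ D) →
      (∀ j < k, ‖iteratedDeriv j (logDeriv fun w => MvPolynomial.eval (G w) Q) z‖ ≤ D) →
      ‖P.toFun (curveJet k f hf z) (G z)‖ ≤ C * (D ^ k) ^ m)
    ⟨0, le_rfl, fun _ _ _ _ _ _ h => absurd h (Set.notMem_empty _)⟩
    (fun s t hst ⟨C, hC, h⟩ => ⟨C, hC, fun f hf G z D h1 h2 => h f hf G z D h1 (hst h2)⟩)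
    (fun s t ⟨C, hC, h⟩ ⟨C', hC', h'⟩ => ⟨max C C', hC.trans (le_max_left _ _),
      fun f hf G z D h1 h2 h3 h4 h5 h6 => by
        have hD : 0 ≤ (D ^ k) ^ m := by positivity
        rcases h2 with h2 | h2
        · exact (h f hf G z D h1 h2 h3 h4 h5 h6).trans (by gcongr; exact le_max_left _ _)
        · exact (h' f hf G z D h1 h2 h3 h4 h5 h6).trans (by gcongr; exact le_max_right _ _)⟩)
    (fun v hv => by
      obtain ⟨V, hV, h⟩ := P.exists_local_bound hQ (v₀ := v) (ne_of_mem_sphere hv one_ne_zero)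
      exact ⟨V, mem_nhdsWithin_of_mem_nhds hV, h⟩)
  obtain ⟨C, hC, h⟩ := key
  exact ⟨C, hC, fun f hf G z D h1 h2 => h f hf G z D h1 (by simpa using h2)⟩

end LocalBound

/-! ### Reduction to logarithmic derivatives of quotients. -/

/-- Near z, u = u(z) exp L with L(z) = 0 and L' = u'/u. The composition bound for exp at 0 applies,
and |u(z)| ≤ 1 removes the prefactor. -/
theorem exists_bound_iteratedDeriv_of_logDeriv (k : ℕ) :
    ∃ C : ℝ, 1 ≤ C ∧ ∀ (u : ℂ → ℂ) (z : ℂ) (D : ℝ), AnalyticAt ℂ u z → u z ≠ 0 → ‖u z‖ ≤ 1 →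
      1 ≤ D → (∀ j < k, ‖iteratedDeriv j (logDeriv u) z‖ ≤ D) →
      ∀ i ≤ k, ‖iteratedDeriv i u z‖ ≤ C * D ^ k := by
  obtain ⟨V, hV, C, hC, hb⟩ := exists_bound_iteratedDeriv_comp (isOpen_univ (X := ℂ))
    Complex.differentiable_exp.differentiableOn (Set.mem_univ (0 : ℂ)) k
  refine ⟨C + 1, by linarith, fun u z D hu hz hz1 hD hj i hi => ?_⟩
  set L : ℂ → ℂ := fun w => Complex.log (u w / u z) with hL
  have hone : u z / u z = 1 := div_self hz
  have hdiv : AnalyticAt ℂ (fun w => u w / u z) z := hu.fun_div analyticAt_const hz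
  have hslit : u z / u z ∈ Complex.slitPlane := by rw [hone]; exact Complex.one_mem_slitPlane
  have hLa : AnalyticAt ℂ L z := hdiv.clog hslit
  have hLz : L z = 0 := by simp [hL]
  have hexp : u =ᶠ[𝓝 z] fun w => u z * Complex.exp (L w) := by
    filter_upwards [hu.continuousAt.eventually_ne hz] with w hw
    rw [hL, Complex.exp_log (div_ne_zero hw hz), mul_div_cancel₀ _ hz]
  have hder : deriv L =ᶠ[𝓝 z] logDeriv u := by
    filter_upwards [hu.eventually_analyticAt, hu.continuousAt.eventually_ne hz,
      hdiv.continuousAt.preimage_mem_nhds (Complex.isOpen_slitPlane.mem_nhds hslit)] with w h1 h2 h3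
    rw [((h1.differentiableAt.hasDerivAt.div_const (u z)).clog h3).deriv, logDeriv_apply]
    field_simp
  rw [hexp.iteratedDeriv_eq, iteratedDeriv_const_mul_field, norm_mul]
  have h1 := hb L z D hLa (by rw [hLz]; exact mem_of_mem_nhds hV) hD (fun i hi1 hik => by
    obtain ⟨i, rfl⟩ : ∃ i', i = i' + 1 := ⟨i - 1, by omega⟩
    rw [iteratedDeriv_succ', hder.iteratedDeriv_eq]
    exact hj i (by omega)) i hi
  have hDk : 0 ≤ D ^ k := by positivity
  calc _ ≤ 1 * (C * D ^ k) := by gcongr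
    _ ≤ _ := by rw [one_mul]; gcongr; linarith

theorem iteratedDeriv_apply_of_analyticAt {n : ℕ} (i : ℕ) :
    ∀ {G : ℂ → Fin n → ℂ} {z : ℂ}, AnalyticAt ℂ G z → ∀ s : Fin n,
      iteratedDeriv i G z s = iteratedDeriv i (fun w => G w s) z := by
  induction i with
  | zero => intro G z _ s; simp
  | succ i ih =>
    intro G z hG s
    rw [iteratedDeriv_succ', iteratedDeriv_succ', ih hG.deriv s]
    refine Filter.EventuallyEq.iteratedDeriv_eq i ?_
    filter_upwards [hG.eventually_analyticAt] with w hw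
    exact (hasDerivAt_pi.1 hw.differentiableAt.hasDerivAt s).deriv.symm

section GlobalBound

variable {n d k m μ : ℕ} {Q : MvPolynomial (Fin (n + 1)) ℂ} {F : ℂ → Fin (n + 1) → ℂ}
  {f : ℂ → Pn n}

/-- The quotients `F_s / F_l` and `Q(F) / F_l ^ d`. -/
noncomputable def quotientAlong (F : ℂ → Fin (n + 1) → ℂ) (Q : MvPolynomial (Fin (n + 1)) ℂ)
    (d : ℕ) : Option (Fin (n + 1)) → Fin (n + 1) → ℂ → ℂ
  | none, l => fun w => MvPolynomial.eval (F w) Q / F w l ^ d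
  | some s, l => fun w => F w s / F w l

open Classical in
/-- The indices of those quotients whose numerator and denominator are not identically zero. -/
noncomputable def quotientIndices (F : ℂ → Fin (n + 1) → ℂ) (k : ℕ) :
    Finset (Option (Fin (n + 1)) × Fin (n + 1) × Fin k) :=
  {a | (∃ z, F z a.2.1 ≠ 0) ∧ ∀ s ∈ a.1, ∃ z, F z s ≠ 0}

/-- The size at `z` of a derivative of a logarithmic derivative of a quotient. -/
noncomputable def quotientSize (F : ℂ → Fin (n + 1) → ℂ) (Q : MvPolynomial (Fin (n + 1)) ℂ)
    (d : ℕ) {k : ℕ} (a : Option (Fin (n + 1)) × Fin (n + 1) × Fin k) (z : ℂ) : ℝ :=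
  ‖iteratedDeriv (a.2.2 : ℕ) (logDeriv (quotientAlong F Q d a.1 a.2.1)) z‖

theorem IsReducedRepresentation.representsAt_inv_smul (hF : IsReducedRepresentation F f) {z : ℂ}
    {l : Fin (n + 1)} (hl : F z l ≠ 0) : RepresentsAt (fun w => (F w l)⁻¹ • F w) f z := by
  have hla : AnalyticAt ℂ (fun w => F w l) z := (differentiable_pi.1 hF.1 l).analyticAt z
  refine ⟨(hla.fun_inv hl).fun_smul (hF.1.analyticAt z), ?_⟩
  filter_upwards [hla.continuousAt.eventually_ne hl] with w hw
  refine ⟨smul_ne_zero (inv_ne_zero hw) (hF.ne_zero w), ?_⟩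
  rw [← (hF.2 w).2, Projectivization.mk_eq_mk_iff']
  exact ⟨_, rfl⟩

/-- With |F_l(z)| = ‖F(z)‖, the components of G = F / F_l have modulus at most 1 at z, so their
derivatives are controlled by logarithmic derivatives, and homogeneity turns P at G into P at F
times ‖F‖^μ in modulus. One factor k in the exponent comes from bounding derivatives of G, the other
and m from the bound for P. -/
theorem LogJetDifferential.exists_norm_mul_le (hQ : IsSmoothEquation Q d)
    (P : LogJetDifferential Q k m μ) (hf : IsEntireCurve f) (hF : IsReducedRepresentation F f) :
    ∃ C : ℝ, 0 < C ∧ ∀ z, (∀ i, (∃ w, F w i ≠ 0) → F z i ≠ 0) → MvPolynomial.eval (F z) Q ≠ 0 →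
      ‖P.toFun (curveJet k f hf z) (F z)‖ * ‖F z‖ ^ μ ≤
        C * (∏ a ∈ quotientIndices F k, (1 + quotientSize F Q d a z)) ^ (k * k * m) := by
  obtain ⟨C, hC, hb⟩ := P.exists_bound hQ
  obtain ⟨C₁, hC₁, hb₁⟩ := exists_bound_iteratedDeriv_of_logDeriv k
  refine ⟨(C + 1) * (C₁ ^ k) ^ m, by positivity, fun z hz hqz => ?_⟩
  -- The maximizing index l varies with z, so all quotients enter at once; a product dominates each
  -- of its factors and becomes a sum under the logarithm.
  set D := ∏ a ∈ quotientIndices F k, (1 + quotientSize F Q d a z) with hDdef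
  have hsize : ∀ a : Option (Fin (n + 1)) × Fin (n + 1) × Fin k, 0 ≤ quotientSize F Q d a z :=
    fun a => norm_nonneg _
  have hD : 1 ≤ D := Finset.one_le_prod fun a _ => by linarith [hsize a]
  have hle : ∀ a ∈ quotientIndices F k, quotientSize F Q d a z ≤ D := by
    intro a ha
    classical
    rw [hDdef, ← Finset.mul_prod_erase _ _ ha]
    have h1 : 1 ≤ ∏ a ∈ (quotientIndices F k).erase a, (1 + quotientSize F Q d a z) :=
      Finset.one_le_prod fun a _ => by linarith [hsize a]
    nlinarith [hsize a]
  obtain ⟨l, hl⟩ := exists_norm_apply_eq_norm (F z)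
  have hFz : 0 < ‖F z‖ := norm_pos_iff.2 (hF.ne_zero z)
  have hl0 : F z l ≠ 0 := norm_pos_iff.1 (by rw [hl]; exact hFz)
  set G : ℂ → Fin (n + 1) → ℂ := fun w => (F w l)⁻¹ • F w with hG
  have hGr : RepresentsAt G f z := hF.representsAt_inv_smul hl0
  have hGs : ∀ s, (fun w => G w s) = fun w => F w s / F w l := fun s => by
    funext w
    simp [hG, div_eq_inv_mul]
  have hGQ : (fun w => MvPolynomial.eval (G w) Q) = quotientAlong F Q d none l := by
    funext w
    simp only [hG, quotientAlong]
    rw [hQ.homogeneous.eval_smul_eq, inv_pow, div_eq_inv_mul]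
  have hGn : ‖G z‖ = 1 := by
    simp only [hG]
    rw [norm_smul, norm_inv, hl, inv_mul_cancel₀ hFz.ne']
  have hGq : MvPolynomial.eval (G z) Q ≠ 0 := by
    simp only [hG]
    rw [hQ.homogeneous.eval_smul_eq]
    exact mul_ne_zero (pow_ne_zero _ (inv_ne_zero hl0)) hqz
  have hDk : 1 ≤ D ^ k := one_le_pow₀ hD
  have hder : ∀ i, 1 ≤ i → i ≤ k → ‖iteratedDeriv i G z‖ ≤ C₁ * D ^ k := by
    intro i _ hi
    refine (pi_norm_le_iff_of_nonneg (by positivity)).2 fun s => ?_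
    rw [iteratedDeriv_apply_of_analyticAt i hGr.1, hGs]
    by_cases hs : ∃ w, F w s ≠ 0
    · refine hb₁ (fun w => F w s / F w l) z D ?_ (div_ne_zero (hz s hs) hl0) ?_ hD ?_ i hi
      · exact ((differentiable_pi.1 hF.1 s).analyticAt z).fun_div
          ((differentiable_pi.1 hF.1 l).analyticAt z) hl0
      · rw [norm_div, hl, div_le_one hFz]
        exact norm_le_pi_norm _ _
      · intro j hj
        refine hle (some s, l, ⟨j, hj⟩) ?_
        simp only [quotientIndices, Finset.mem_filter, Finset.mem_univ, true_and]
        exact ⟨⟨z, hl0⟩, fun s' hs' => by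
          obtain rfl := Option.some_injective _ hs'
          exact hs⟩
    · push Not at hs
      simp only [hs, zero_div]
      rw [iteratedDeriv_const]
      split_ifs <;> simp <;> positivity
  have hlog : ∀ j < k, ‖iteratedDeriv j (logDeriv fun w => MvPolynomial.eval (G w) Q) z‖ ≤
      C₁ * D ^ k := by
    intro j hj
    rw [hGQ]
    have h1 : quotientSize F Q d (none, l, ⟨j, hj⟩) z ≤ D := by
      refine hle _ ?_
      simp only [quotientIndices, Finset.mem_filter, Finset.mem_univ, true_and]
      exact ⟨⟨z, hl0⟩, fun s' hs' => by simp at hs'⟩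
    refine h1.trans ((le_self_pow₀ hD (by omega : k ≠ 0)).trans ?_)
    exact le_mul_of_one_le_left (by positivity) hC₁
  have hmain := hb f hf G z (C₁ * D ^ k) hGr hGn hGq (one_le_mul_of_one_le_of_one_le hC₁ hDk)
    hder hlog
  have hsm : F z = F z l • G z := by
    simp only [hG]
    rw [smul_smul, mul_inv_cancel₀ hl0, one_smul]
  obtain ⟨hG0, hmk⟩ := hGr.2.self_of_nhds
  have hnD : f z ∉ hypersurface Q := fun h => hqz ((hF.mem_hypersurface_iff hQ.homogeneous).1 h)
  have hval : ‖P.toFun (curveJet k f hf z) (F z)‖ * ‖F z‖ ^ μ =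
      ‖P.toFun (curveJet k f hf z) (G z)‖ := by
    have h1 := P.toFun_smul hf hG0 hmk hnD hl0
    rw [← hsm] at h1
    rw [h1, norm_mul, norm_inv, norm_pow, hl]
    field_simp
  rw [hval]
  refine hmain.trans ?_
  have : ((C₁ * D ^ k) ^ k) ^ m = (C₁ ^ k) ^ m * D ^ (k * k * m) := by
    rw [mul_pow, mul_pow, ← pow_mul D, ← pow_mul D]
  rw [this, ← mul_assoc]
  gcongr
  linarith

end GlobalBound

/-! ### Averaging the upper bound and conclusion. -/

theorem circleAverage_log_norm_add_le {ι : Type*} {u : ℂ → ℂ} (hu : Meromorphic u) {n : ℕ}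
    {F : ℂ → Fin (n + 1) → ℂ} (hF : Differentiable ℂ F) (hF0 : ∀ z, F z ≠ 0) {μ N : ℕ} {C r : ℝ}
    (hC : 0 < C) (hr : 0 ≤ r) (J : Finset ι) {g : ι → ℂ → ℝ} (hg : ∀ a ∈ J, ∀ z, 0 ≤ g a z)
    (hgi : ∀ a ∈ J, CircleIntegrable (fun z => Real.log (1 + g a z)) 0 r)
    (hu0 : ∀ z ∈ sphere (0 : ℂ) r, u z ≠ 0)
    (hle : ∀ z ∈ sphere (0 : ℂ) r, ‖u z‖ * ‖F z‖ ^ μ ≤ C * (∏ a ∈ J, (1 + g a z)) ^ N) :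
    Real.circleAverage (fun z => Real.log ‖u z‖) 0 r + μ * orderFunction F r ≤
      Real.log C + N * ∑ a ∈ J, Real.circleAverage (fun z => Real.log (1 + g a z)) 0 r := by
  have hui := circleIntegrable_log_norm_of_meromorphic hu r
  have hFi : CircleIntegrable (fun z => (μ : ℝ) • Real.log ‖F z‖) 0 r :=
    (circleIntegrable_log_norm_of_ne_zero hF hF0 r).const_fun_smul
  have hsum : CircleIntegrable (fun z => ∑ a ∈ J, Real.log (1 + g a z)) 0 r :=
    CircleIntegrable.fun_sum J hgi
  have hNsum : CircleIntegrable (fun z => (N : ℝ) • ∑ a ∈ J, Real.log (1 + g a z)) 0 r :=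
    hsum.const_fun_smul
  have h1 : Real.circleAverage (fun z => Real.log ‖u z‖ + (μ : ℝ) • Real.log ‖F z‖) 0 r ≤
      Real.circleAverage (fun z => Real.log C + (N : ℝ) • ∑ a ∈ J, Real.log (1 + g a z)) 0 r := by
    refine Real.circleAverage_mono (hui.add hFi) ((circleIntegrable_const _ _ _).add hNsum) ?_
    intro z hz
    rw [abs_of_nonneg hr] at hz
    have hpos : ∀ a ∈ J, 0 < 1 + g a z := fun a ha => by linarith [hg a ha z]
    have hu' := norm_pos_iff.2 (hu0 z hz)
    have hF' := norm_pos_iff.2 (hF0 z)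
    have h2 := Real.log_le_log (by positivity) (hle z hz)
    rw [Real.log_mul hu'.ne' (by positivity), Real.log_pow,
      Real.log_mul hC.ne' (pow_ne_zero _ (Finset.prod_pos hpos).ne'), Real.log_pow,
      Real.log_prod fun a ha => (hpos a ha).ne'] at h2
    simpa only [smul_eq_mul] using h2
  rwa [Real.circleAverage_fun_add hui hFi, Real.circleAverage_fun_smul,
    Real.circleAverage_fun_add (circleIntegrable_const _ _ _) hNsum, Real.circleAverage_const,
    Real.circleAverage_fun_smul, Real.circleAverage_fun_sum hgi, smul_eq_mul, smul_eq_mul,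
    ← orderFunction_eq_circleAverage] at h1

section Dominated

variable {n d : ℕ} {F : ℂ → Fin (n + 1) → ℂ} {Q : MvPolynomial (Fin (n + 1)) ℂ}

theorem dominatedBy_coord_pow (hF : Differentiable ℂ F) {l : Fin (n + 1)} (hl : ∃ z, F z l ≠ 0)
    (d : ℕ) : DominatedBy F d fun z => F z l ^ d := by
  refine ⟨(differentiable_pi.1 hF l).fun_pow d, ?_, 1, one_pos, fun z => ?_⟩
  · obtain ⟨z, hz⟩ := hl
    exact ⟨z, pow_ne_zero d hz⟩
  · rw [norm_pow, one_mul]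
    exact pow_le_pow_left₀ (norm_nonneg _) (norm_le_pi_norm _ _) _

theorem dominatedBy_coord (hF : Differentiable ℂ F) {l : Fin (n + 1)} (hl : ∃ z, F z l ≠ 0) :
    DominatedBy F 1 fun z => F z l := by
  simpa using dominatedBy_coord_pow hF hl 1

theorem dominatedBy_eval (hF : Differentiable ℂ F) (hQ : Q.IsHomogeneous d)
    (hq : ∃ z, MvPolynomial.eval (F z) Q ≠ 0) :
    DominatedBy F d fun z => MvPolynomial.eval (F z) Q := by
  refine ⟨differentiable_eval hF Q, hq, 1 + ∑ α ∈ Q.support, ‖Q.coeff α‖, by positivity,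
    fun z => ?_⟩
  rw [MvPolynomial.eval_eq', add_mul, Finset.sum_mul]
  refine (norm_sum_le _ _).trans (le_add_of_nonneg_of_le (by positivity)
    (Finset.sum_le_sum fun α hα => ?_))
  rw [norm_mul, norm_prod]
  have h1 := hQ (MvPolynomial.mem_support_iff.1 hα)
  rw [Finsupp.weight_apply, Finsupp.sum_fintype _ _ (by simp)] at h1
  simp only [Pi.one_apply, smul_eq_mul, mul_one] at h1
  rw [← h1, ← Finset.prod_pow_eq_pow_sum]
  gcongr with i
  rw [norm_pow]
  exact pow_le_pow_left₀ (norm_nonneg _) (norm_le_pi_norm _ _) _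

theorem isSmallErrorTerm_quotientSize {k : ℕ} (hF : Differentiable ℂ F) (hF0 : ∀ z, F z ≠ 0)
    (hQ : Q.IsHomogeneous d) (hq : ∃ z, MvPolynomial.eval (F z) Q ≠ 0)
    {a : Option (Fin (n + 1)) × Fin (n + 1) × Fin k} (ha : a ∈ quotientIndices F k) :
    IsSmallErrorTerm (fun r => max (orderFunction F r) 1) fun r =>
      Real.circleAverage (fun z => Real.log (1 + quotientSize F Q d a z)) 0 r := by
  simp only [quotientIndices, Finset.mem_filter, Finset.mem_univ, true_and] at ha
  obtain ⟨o, l, j⟩ := a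
  cases o with
  | none =>
    exact (dominatedBy_eval hF hQ hq).isSmallErrorTerm hF hF0 (dominatedBy_coord_pow hF ha.1 d) j
  | some s =>
    exact (dominatedBy_coord hF (ha.2 s rfl)).isSmallErrorTerm hF hF0 (dominatedBy_coord hF ha.1) j

theorem circleIntegrable_log_quotientSize {k : ℕ} (hF : Differentiable ℂ F) {r : ℝ} (hr : 0 ≤ r)
    (hFr : ∀ z ∈ sphere (0 : ℂ) r, ∀ i, (∃ w, F w i ≠ 0) → F z i ≠ 0)
    (hqr : ∀ z ∈ sphere (0 : ℂ) r, MvPolynomial.eval (F z) Q ≠ 0)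
    {a : Option (Fin (n + 1)) × Fin (n + 1) × Fin k} (ha : a ∈ quotientIndices F k) :
    CircleIntegrable (fun z => Real.log (1 + quotientSize F Q d a z)) 0 r := by
  simp only [quotientIndices, Finset.mem_filter, Finset.mem_univ, true_and] at ha
  obtain ⟨o, l, j⟩ := a
  have hreg : RegularOn (quotientAlong F Q d o l) (sphere 0 r) := by
    have hcoord : ∀ i, (∃ w, F w i ≠ 0) → RegularOn (fun w => F w i) (sphere 0 r) :=
      fun i hi z hz => ⟨(differentiable_pi.1 hF i).analyticAt z, hFr z hz i hi⟩
    cases o with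
    | none =>
      have h1 : RegularOn (fun z => MvPolynomial.eval (F z) Q) (sphere 0 r) := fun z hz =>
        ⟨(differentiable_eval hF Q).analyticAt z, hqr z hz⟩
      have h2 : RegularOn (fun z => F z l ^ d) (sphere 0 r) := fun z hz =>
        ⟨(hcoord l ha.1 z hz).1.fun_pow d, pow_ne_zero d (hcoord l ha.1 z hz).2⟩
      exact h1.fun_div h2
    | some s => exact (hcoord s (ha.2 s rfl)).fun_div (hcoord l ha.1)
  refine ContinuousOn.circleIntegrable hr (ContinuousOn.log ?_ fun z _ => ?_)
  · exact continuousOn_const.add (hreg.continuousOn_iteratedDeriv_logDeriv j).norm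
  · have : 0 ≤ quotientSize F Q d (o, l, j) z := norm_nonneg _
    positivity

end Dominated

/-- If T ever reaches 1, monotonicity makes the maximum equal to T outside a bounded interval.
Otherwise log max(T, 1) vanishes, and the constant 0 works whatever the value of log T. -/
theorem IsSmallErrorTerm.of_max_one {T S : ℝ → ℝ} (hT : ∀ r s, 0 ≤ r → r ≤ s → T r ≤ T s)
    (h : IsSmallErrorTerm (fun r => max (T r) 1) S) : IsSmallErrorTerm T S := by
  obtain ⟨C, h⟩ := h
  by_cases hb : ∃ r₀, 0 ≤ r₀ ∧ 1 ≤ T r₀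
  · obtain ⟨r₀, hr₀, h1⟩ := hb
    refine ⟨C, fun δ hδ => ?_⟩
    obtain ⟨E, hE, h⟩ := h δ hδ
    refine ⟨Set.Ioo 0 r₀ ∪ E, measure_union_lt_top (by simp) hE, fun r hr hrE => ?_⟩
    have h2 : r₀ ≤ r := by
      by_contra h2
      exact hrE (Or.inl ⟨hr, not_le.1 h2⟩)
    have h3 := h r hr fun h => hrE (Or.inr h)
    simp only at h3
    rwa [max_eq_left (h1.trans (hT r₀ r hr₀ h2))] at h3
  · push Not at hb
    refine ⟨0, fun δ hδ => ?_⟩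
    obtain ⟨E, hE, h⟩ := h δ hδ
    refine ⟨E, hE, fun r hr hrE => ?_⟩
    have h3 := h r hr hrE
    simp only at h3
    rw [max_eq_right (hb r hr.le).le, Real.log_one, mul_zero] at h3
    rwa [zero_mul]

theorem mainTheorem2 (n d k m μ : ℕ) (hμ : 0 < μ)
    (Q : MvPolynomial (Fin (n + 1)) ℂ) (hQ : IsSmoothEquation Q d)
    (f : ℂ → Pn n) (hf : IsEntireCurve f)
    (F : ℂ → Fin (n + 1) → ℂ) (hF : IsReducedRepresentation F f)
    (P : LogJetDifferential Q k m μ)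
    (hP : ∃ z : ℂ, f z ∉ hypersurface Q ∧ P.toFun (curveJet k f hf z) (F z) ≠ 0) :
    ∃ S : ℝ → ℝ, IsSmallErrorTerm (orderFunction F) S ∧
      ∀ r : ℝ, 1 < r →
        orderFunction F r ≤ (m : ℝ) / (μ : ℝ) * countingFunction 1 F Q r + S r := by
  -- The error term is the difference of the two sides, so all the content is in its smallness.
  refine ⟨fun r => orderFunction F r - (m : ℝ) / μ * countingFunction 1 F Q r, ?_,
    fun r _ => by simp⟩
  have hF0 := hF.ne_zero
  obtain ⟨z₀, hz₀D, hz₀⟩ := hP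
  have hqz₀ : MvPolynomial.eval (F z₀) Q ≠ 0 := fun h =>
    hz₀D ((hF.mem_hypersurface_iff hQ.homogeneous).2 h)
  have hq : ∃ z, MvPolynomial.eval (F z) Q ≠ 0 := ⟨z₀, hqz₀⟩
  set u : ℂ → ℂ := fun z => P.toFun (curveJet k f hf z) (F z) with hu
  have hum : Meromorphic u := fun a => (P.poleOrderLE_curveJet hQ.homogeneous hf hF hq a).1
  -- Identity theorem: u is analytic and nonzero at z₀, so it vanishes identically near no point.
  have hord : ∀ z, meromorphicOrderAt u z ≠ ⊤ := by
    intro z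
    refine hum.meromorphicOn.meromorphicOrderAt_ne_top_of_isPreconnected (U := Set.univ)
      isPreconnected_univ (x := z₀) (Set.mem_univ _) (Set.mem_univ _) ?_
    rw [(P.analyticAt_curveJet hQ.homogeneous hf hF
      hqz₀).meromorphicNFAt.meromorphicOrderAt_eq_zero_iff.2 hz₀]
    exact WithTop.zero_ne_top
  have hu0 : ∀ z, ∀ᶠ w in 𝓝[≠] z, u w ≠ 0 := fun z =>
    (meromorphicOrderAt_ne_top_iff_eventually_ne_zero (hum z)).1 (hord z)
  obtain ⟨C, hC, hbound⟩ := P.exists_norm_mul_le hQ hf hF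
  have hgeneric : ∀ z, ∀ᶠ w in 𝓝[≠] z, u w ≠ 0 ∧ MvPolynomial.eval (F w) Q ≠ 0 ∧
      ∀ i, (∃ w, F w i ≠ 0) → F w i ≠ 0 := fun z =>
    (hu0 z).and ((eventually_nhdsNE_ne_zero_of_entire (differentiable_eval hF.1 Q) hq z).and
      (eventually_all.2 fun i => by
        by_cases hi : ∃ w, F w i ≠ 0
        · filter_upwards [eventually_nhdsNE_ne_zero_of_entire (differentiable_pi.1 hF.1 i) hi z]
            with w hw _ using hw
        · exact Eventually.of_forall fun w h => absurd h hi))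
  -- The added 1 keeps the factor positive when k or m is 0; the surplus is harmless because the sum
  -- is nonnegative.
  have hsmall := (((isSmallErrorTerm_const (fun r => max (orderFunction F r) 1) (Real.log C -
    Real.circleAverage (fun z => Real.log ‖u z‖) 0 1)).add
    ((IsSmallErrorTerm.sum (quotientIndices F k) fun a ha =>
      isSmallErrorTerm_quotientSize hF.1 hF0 hQ.homogeneous hq ha).const_mul
        (c := ((k * k * m : ℕ) : ℝ) + 1) (by positivity))).const_mul
        (c := (μ : ℝ)⁻¹) (by positivity))
  refine IsSmallErrorTerm.of_max_one (fun r s h1 h2 => orderFunction_le_of_le hF.1 hF0 h1 h2)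
    (hsmall.mono (E := {r : ℝ | ∃ z : ℂ, ‖z‖ = r ∧ ¬ (u z ≠ 0 ∧ MvPolynomial.eval (F z) Q ≠ 0 ∧
      ∀ i, (∃ w, F w i ≠ 0) → F z i ≠ 0)})
      (by rw [(countable_norm_image_setOf_not hgeneric).measure_zero]; simp) fun r hr hrE => ?_)
  have hgen : ∀ z ∈ sphere (0 : ℂ) r, u z ≠ 0 ∧ MvPolynomial.eval (F z) Q ≠ 0 ∧
      ∀ i, (∃ w, F w i ≠ 0) → F z i ≠ 0 := by
    intro z hz
    by_contra h
    exact hrE ⟨z, by simpa using hz, h⟩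
  have hr0 : 0 ≤ r := by linarith
  have h1 := circleAverage_log_norm_add_le hum hF.1 hF0 hC hr0 (quotientIndices F k)
    (g := fun a => quotientSize F Q d a) (fun _ _ _ => norm_nonneg _)
    (fun a ha => circleIntegrable_log_quotientSize hF.1 hr0 (fun z hz => (hgen z hz).2.2)
      (fun z hz => (hgen z hz).2.1) ha)
    (fun z hz => (hgen z hz).1) fun z hz => hbound z (hgen z hz).2.2 (hgen z hz).2.1
  -- The average of log |u| is now bounded on both sides, and eliminating it leaves the estimate for
  -- μ T_f - m N.
  have h2 := P.circleAverage_log_norm_ge hQ.homogeneous hf hF hq hr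
  have h3 : 0 ≤ ∑ a ∈ quotientIndices F k,
      Real.circleAverage (fun z => Real.log (1 + quotientSize F Q d a z)) 0 r :=
    Finset.sum_nonneg fun a _ => Real.circleAverage_nonneg_of_nonneg fun z _ =>
      Real.log_nonneg (by linarith [show 0 ≤ quotientSize F Q d a z from norm_nonneg _])
  have hμ0 : (0 : ℝ) < μ := by exact_mod_cast hμ
  have h4 : orderFunction F r - (m : ℝ) / μ * countingFunction 1 F Q r =
      (μ : ℝ)⁻¹ * (μ * orderFunction F r - m * countingFunction 1 F Q r) := by
    field_simp
  simp only [h4]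
  refine mul_le_mul_of_nonneg_left ?_ (by positivity)
  linarith
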